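/- Let $n\ge 2$. By an $n$-simplex in the unit sphere $S^n\subset\mathbf R^{n+1}$, in hyperbolic space $H^n$ (hyperboloid model) or in Euclidean space $\mathbf R^n$ we mean a nondegenerate compact geodesic simplex with vertices $u_1,\dots,u_{n+1}$ in that space. Let $\theta_{ij}$ ($i\ne j$) be its dihedral angle between the codimension-1 faces opposite to $u_i$ and $u_j$, put $\theta_{ii}=\pi$, and call $A=[-\cos\theta_{ij}]\in\mathbf R^{(n+1)\times(n+1)}$ the angle Gram matrix of the simplex. Let $\mathcal X_{n+1},\mathcal Y_{n+1},\mathcal Z_{n+1}\subset\mathbf R^{(n+1)\times(n+1)}$ be the sets of angle Gram matrices of spherical, hyperbolic and Euclidean $n$-simplexes respectively, and let $\overline{\mathcal X}_{n+1},\overline{\mathcal Y}_{n+1},\overline{\mathcal Z}_{n+1}$ be their closures in $\mathbf R^{(n+1)\times(n+1)}$. The $n$-dimensional volume of spherical and hyperbolic $n$-simplexes, viewed as a function of the angle Gram matrix on $\mathcal X_{n+1}\cup\mathcal Y_{n+1}$, is well defined and extends to a continuous function $V:\overline{\mathcal X}_{n+1}\cup\overline{\mathcal Y}_{n+1}\to\mathbf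 R$ (necessarily unique). For every $A\in\overline{\mathcal X}_{n+1}\cup\overline{\mathcal Y}_{n+1}$ one has $$V(A)=0\iff A\in\overline{\mathcal Z}_{n+1}.$$ -/

import Mathlib

open MeasureTheory
open scoped RealInnerProductSpace

namespace SimplexVolume

/-- The angle Gram matrix `[-cos θ_ij]` attached to the pairwise products `g i j` of the outward unit
normals of the codimension-1 faces: the (interior) dihedral angle `θ_ij` is the supplement of the
angle between the outward normals. For `i = j` one has `g i i = 1`, so that `θ_ii = π`. -/
noncomputable def angleGram {n : ℕ} (g : Fin (n + 1) → Fin (n + 1) → ℝ) :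
    Matrix (Fin (n + 1)) (Fin (n + 1)) ℝ :=
  Matrix.of fun i j => -Real.cos (Real.pi - Real.arccos (g i j))

/-- The convex cone spanned by finitely many vectors. -/
def cone {E : Type*} [AddCommGroup E] [Module ℝ E] {n : ℕ} (u : Fin (n + 1) → E) : Set E :=
  {x | ∃ t : Fin (n + 1) → ℝ, (∀ i, 0 ≤ t i) ∧ ∑ i, t i • u i = x}

section Euclidean

/-- `v i` is the outward unit normal of the face of `s` opposite to its `i`-th vertex. -/
structure IsEuclideanNormals {n : ℕ} (s : Affine.Simplex ℝ (EuclideanSpace ℝ (Fin n)) n)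
    (v : Fin (n + 1) → EuclideanSpace ℝ (Fin n)) : Prop where
  norm_eq : ∀ i, ‖v i‖ = 1
  orth : ∀ i j k, j ≠ i → k ≠ i → ⟪v i, s.points j - s.points k⟫ = 0
  outward : ∀ i j, j ≠ i → ⟪v i, s.points i - s.points j⟫ < 0

/-- Angle Gram matrices of Euclidean `n`-simplexes. -/
def euclideanGram (n : ℕ) : Set (Matrix (Fin (n + 1)) (Fin (n + 1)) ℝ) :=
  {A | ∃ s v, IsEuclideanNormals (n := n) s v ∧ A = angleGram fun i j => ⟪v i, v j⟫}

end Euclidean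

section Spherical

/-- `u` is the family of vertices of a (nondegenerate) `n`-simplex in the unit sphere of `ℝ^(n+1)`. -/
structure IsSphericalSimplex {n : ℕ} (u : Fin (n + 1) → EuclideanSpace ℝ (Fin (n + 1))) : Prop where
  norm_eq : ∀ i, ‖u i‖ = 1
  linearIndependent : LinearIndependent ℝ u

/-- `v i` is the outward unit normal of the (great-sphere) face opposite to the vertex `u i`. -/
structure IsSphericalNormals {n : ℕ} (u v : Fin (n + 1) → EuclideanSpace ℝ (Fin (n + 1))) :
    Prop where
  norm_eq : ∀ i, ‖v i‖ = 1
  orth : ∀ i j, j ≠ i → ⟪v i, u j⟫ = 0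
  outward : ∀ i, ⟪v i, u i⟫ < 0

/-- `A` is the angle Gram matrix of the spherical simplex with vertices `u`. -/
def HasSphericalGram {n : ℕ} (u : Fin (n + 1) → EuclideanSpace ℝ (Fin (n + 1)))
    (A : Matrix (Fin (n + 1)) (Fin (n + 1)) ℝ) : Prop :=
  IsSphericalSimplex u ∧ ∃ v, IsSphericalNormals u v ∧ A = angleGram fun i j => ⟪v i, v j⟫

/-- Angle Gram matrices of spherical `n`-simplexes. -/
def sphericalGram (n : ℕ) : Set (Matrix (Fin (n + 1)) (Fin (n + 1)) ℝ) :=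
  {A | ∃ u, HasSphericalGram u A}

/-- The `n`-dimensional volume (surface measure of the unit sphere) of the spherical simplex with
vertices `u`, which is the intersection of the sphere with the cone over `u`. -/
noncomputable def sphericalVolume {n : ℕ} (u : Fin (n + 1) → EuclideanSpace ℝ (Fin (n + 1))) : ℝ :=
  ((volume : Measure (EuclideanSpace ℝ (Fin (n + 1)))).toSphere
    {x | (x : EuclideanSpace ℝ (Fin (n + 1))) ∈ cone u}).toReal

end Spherical

section Hyperbolic

/-- Minkowski space `ℝ^{n,1}`: the second component is the time coordinate. -/
abbrev Minkowski (n : ℕ) : Type := EuclideanSpace ℝ (Fin n) × ℝ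

/-- The Lorentz product `x₁y₁ + ... + xₙyₙ - xₙ₊₁yₙ₊₁`. -/
noncomputable def lorentz {n : ℕ} (x y : Minkowski n) : ℝ := ⟪x.1, y.1⟫ - x.2 * y.2

/-- `u` is the family of vertices of a (nondegenerate, compact) `n`-simplex in the hyperboloid
`H^n = {x | ⟨x, x⟩ = -1, xₙ₊₁ > 0}`. -/
structure IsHyperbolicSimplex {n : ℕ} (u : Fin (n + 1) → Minkowski n) : Prop where
  lorentz_self : ∀ i, lorentz (u i) (u i) = -1
  pos : ∀ i, 0 < (u i).2
  linearIndependent : LinearIndependent ℝ u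

/-- `v i` is the outward unit normal (in de Sitter space) of the face opposite to `u i`. -/
structure IsHyperbolicNormals {n : ℕ} (u v : Fin (n + 1) → Minkowski n) : Prop where
  lorentz_self : ∀ i, lorentz (v i) (v i) = 1
  orth : ∀ i j, j ≠ i → lorentz (v i) (u j) = 0
  outward : ∀ i, lorentz (v i) (u i) < 0

/-- `A` is the angle Gram matrix of the hyperbolic simplex with vertices `u`. -/
def HasHyperbolicGram {n : ℕ} (u : Fin (n + 1) → Minkowski n)
    (A : Matrix (Fin (n + 1)) (Fin (n + 1)) ℝ) : Prop :=
  IsHyperbolicSimplex u ∧ ∃ v, IsHyperbolicNormals u v ∧ A = angleGram fun i j => lorentz (v i) (v j)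

/-- Angle Gram matrices of hyperbolic `n`-simplexes. -/
def hyperbolicGram (n : ℕ) : Set (Matrix (Fin (n + 1)) (Fin (n + 1)) ℝ) :=
  {A | ∃ u, HasHyperbolicGram u A}

/-- The global chart `x ↦ (x, √(1 + |x|²))` of the hyperboloid. -/
noncomputable def hyperboloidChart {n : ℕ} (x : EuclideanSpace ℝ (Fin n)) : Minkowski n :=
  (x, √(1 + ‖x‖ ^ 2))

/-- The hyperbolic volume of the simplex with vertices `u` (the intersection of the hyperboloid with
the cone over `u`). In the global chart the Riemannian metric of the hyperboloid is
`g_ij = δ_ij - x_i x_j / (1 + |x|²)`, and its volume density `√(det g)` is `1 / √(1 + |x|²)`. -/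
noncomputable def hyperbolicVolume {n : ℕ} (u : Fin (n + 1) → Minkowski n) : ℝ :=
  (∫⁻ x in {x : EuclideanSpace ℝ (Fin n) | hyperboloidChart x ∈ cone u},
    ENNReal.ofReal (1 / √(1 + ‖x‖ ^ 2))).toReal

end Hyperbolic

/-- `V` is a continuous extension, to the union of the closures of the sets of angle Gram matrices of
spherical and of hyperbolic `n`-simplexes, of the volume as a function of the angle Gram matrix. -/
structure IsExtendedVolume (n : ℕ) (V : Matrix (Fin (n + 1)) (Fin (n + 1)) ℝ → ℝ) : Prop where
  continuousOn : ContinuousOn V (closure (sphericalGram n) ∪ closure (hyperbolicGram n))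
  spherical : ∀ u A, HasSphericalGram u A → V A = sphericalVolume u
  hyperbolic : ∀ u A, HasHyperbolicGram u A → V A = hyperbolicVolume u

end SimplexVolume

/-! The volume has one explicit formula on positive semidefinite matrices and another on the
remaining ones (`gramVolume`). Convergence to these values at every limit matrix gives the extension
and its uniqueness, and leaves the zeros of the formulas to be found.

If `A` is positive semidefinite, the rows of `CFC.sqrt A` are vectors with Gram matrix `A`, so a
spherical simplex has `n + 1` times the volume of the part of the unit ball that they cut out
(`polarBody`). This is continuous because the rows never vanish. By Gordan's alternative it is zero
exactly when `A` kills a nonzero nonnegative vector (`volume_polarBody_eq_zero_iff`). Such matrices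
with unit diagonal are exactly the limits of Euclidean ones: normals of a Euclidean simplex satisfy
a positive linear relation, and conversely a nonnegative null vector can be perturbed to a positive
one spanning the kernel (`mem_closure_euclideanGram`).

If `A` is hyperbolic, `C = -A⁻¹` is minus the Lorentz Gram matrix of suitably scaled vertices. Polar
coordinates in Minkowski space give the volume as `n + 1` times `√|det C|` times the Lebesgue
measure of the nonnegative `t` with `t ⬝ᵥ C *ᵥ t < 1` (`normVolume`).

At a limit that is not positive semidefinite, `A` stays invertible and the off-diagonal entries of
`C` stay positive, although diagonal entries may vanish (ideal vertices). Bounded pairwise products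
of coordinates already give a finite volume in dimension at least three, so dominated convergence
applies, and the limit volume is positive and finite.

At a positive semidefinite limit the inradius tends to zero. Coning the facets from the incenter
bounds the volume by a constant times `σ^(-1/2)`, the hyperbolic sine of the inradius, where `σ` is
the sum of the entries of `C` (`exists_normVolume_le_inradius`); `σ⁻¹` is in turn at most the
entrywise distance to any positive semidefinite matrix (`inv_sum_le`). So the volume tends to zero,
in agreement with the first formula, because the limit of the incenter weights is a nonnegative null
vector. -/

namespace SimplexVolume

/-! ### Sublevel sets of quadratic forms in the orthant: finiteness and continuity of their volume
-/

open Filter Topology Matrix Pointwise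

/-- The part of the positive orthant on which the quadratic form of `C` is less than `1`. -/
def orthantBody {k : ℕ} (C : Matrix (Fin k) (Fin k) ℝ) : Set (Fin k → ℝ) :=
  {t | (∀ i, 0 ≤ t i) ∧ t ⬝ᵥ C *ᵥ t < 1}

lemma quad_eq_sum {k : ℕ} (C : Matrix (Fin k) (Fin k) ℝ) (s t : Fin k → ℝ) :
    s ⬝ᵥ C *ᵥ t = ∑ i, ∑ j, C i j * (s i * t j) := by
  simp only [dotProduct, mulVec, Finset.mul_sum]
  refine Finset.sum_congr rfl fun i _ => Finset.sum_congr rfl fun j _ => by ring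

lemma continuous_quad {k : ℕ} (C : Matrix (Fin k) (Fin k) ℝ) :
    Continuous fun t : Fin k → ℝ => t ⬝ᵥ C *ᵥ t := by
  simp only [quad_eq_sum]
  fun_prop

lemma measurableSet_nonneg {k : ℕ} : MeasurableSet {t : Fin k → ℝ | ∀ i, 0 ≤ t i} := by
  have : {t : Fin k → ℝ | ∀ i, 0 ≤ t i} = Set.Ici 0 := by
    ext t; simp [Pi.le_def]
  rw [this]
  exact isClosed_Ici.measurableSet

lemma measurableSet_orthantBody {k : ℕ} (C : Matrix (Fin k) (Fin k) ℝ) :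
    MeasurableSet (orthantBody C) :=
  measurableSet_nonneg.inter (isOpen_lt (continuous_quad C) continuous_const).measurableSet

lemma quad_smul {k : ℕ} (C : Matrix (Fin k) (Fin k) ℝ) (r : ℝ) (t : Fin k → ℝ) :
    (r • t) ⬝ᵥ C *ᵥ (r • t) = r ^ 2 * (t ⬝ᵥ C *ᵥ t) := by
  simp only [mulVec_smul, dotProduct_smul, smul_dotProduct, smul_eq_mul]
  ring

/-- Slicing Lebesgue measure along one coordinate. -/
lemma volume_eq_lintegral_slices {m : ℕ} (i : Fin (m + 1)) {s : Set (Fin (m + 1) → ℝ)}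
    (hs : MeasurableSet s) :
    volume s = ∫⁻ x : ℝ, volume {t : Fin m → ℝ | (i.insertNth x t : Fin (m + 1) → ℝ) ∈ s} := by
  have h := (volume_preserving_piFinSuccAbove (fun _ : Fin (m + 1) => ℝ) i).symm
  rw [← h.measure_preimage hs.nullMeasurableSet, Measure.volume_eq_prod, Measure.prod_apply]
  · rfl
  · exact h.measurable hs

/-- In dimension at least three, the part of the orthant where all products of two coordinates are
bounded has finite volume. -/
lemma volume_pairwise_mul_lt_lt_top {k : ℕ} (hk : 3 ≤ k) {M : ℝ} (hM : 0 < M) :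
    volume {t : Fin k → ℝ | (∀ i, 0 ≤ t i) ∧ ∀ i j, i ≠ j → t i * t j < M} < ⊤ := by
  obtain ⟨m, rfl⟩ : ∃ m, k = m + 1 := ⟨k - 1, by omega⟩
  have hm : 2 ≤ m := by omega
  set g : ℝ → ℝ := fun x => min x (M / x) with hg
  set W : Fin (m + 1) → Set (Fin (m + 1) → ℝ) := fun i =>
    {t | 0 ≤ t i ∧ ∀ j : Fin m, t (i.succAbove j) ∈ Set.Icc 0 (g (t i))} with hW
  have hsub : {t : Fin (m + 1) → ℝ | (∀ i, 0 ≤ t i) ∧ ∀ i j, i ≠ j → t i * t j < M} ⊆ ⋃ i, W i := by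
    rintro t ⟨h0, h1⟩
    -- Cover by the regions where a given coordinate `x` is largest; there every other coordinate is
    -- at most both `x` and `M / x`.
    obtain ⟨i, hi⟩ := Finite.exists_max t
    refine Set.mem_iUnion.2 ⟨i, h0 i, fun j => ⟨h0 _, le_min (hi _) ?_⟩⟩
    rcases (h0 i).eq_or_lt with h | h
    · have := hi (i.succAbove j)
      rw [← h] at this ⊢
      simpa using this
    · rw [le_div_iff₀ h]
      exact (h1 _ _ (Fin.succAbove_ne i j)).le
  refine (measure_mono hsub).trans_lt ((measure_iUnion_le W).trans_lt ?_)
  rw [tsum_fintype, ENNReal.sum_lt_top]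
  intro i _
  have hgm : Measurable g := by fun_prop
  have hWm : MeasurableSet (W i) := by
    have : W i = {t | 0 ≤ t i} ∩ ⋂ j : Fin m, ({t | 0 ≤ t (i.succAbove j)} ∩
        {t | t (i.succAbove j) ≤ g (t i)}) := by
      ext t; simp [hW]
    rw [this]
    refine (measurableSet_le measurable_const (measurable_pi_apply i)).inter
      (MeasurableSet.iInter fun j => (measurableSet_le measurable_const (measurable_pi_apply _)).inter
        (measurableSet_le (measurable_pi_apply _) (hgm.comp (measurable_pi_apply i))))
  rw [volume_eq_lintegral_slices i hWm]
  -- Since `g ^ 2 ≤ M` and `g * x ≤ M`, two of the `m` factors `g` absorb `1 + x ^ 2`, and each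
  -- remaining one is at most `√M`. This is where `2 ≤ m` enters.
  set K : ℝ := (√M) ^ (m - 2) * (M + M ^ 2) with hK
  have hbound : ∀ x : ℝ, volume {t : Fin m → ℝ | (i.insertNth x t : Fin (m + 1) → ℝ) ∈ W i} ≤
      ENNReal.ofReal (K * (1 + x ^ 2)⁻¹) := by
    intro x
    rcases lt_or_ge x 0 with hx | hx
    · have : {t : Fin m → ℝ | (i.insertNth x t : Fin (m + 1) → ℝ) ∈ W i} = ∅ := by
        ext t; simp [hW, hx]
      rw [this]; simp
    · have : {t : Fin m → ℝ | (i.insertNth x t : Fin (m + 1) → ℝ) ∈ W i} ⊆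
          Set.Icc 0 (fun _ => g x) := by
        intro t ht
        simp only [hW, Set.mem_ofPred_eq, Fin.insertNth_apply_same, Fin.insertNth_apply_succAbove] at ht
        exact ⟨fun j => (ht.2 j).1, fun j => (ht.2 j).2⟩
      refine (measure_mono this).trans ?_
      have hg0 : 0 ≤ g x := le_min hx (by positivity)
      rw [Real.volume_Icc_pi]
      simp only [Pi.zero_apply, sub_zero, Finset.prod_const, Finset.card_univ, Fintype.card_fin]
      rw [← ENNReal.ofReal_pow hg0]
      refine ENNReal.ofReal_le_ofReal ?_
      rw [← div_eq_mul_inv, le_div_iff₀ (by positivity)]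
      have h1 : g x ≤ x := min_le_left _ _
      have h2 : g x * x ≤ M := by
        rcases hx.eq_or_lt with h | h
        · rw [← h]; simp [hM.le]
        · calc g x * x ≤ M / x * x := by gcongr; exact min_le_right _ _
            _ = M := by field_simp
      have h3 : g x ^ 2 ≤ M := by nlinarith
      have h4 : g x ≤ √M := Real.le_sqrt_of_sq_le h3
      have h5 : g x ^ 2 * (1 + x ^ 2) ≤ M + M ^ 2 := by
        have : (g x * x) ^ 2 ≤ M ^ 2 := by gcongr
        nlinarith
      calc g x ^ m * (1 + x ^ 2) = g x ^ (m - 2) * (g x ^ 2 * (1 + x ^ 2)) := by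
            rw [← mul_assoc, ← pow_add]; congr 2; omega
        _ ≤ K := by rw [hK]; gcongr
  refine (lintegral_mono hbound).trans_lt ?_
  have hint : Integrable fun x : ℝ => K * (1 + x ^ 2)⁻¹ := integrable_inv_one_add_sq.const_mul K
  exact hint.lintegral_lt_top

lemma smul_orthantBody {k : ℕ} (C : Matrix (Fin k) (Fin k) ℝ) {r : ℝ} (hr : 0 < r) :
    r • orthantBody C = {t | (∀ i, 0 ≤ t i) ∧ t ⬝ᵥ C *ᵥ t < r ^ 2} := by
  ext t
  rw [Set.mem_smul_set_iff_inv_smul_mem₀ hr.ne']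
  simp only [orthantBody, Set.mem_ofPred_eq, quad_smul, Pi.smul_apply, smul_eq_mul]
  have h1 : ∀ i, 0 ≤ r⁻¹ * t i ↔ 0 ≤ t i := fun i => by
    constructor
    · intro h; by_contra h'; push Not at h'
      have := mul_neg_of_pos_of_neg (inv_pos.2 hr) h'
      linarith
    · intro h; positivity
  have h2 : r⁻¹ ^ 2 * (t ⬝ᵥ C *ᵥ t) < 1 ↔ t ⬝ᵥ C *ᵥ t < r ^ 2 := by
    rw [inv_pow, inv_mul_lt_iff₀ (by positivity), mul_one]
  simp only [h1, h2]

lemma volume_quad_lt_sq {k : ℕ} (C : Matrix (Fin k) (Fin k) ℝ) {r : ℝ} (hr : 0 < r) :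
    volume {t : Fin k → ℝ | (∀ i, 0 ≤ t i) ∧ t ⬝ᵥ C *ᵥ t < r ^ 2} =
      ENNReal.ofReal (r ^ k) * volume (orthantBody C) := by
  rw [← smul_orthantBody C hr, Measure.addHaar_smul, abs_of_pos (by positivity)]
  simp

/-- The level set and the body together fit into every dilate of the body by a factor `r > 1`.
Letting `r` tend to `1` leaves no room for the level set when the body has finite volume. -/
lemma volume_quad_eq_one {k : ℕ} (C : Matrix (Fin k) (Fin k) ℝ) (hC : volume (orthantBody C) ≠ ⊤) :
    volume {t : Fin k → ℝ | (∀ i, 0 ≤ t i) ∧ t ⬝ᵥ C *ᵥ t = 1} = 0 := by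
  set L := {t : Fin k → ℝ | (∀ i, 0 ≤ t i) ∧ t ⬝ᵥ C *ᵥ t = 1} with hL
  have hle : ∀ r : ℝ, 1 < r → volume L + volume (orthantBody C) ≤
      ENNReal.ofReal (r ^ k) * volume (orthantBody C) := by
    intro r hr
    rw [← volume_quad_lt_sq C (by linarith), ← measure_union _ (measurableSet_orthantBody C)]
    · refine measure_mono ?_
      rintro t (ht | ht)
      · exact ⟨ht.1, by rw [ht.2]; nlinarith⟩
      · exact ⟨ht.1, by have := ht.2; nlinarith⟩
    · rw [Set.disjoint_left]
      rintro t ht ht'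
      exact absurd ht.2 ht'.2.ne
  have hlim : Tendsto (fun r : ℝ => ENNReal.ofReal (r ^ k) * volume (orthantBody C)) (𝓝[>] 1)
      (𝓝 (ENNReal.ofReal (1 ^ k) * volume (orthantBody C))) := by
    refine ENNReal.Tendsto.mul_const ?_ (Or.inr hC)
    refine ENNReal.tendsto_ofReal (tendsto_nhdsWithin_of_tendsto_nhds ?_)
    exact (continuous_pow k).tendsto 1
  have := ge_of_tendsto hlim (eventually_nhdsWithin_of_forall fun r hr => hle r hr)
  simp only [one_pow, ENNReal.ofReal_one, one_mul] at this
  have h2 : volume L + volume (orthantBody C) ≤ 0 + volume (orthantBody C) := by simpa using this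
  exact le_antisymm ((ENNReal.add_le_add_iff_right hC).1 h2) bot_le

lemma single_entry_le_quad {k : ℕ} {C : Matrix (Fin k) (Fin k) ℝ} (hC : ∀ i j, 0 ≤ C i j)
    {t : Fin k → ℝ} (ht : ∀ i, 0 ≤ t i) (i j : Fin k) : C i j * (t i * t j) ≤ t ⬝ᵥ C *ᵥ t := by
  rw [quad_eq_sum]
  have h : ∀ i j, 0 ≤ C i j * (t i * t j) := fun i j => mul_nonneg (hC i j) (mul_nonneg (ht i) (ht j))
  exact (Finset.single_le_sum (f := fun j => C i j * (t i * t j)) (fun j _ => h i j)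
    (Finset.mem_univ j)).trans
    (Finset.single_le_sum (f := fun i => ∑ j, C i j * (t i * t j))
      (fun i _ => Finset.sum_nonneg fun j _ => h i j) (Finset.mem_univ i))

lemma exists_pos_forall_lt_off_diagonal {k : ℕ} {C : Matrix (Fin k) (Fin k) ℝ}
    (hoff : ∀ i j, i ≠ j → 0 < C i j) : ∃ ε, 0 < ε ∧ ∀ i j, i ≠ j → ε < C i j := by
  have h : ∀ᶠ ε in 𝓝[>] (0 : ℝ), ∀ i j, i ≠ j → ε < C i j := by
    refine eventually_all.2 fun i => eventually_all.2 fun j => ?_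
    rcases eq_or_ne i j with rfl | hij
    · exact Eventually.of_forall fun a h => absurd rfl h
    · exact (eventually_nhdsWithin_of_eventually_nhds (eventually_lt_nhds (hoff i j hij))).mono
        fun a ha _ => ha
  obtain ⟨ε, h1, h2⟩ := (h.and self_mem_nhdsWithin).exists
  exact ⟨ε, h2, h1⟩

lemma orthantBody_subset {k : ℕ} {C : Matrix (Fin k) (Fin k) ℝ} {ε : ℝ} (hε : 0 < ε)
    (hC : ∀ i j, 0 ≤ C i j) (hoff : ∀ i j, i ≠ j → ε ≤ C i j) :
    orthantBody C ⊆ {t | (∀ i, 0 ≤ t i) ∧ ∀ i j, i ≠ j → t i * t j < ε⁻¹} := by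
  rintro t ⟨h0, h1⟩
  refine ⟨h0, fun i j hij => ?_⟩
  have h2 := single_entry_le_quad hC h0 i j
  have h3 : ε * (t i * t j) ≤ C i j * (t i * t j) :=
    mul_le_mul_of_nonneg_right (hoff i j hij) (mul_nonneg (h0 i) (h0 j))
  rw [← one_div, lt_div_iff₀ hε]
  linarith

/-- Only off-diagonal positivity is needed, so zero diagonal entries, which correspond to ideal
vertices, are allowed. -/
lemma volume_orthantBody_lt_top {k : ℕ} (hk : 3 ≤ k) {C : Matrix (Fin k) (Fin k) ℝ}
    (hC : ∀ i, 0 ≤ C i i) (hoff : ∀ i j, i ≠ j → 0 < C i j) : volume (orthantBody C) < ⊤ := by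
  obtain ⟨ε, hε, h⟩ := exists_pos_forall_lt_off_diagonal hoff
  refine (measure_mono (orthantBody_subset hε (fun i j => ?_) fun i j hij => (h i j hij).le)).trans_lt
    (volume_pairwise_mul_lt_lt_top hk (inv_pos.2 hε))
  rcases eq_or_ne i j with rfl | hij
  · exact hC i
  · exact (hoff i j hij).le

/-- The volume of the orthant body depends continuously on the matrix, as long as the limit has
positive off-diagonal entries. -/
lemma tendsto_volume_orthantBody {α : Type*} {l : Filter α} [l.IsCountablyGenerated] {k : ℕ}
    (hk : 3 ≤ k) {C : α → Matrix (Fin k) (Fin k) ℝ} {C₀ : Matrix (Fin k) (Fin k) ℝ}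
    (hlim : Tendsto C l (𝓝 C₀)) (hdiag : ∀ᶠ a in l, ∀ i, 0 ≤ C a i i) (hdiag₀ : ∀ i, 0 ≤ C₀ i i)
    (hoff : ∀ i j, i ≠ j → 0 < C₀ i j) :
    Tendsto (fun a => volume (orthantBody (C a))) l (𝓝 (volume (orthantBody C₀))) := by
  obtain ⟨ε, hε, h⟩ := exists_pos_forall_lt_off_diagonal hoff
  have hent : ∀ i j, Tendsto (fun a => C a i j) l (𝓝 (C₀ i j)) := fun i j =>
    ((continuous_id.matrix_elem i j).tendsto C₀).comp hlim
  have hev : ∀ᶠ a in l, ∀ i j, i ≠ j → ε < C a i j := by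
    refine eventually_all.2 fun i => eventually_all.2 fun j => ?_
    rcases eq_or_ne i j with rfl | hij
    · exact Eventually.of_forall fun a h => absurd rfl h
    · exact ((hent i j).eventually_const_lt (h i j hij)).mono fun a ha _ => ha
  refine tendsto_measure_of_ae_tendsto_indicator l (measurableSet_orthantBody C₀)
    (fun a => measurableSet_orthantBody (C a))
    (B := {t | (∀ i, 0 ≤ t i) ∧ ∀ i j, i ≠ j → t i * t j < ε⁻¹}) ?_
    (volume_pairwise_mul_lt_lt_top hk (inv_pos.2 hε)).ne ?_ ?_
  · have : {t : Fin k → ℝ | (∀ i, 0 ≤ t i) ∧ ∀ i j, i ≠ j → t i * t j < ε⁻¹} =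
        {t | ∀ i, 0 ≤ t i} ∩ ⋂ i, ⋂ j, ⋂ _ : i ≠ j, {t | t i * t j < ε⁻¹} := by
      ext t; simp
    rw [this]
    refine measurableSet_nonneg.inter (MeasurableSet.iInter fun i => MeasurableSet.iInter fun j =>
      MeasurableSet.iInter fun _ => measurableSet_lt ?_ measurable_const)
    fun_prop
  · filter_upwards [hdiag, hev] with a h1 h2
    refine orthantBody_subset hε (fun i j => ?_) fun i j hij => (h2 i j hij).le
    rcases eq_or_ne i j with rfl | hij
    · exact h1 i
    · exact (hε.trans (h2 i j hij)).le
  -- Indicators converge at every point off the level set of value `1` of the limiting form, which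
  -- is null.
  · have hnull := volume_quad_eq_one C₀ (volume_orthantBody_lt_top hk hdiag₀ hoff).ne
    have : ∀ᵐ t : Fin k → ℝ, ¬ ((∀ i, 0 ≤ t i) ∧ t ⬝ᵥ C₀ *ᵥ t = 1) := by
      rw [ae_iff]; simpa using hnull
    filter_upwards [this] with t ht
    by_cases ht0 : ∀ i, 0 ≤ t i
    · have hq : Tendsto (fun a => t ⬝ᵥ C a *ᵥ t) l (𝓝 (t ⬝ᵥ C₀ *ᵥ t)) := by
        simp only [quad_eq_sum]
        exact tendsto_finsetSum _ fun i _ => tendsto_finsetSum _ fun j _ =>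
          (hent i j).mul_const _
      have hne : t ⬝ᵥ C₀ *ᵥ t ≠ 1 := fun h => ht ⟨ht0, h⟩
      rcases hne.lt_or_gt with h | h
      · filter_upwards [hq.eventually_lt_const h] with a ha
        exact ⟨fun _ => ⟨ht0, h⟩, fun _ => ⟨ht0, ha⟩⟩
      · filter_upwards [hq.eventually_const_lt h] with a ha
        exact ⟨fun h' => absurd h'.2 ha.not_gt, fun h' => absurd h'.2 h.not_gt⟩
    · exact Eventually.of_forall fun a => ⟨fun h => absurd h.1 ht0, fun h => absurd h.1 ht0⟩

end SimplexVolume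

/-! ### Lorentzian matrices and a uniform bound for hyperbolic volume -/

namespace SimplexVolume

open Filter Topology Matrix Pointwise

/-- Symmetric matrices with positive entries and exactly one positive direction: up to sign, the
Lorentz Gram matrices of families of timelike vectors in the same half of the light cone. -/
structure IsLorentzian {k : ℕ} (C : Matrix (Fin k) (Fin k) ℝ) : Prop where
  symm : C.IsSymm
  pos : ∀ i j, 0 < C i j
  neg : ∀ x y, 0 < x ⬝ᵥ C *ᵥ x → x ⬝ᵥ C *ᵥ y = 0 → y ≠ 0 → y ⬝ᵥ C *ᵥ y < 0

lemma quad_comm {k : ℕ} {C : Matrix (Fin k) (Fin k) ℝ} (hC : C.IsSymm) (x y : Fin k → ℝ) :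
    x ⬝ᵥ C *ᵥ y = y ⬝ᵥ C *ᵥ x := by
  rw [dotProduct_mulVec, ← mulVec_transpose, hC.eq, dotProduct_comm]

lemma quad_insertNth {m : ℕ} (C : Matrix (Fin (m + 1)) (Fin (m + 1)) ℝ) (i : Fin (m + 1))
    (a b : ℝ) (s t : Fin m → ℝ) :
    (i.insertNth a s : Fin (m + 1) → ℝ) ⬝ᵥ C *ᵥ (i.insertNth b t : Fin (m + 1) → ℝ) =
      C i i * (a * b) + a * ∑ j, C i (i.succAbove j) * t j + b * ∑ j, C (i.succAbove j) i * s j +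
        s ⬝ᵥ C.submatrix i.succAbove i.succAbove *ᵥ t := by
  simp only [quad_eq_sum, Fin.sum_univ_succAbove _ i, Fin.insertNth_apply_same,
    Fin.insertNth_apply_succAbove, submatrix_apply, Finset.mul_sum, Finset.sum_add_distrib]
  have h1 : ∀ j, C i (i.succAbove j) * (a * t j) = a * (C i (i.succAbove j) * t j) := fun j => by ring
  have h2 : ∀ j, C (i.succAbove j) i * (s j * b) = b * (C (i.succAbove j) i * s j) := fun j => by ring
  simp only [h1, h2]
  ring

namespace IsLorentzian

variable {k m : ℕ}

/-- Deleting a vertex passes to a facet, which makes induction on the dimension possible. -/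
lemma submatrix {C : Matrix (Fin (m + 1)) (Fin (m + 1)) ℝ} (hC : IsLorentzian C) (i : Fin (m + 1)) :
    IsLorentzian (C.submatrix i.succAbove i.succAbove) where
  symm := hC.symm.submatrix _
  pos _ _ := hC.pos _ _
  neg x y hx hxy hy := by
    have h (s t : Fin m → ℝ) := quad_insertNth C i 0 0 s t
    simp only [mul_zero, zero_mul, add_zero, zero_add] at h
    rw [← h] at hx hxy ⊢
    refine hC.neg _ _ hx hxy fun h0 => hy ?_
    ext j
    have := congrFun h0 (i.succAbove j)
    simpa using this

/-- Reversed Cauchy–Schwarz: `q • y - b • x` is orthogonal to the timelike vector `x`, so the form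
is nonpositive on it. -/
lemma quad_mul_le_sq {C : Matrix (Fin k) (Fin k) ℝ} (hC : IsLorentzian C) {x : Fin k → ℝ}
    (hx : 0 < x ⬝ᵥ C *ᵥ x) (y : Fin k → ℝ) :
    (x ⬝ᵥ C *ᵥ x) * (y ⬝ᵥ C *ᵥ y) ≤ (x ⬝ᵥ C *ᵥ y) ^ 2 := by
  set q := x ⬝ᵥ C *ᵥ x with hq
  set b := x ⬝ᵥ C *ᵥ y with hb
  have hyx : y ⬝ᵥ C *ᵥ x = b := quad_comm hC.symm y x
  have h0 : x ⬝ᵥ C *ᵥ (q • y - b • x) = 0 := by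
    simp only [mulVec_sub, mulVec_smul, dotProduct_sub, dotProduct_smul, smul_eq_mul, ← hq, ← hb]
    ring
  have h1 : (q • y - b • x) ⬝ᵥ C *ᵥ (q • y - b • x) = q * (q * (y ⬝ᵥ C *ᵥ y) - b ^ 2) := by
    simp only [mulVec_sub, mulVec_smul, dotProduct_sub, dotProduct_smul, smul_eq_mul, ← hq, ← hb,
      sub_dotProduct, smul_dotProduct, hyx]
    ring
  have h2 : (q • y - b • x) ⬝ᵥ C *ᵥ (q • y - b • x) ≤ 0 := by
    by_cases h : q • y - b • x = 0
    · rw [h]; simp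
    · exact (hC.neg x _ hx h0 h).le
  rw [h1] at h2
  have := nonpos_of_mul_nonpos_right h2 hx
  linarith

lemma single_quad (C : Matrix (Fin k) (Fin k) ℝ) (i j : Fin k) :
    (Pi.single i 1 : Fin k → ℝ) ⬝ᵥ C *ᵥ (Pi.single j 1) = C i j := by
  simp

lemma det_ne_zero {C : Matrix (Fin (m + 1)) (Fin (m + 1)) ℝ} (hC : IsLorentzian C) : C.det ≠ 0 := by
  intro h
  obtain ⟨v, hv, h0⟩ := exists_mulVec_eq_zero_iff.2 h
  have := hC.neg (Pi.single 0 1) v (by rw [single_quad]; exact hC.pos _ _) (by rw [h0]; simp) hv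
  rw [h0] at this
  simp at this

lemma diag_mul_diag_le {C : Matrix (Fin k) (Fin k) ℝ} (hC : IsLorentzian C) (i j : Fin k) :
    C i i * C j j ≤ C i j ^ 2 := by
  have := hC.quad_mul_le_sq (x := Pi.single i 1) (by rw [single_quad]; exact hC.pos _ _)
    (Pi.single j 1)
  simpa only [single_quad] using this

end IsLorentzian

lemma inv_diag_mul_det {m : ℕ} {C : Matrix (Fin (m + 1)) (Fin (m + 1)) ℝ} (hC : C.det ≠ 0)
    (i : Fin (m + 1)) : C⁻¹ i i * C.det = (C.submatrix i.succAbove i.succAbove).det := by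
  rw [inv_def, Matrix.smul_apply, adjugate_fin_succ_eq_det_submatrix, Ring.inverse_eq_inv',
    smul_eq_mul, ← two_mul, pow_mul]
  field_simp
  simp

namespace IsLorentzian

variable {k m : ℕ}

/-- The vector `C⁻¹ *ᵥ Pi.single i 1` is orthogonal to every other basis vector, hence spacelike,
and the entry is the value of the form on it. At least two indices are needed for another basis
vector to exist. -/
lemma inv_diag_neg {C : Matrix (Fin (m + 2)) (Fin (m + 2)) ℝ} (hC : IsLorentzian C)
    (i : Fin (m + 2)) : C⁻¹ i i < 0 := by
  set w := C⁻¹ *ᵥ Pi.single i 1 with hw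
  have hunit : IsUnit C.det := hC.det_ne_zero.isUnit
  have hCw : C *ᵥ w = Pi.single i 1 := by
    rw [hw, mulVec_mulVec, mul_nonsing_inv _ hunit, one_mulVec]
  have hw0 : w ≠ 0 := by
    intro h
    rw [h, mulVec_zero] at hCw
    simpa using (congrFun hCw i).symm
  have := hC.neg (Pi.single (i.succAbove 0) 1) w (by rw [single_quad]; exact hC.pos _ _)
    (by rw [hCw]; simp) hw0
  rw [hCw] at this
  simpa [hw] using this

/-- The hyperbolic distance from a vertex to a point of the opposite facet is at least the
corresponding height. -/
lemma height_sq_mul_quad_le {C : Matrix (Fin (m + 2)) (Fin (m + 2)) ℝ} (hC : IsLorentzian C)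
    (i : Fin (m + 2)) (t : Fin (m + 1) → ℝ)
    (ht : 0 ≤ t ⬝ᵥ C.submatrix i.succAbove i.succAbove *ᵥ t) :
    -(C⁻¹ i i)⁻¹ * (t ⬝ᵥ C.submatrix i.succAbove i.succAbove *ᵥ t) ≤
      (∑ j, C i (i.succAbove j) * t j) ^ 2 := by
  have hneg := hC.inv_diag_neg i
  set δ := (C⁻¹ i i)⁻¹ with hδ
  have hδ0 : δ < 0 := inv_lt_zero.2 hneg
  have hunit : IsUnit C.det := hC.det_ne_zero.isUnit
  -- `w` is the component of the `i`-th vertex orthogonal to the facet, and `Pi.single i 1 - w` its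
  -- projection to the span of the facet. The bound is reversed Cauchy–Schwarz for this projection
  -- and `T`, with a nonnegative term dropped.
  set w := δ • C⁻¹ *ᵥ Pi.single i 1 with hw
  have hCw : C *ᵥ w = δ • Pi.single i 1 := by
    rw [hw, mulVec_smul, mulVec_mulVec, mul_nonsing_inv _ hunit, one_mulVec]
  have hwi : w i = 1 := by
    simp [hw, hδ, hneg.ne]
  set T : Fin (m + 2) → ℝ := i.insertNth 0 t with hT
  have hQT : T ⬝ᵥ C *ᵥ T = t ⬝ᵥ C.submatrix i.succAbove i.succAbove *ᵥ t := by
    rw [hT, quad_insertNth]; ring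
  have hwT : w ⬝ᵥ C *ᵥ T = 0 := by
    rw [quad_comm hC.symm, hCw]; simp [hT]
  have hww : w ⬝ᵥ C *ᵥ w = δ := by
    rw [hCw]; simp [hwi]
  have hew : (Pi.single i 1 : Fin (m + 2) → ℝ) ⬝ᵥ C *ᵥ w = δ := by
    rw [hCw]; simp
  have hwe : w ⬝ᵥ C *ᵥ (Pi.single i 1) = δ := by rw [quad_comm hC.symm, hew]
  have heT : (Pi.single i 1 : Fin (m + 2) → ℝ) ⬝ᵥ C *ᵥ T = ∑ j, C i (i.succAbove j) * t j := by
    have : (Pi.single i 1 : Fin (m + 2) → ℝ) = i.insertNth 1 (0 : Fin (m + 1) → ℝ) := by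
      ext j
      rcases Fin.eq_self_or_eq_succAbove i j with rfl | ⟨j, rfl⟩ <;> simp [Fin.succAbove_ne]
    rw [this, hT, quad_insertNth]; simp
  have hq : (Pi.single i 1 - w) ⬝ᵥ C *ᵥ (Pi.single i 1 - w) = C i i - δ := by
    simp only [mulVec_sub, dotProduct_sub, sub_dotProduct, hww, hew, hwe, single_quad]; ring
  have hb : (Pi.single i 1 - w) ⬝ᵥ C *ᵥ T = ∑ j, C i (i.succAbove j) * t j := by
    rw [sub_dotProduct, hwT, heT, sub_zero]
  have := hC.quad_mul_le_sq (x := Pi.single i 1 - w) (by rw [hq]; linarith [hC.pos i i]) T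
  rw [hq, hb, hQT] at this
  nlinarith [mul_nonneg (hC.pos i i).le ht]

/-- Lorentzian analogue of `cosh (d₁ + d₂) ≤ 2 cosh d₁ cosh d₂`. -/
lemma quad_mul_le_two_mul {C : Matrix (Fin k) (Fin k) ℝ} (hC : IsLorentzian C) {o x y : Fin k → ℝ}
    (ho : 0 < o ⬝ᵥ C *ᵥ o) (hx : 0 ≤ x ⬝ᵥ C *ᵥ x) (hy : 0 ≤ y ⬝ᵥ C *ᵥ y)
    (hox : 0 ≤ o ⬝ᵥ C *ᵥ x) (hoy : 0 ≤ o ⬝ᵥ C *ᵥ y) :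
    (o ⬝ᵥ C *ᵥ o) * (x ⬝ᵥ C *ᵥ y) ≤ 2 * (o ⬝ᵥ C *ᵥ x) * (o ⬝ᵥ C *ᵥ y) := by
  set q := o ⬝ᵥ C *ᵥ o with hq
  set a := o ⬝ᵥ C *ᵥ x with ha
  set b := o ⬝ᵥ C *ᵥ y with hb
  set X := x ⬝ᵥ C *ᵥ x with hX
  set Y := y ⬝ᵥ C *ᵥ y with hY
  set p := x ⬝ᵥ C *ᵥ y with hp
  have hp' : y ⬝ᵥ C *ᵥ x = p := quad_comm hC.symm _ _
  have ha' : x ⬝ᵥ C *ᵥ o = a := quad_comm hC.symm _ _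
  have hb' : y ⬝ᵥ C *ᵥ o = b := quad_comm hC.symm _ _
  have key : ∀ α β : ℝ, 0 ≤ (a ^ 2 - q * X) * α ^ 2 + 2 * (a * b - q * p) * (α * β) +
      (b ^ 2 - q * Y) * β ^ 2 := by
    intro α β
    have h := hC.quad_mul_le_sq ho (α • x + β • y)
    simp only [mulVec_add, mulVec_smul, dotProduct_add, dotProduct_smul, add_dotProduct,
      smul_dotProduct, smul_eq_mul, hp', ← hp, ← ha, ← hb, ← hX, ← hY] at h
    rw [← hq] at h
    nlinarith
  by_contra hcon
  push Not at hcon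
  have h1 := key b a
  have h2 : a * b < q * p - a * b := by linarith
  have hab : 0 ≤ a * b := mul_nonneg hox hoy
  rcases hab.eq_or_lt with h0 | h0
  -- If `a * b = 0`, the choice `(b, a)` gives nothing. One weight is then taken large enough for
  -- the cross term to outweigh the remaining square.
  · have hqp : 0 < q * p := by linarith
    rcases mul_eq_zero.1 h0.symm with h | h
    · have h3 := key ((b ^ 2 + 1) / (q * p)) 1
      have hqX : 0 ≤ q * X := mul_nonneg ho.le hx
      have hqY : 0 ≤ q * Y := mul_nonneg ho.le hy
      rw [h] at h3
      have h4 : q * p * ((b ^ 2 + 1) / (q * p)) = b ^ 2 + 1 := mul_div_cancel₀ _ hqp.ne'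
      nlinarith [mul_nonneg hqX (sq_nonneg ((b ^ 2 + 1) / (q * p)))]
    · have h3 := key 1 ((a ^ 2 + 1) / (q * p))
      have hqX : 0 ≤ q * X := mul_nonneg ho.le hx
      have hqY : 0 ≤ q * Y := mul_nonneg ho.le hy
      rw [h] at h3
      have h4 : q * p * ((a ^ 2 + 1) / (q * p)) = a ^ 2 + 1 := mul_div_cancel₀ _ hqp.ne'
      nlinarith [mul_nonneg hqY (sq_nonneg ((a ^ 2 + 1) / (q * p)))]
  · have hqX : 0 ≤ q * X := mul_nonneg ho.le hx
    have hqY : 0 ≤ q * Y := mul_nonneg ho.le hy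
    nlinarith [mul_nonneg hqX (sq_nonneg b), mul_nonneg hqY (sq_nonneg a)]

end IsLorentzian

/-- The normalised volume of the orthant body of `C`; it is invariant under rescaling of the
coordinates. -/
noncomputable def normVolume {k : ℕ} (C : Matrix (Fin k) (Fin k) ℝ) : ENNReal :=
  ENNReal.ofReal √|C.det| * volume (orthantBody C)

lemma lintegral_ofReal_inv_one_add_sq {c : ℝ} (hc : 0 < c) :
    ∫⁻ s : ℝ, ENNReal.ofReal (1 + (c * s) ^ 2)⁻¹ = ENNReal.ofReal (c⁻¹ * Real.pi) := by
  have h : Integrable fun s : ℝ => (1 + (c * s) ^ 2)⁻¹ :=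
    integrable_inv_one_add_sq.comp_mul_left' hc.ne'
  rw [← ofReal_integral_eq_lintegral_ofReal h (Eventually.of_forall fun s => by positivity),
    Measure.integral_comp_mul_left (fun s : ℝ => (1 + s ^ 2)⁻¹), integral_univ_inv_one_add_sq,
    abs_of_pos (inv_pos.2 hc), smul_eq_mul]

/-- The volume of a simplex is bounded by the volume of any facet, in dimension at least three. -/
lemma IsLorentzian.normVolume_le {m : ℕ} {C : Matrix (Fin (m + 2)) (Fin (m + 2)) ℝ} (hm : 1 ≤ m)
    (hC : IsLorentzian C) (i : Fin (m + 2)) :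
    normVolume C ≤ ENNReal.ofReal (2 ^ (m + 1) * Real.pi) *
      normVolume (C.submatrix i.succAbove i.succAbove) := by
  set C' := C.submatrix i.succAbove i.succAbove with hC'
  have hneg := hC.inv_diag_neg i
  set a := √(-(C⁻¹ i i)⁻¹) with ha
  have ha2 : a ^ 2 = -(C⁻¹ i i)⁻¹ := Real.sq_sqrt (by
    have := inv_lt_zero.2 hneg; linarith)
  have ha0 : 0 < a := Real.sqrt_pos.2 (by have := inv_lt_zero.2 hneg; linarith)
  have hdet : |C.det| = a ^ 2 * |C'.det| := by
    rw [ha2, hC', ← inv_diag_mul_det hC.det_ne_zero i, abs_mul, abs_of_neg hneg]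
    field_simp [hneg.ne]
  have hslice : ∀ s : ℝ, volume {t : Fin (m + 1) → ℝ | (i.insertNth s t : Fin (m + 2) → ℝ) ∈
      orthantBody C} ≤ ENNReal.ofReal (2 ^ (m + 1)) *
        ENNReal.ofReal (1 + ((2 * a) * s) ^ 2)⁻¹ * volume (orthantBody C') := by
    intro s
    set η := √((1 + ((2 * a) * s) ^ 2)⁻¹) with hη
    have hη2 : η ^ 2 = (1 + ((2 * a) * s) ^ 2)⁻¹ := Real.sq_sqrt (by positivity)
    have hη0 : 0 < η := Real.sqrt_pos.2 (by positivity)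
    have hη1 : η ≤ 1 := by
      rw [hη, Real.sqrt_le_left (by norm_num), one_pow]
      exact inv_le_one_of_one_le₀ (by nlinarith [sq_nonneg ((2 * a) * s)])
    -- On the slice, `q < 1` and `2 * s * L < 1`. The height inequality `a ^ 2 * q ≤ L ^ 2` turns
    -- the latter into `(2 * a * s) ^ 2 * q < 1`, and adding the two bounds `q`, with room to spare.
    have hsub : {t : Fin (m + 1) → ℝ | (i.insertNth s t : Fin (m + 2) → ℝ) ∈ orthantBody C} ⊆
        {t | (∀ j, 0 ≤ t j) ∧ t ⬝ᵥ C' *ᵥ t < (2 * η) ^ 2} := by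
      rintro t ⟨h0, h1⟩
      have hs : 0 ≤ s := by simpa using h0 i
      have ht : ∀ j, 0 ≤ t j := fun j => by simpa using h0 (i.succAbove j)
      refine ⟨ht, ?_⟩
      rw [quad_insertNth] at h1
      have hsym : ∀ j, C (i.succAbove j) i = C i (i.succAbove j) := fun j => hC.symm.apply _ _
      simp only [hsym] at h1
      have hq : 0 ≤ t ⬝ᵥ C' *ᵥ t := by
        rw [quad_eq_sum]
        exact Finset.sum_nonneg fun j _ => Finset.sum_nonneg fun l _ =>
          mul_nonneg (hC.pos _ _).le (mul_nonneg (ht j) (ht l))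
      have hh := hC.height_sq_mul_quad_le i t hq
      rw [← ha2] at hh
      set q := t ⬝ᵥ C' *ᵥ t with hqdef
      set L := ∑ j, C i (i.succAbove j) * t j with hL
      have hL0 : 0 ≤ L := Finset.sum_nonneg fun j _ => mul_nonneg (hC.pos _ _).le (ht j)
      have hsL : 0 ≤ s * L := mul_nonneg hs hL0
      have hii : 0 ≤ C i i * (s * s) := mul_nonneg (hC.pos _ _).le (mul_nonneg hs hs)
      have hq1 : q < 1 := by linarith
      have hsL1 : 2 * (s * L) < 1 := by linarith
      have h3 : (2 * a * s) ^ 2 * q < 1 := by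
        have : (2 * s) ^ 2 * (a ^ 2 * q) ≤ (2 * s) ^ 2 * L ^ 2 := by gcongr
        nlinarith
      rw [mul_pow, hη2, ← div_eq_mul_inv, lt_div_iff₀ (by positivity)]
      nlinarith
    refine (measure_mono hsub).trans ?_
    rw [volume_quad_lt_sq C' (by positivity), ← ENNReal.ofReal_mul (by positivity)]
    gcongr
    rw [mul_pow]
    gcongr
    rw [← hη2]
    -- The facet has at least two coordinates, so its scaling factor decays at least like `η ^ 2`,
    -- which is integrable in `s`.
    exact pow_le_pow_of_le_one hη0.le hη1 (by omega)
  have hvol : volume (orthantBody C) ≤ ENNReal.ofReal (2 ^ (m + 1)) *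
      ENNReal.ofReal ((2 * a)⁻¹ * Real.pi) * volume (orthantBody C') := by
    rw [volume_eq_lintegral_slices i (measurableSet_orthantBody C)]
    refine (lintegral_mono hslice).trans ?_
    rw [lintegral_mul_const, lintegral_const_mul, lintegral_ofReal_inv_one_add_sq (by positivity)]
    · fun_prop
    · fun_prop
  calc normVolume C ≤ ENNReal.ofReal √|C.det| * (ENNReal.ofReal (2 ^ (m + 1)) *
      ENNReal.ofReal ((2 * a)⁻¹ * Real.pi) * volume (orthantBody C')) := by
        unfold normVolume; gcongr
    _ = ENNReal.ofReal (√|C.det| * (2 ^ (m + 1) * ((2 * a)⁻¹ * Real.pi))) *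
        volume (orthantBody C') := by
        rw [ENNReal.ofReal_mul (p := √|C.det|) (by positivity),
          ENNReal.ofReal_mul (p := 2 ^ (m + 1)) (by positivity)]
        simp only [mul_assoc]
    _ ≤ ENNReal.ofReal (2 ^ (m + 1) * Real.pi * √|C'.det|) * volume (orthantBody C') := by
        refine mul_le_mul_left (ENNReal.ofReal_le_ofReal ?_) _
        rw [hdet, Real.sqrt_mul (by positivity), Real.sqrt_sq ha0.le]
        have : a * √|C'.det| * (2 ^ (m + 1) * ((2 * a)⁻¹ * Real.pi)) =
          (2 ^ (m + 1) * Real.pi * √|C'.det|) / 2 := by field_simp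
        rw [this]
        have : 0 ≤ 2 ^ (m + 1) * Real.pi * √|C'.det| := by positivity
        linarith
    _ = _ := by
        unfold normVolume; rw [ENNReal.ofReal_mul (by positivity)]; ring

/-- A diagonal rescaling makes all three coefficients equal to `1`; the factors `d * r`, `d * q`, `d
* p` are forced by this and have product `d`. -/
lemma volume_three_le {p q r : ℝ} (hp : 0 < p) (hq : 0 < q) (hr : 0 < r) :
    volume {x : Fin 3 → ℝ | (∀ i, 0 ≤ x i) ∧ p * (x 0 * x 1) < 1 ∧ q * (x 0 * x 2) < 1 ∧
      r * (x 1 * x 2) < 1} ≤ ENNReal.ofReal (√(p * q * r))⁻¹ *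
        volume {t : Fin 3 → ℝ | (∀ i, 0 ≤ t i) ∧ ∀ i j, i ≠ j → t i * t j < 1} := by
  set d := (√(p * q * r))⁻¹ with hd
  have hd0 : 0 < d := by positivity
  have hd2 : d ^ 2 * (p * q * r) = 1 := by
    rw [hd, inv_pow, Real.sq_sqrt (by positivity)]; field_simp
  have hsub : {x : Fin 3 → ℝ | (∀ i, 0 ≤ x i) ∧ p * (x 0 * x 1) < 1 ∧ q * (x 0 * x 2) < 1 ∧
      r * (x 1 * x 2) < 1} ⊆ toLin' (diagonal ![d * r, d * q, d * p]) ''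
        {t : Fin 3 → ℝ | (∀ i, 0 ≤ t i) ∧ ∀ i j, i ≠ j → t i * t j < 1} := by
    rintro x ⟨h0, h1, h2, h3⟩
    have e01 : x 0 / (d * r) * (x 1 / (d * q)) = p * (x 0 * x 1) := by
      field_simp; linear_combination (-(x 0 * x 1)) * hd2
    have e02 : x 0 / (d * r) * (x 2 / (d * p)) = q * (x 0 * x 2) := by
      field_simp; linear_combination (-(x 0 * x 2)) * hd2
    have e12 : x 1 / (d * q) * (x 2 / (d * p)) = r * (x 1 * x 2) := by
      field_simp; linear_combination (-(x 1 * x 2)) * hd2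
    refine ⟨![x 0 / (d * r), x 1 / (d * q), x 2 / (d * p)], ⟨?_, ?_⟩, ?_⟩
    · have := h0 0; have := h0 1; have := h0 2
      intro i; fin_cases i <;> simp <;> positivity
    · intro i j hij
      fin_cases i <;> fin_cases j <;>
        first
        | exact absurd rfl hij
        | exact e01.trans_lt h1
        | exact e02.trans_lt h2
        | exact e12.trans_lt h3
        | exact (mul_comm _ _).trans_lt (e01.trans_lt h1)
        | exact (mul_comm _ _).trans_lt (e02.trans_lt h2)
        | exact (mul_comm _ _).trans_lt (e12.trans_lt h3)
    · ext i
      fin_cases i <;> simp [mulVec_diagonal] <;> field_simp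
  refine (measure_mono hsub).trans ?_
  rw [Measure.addHaar_image_linearMap, LinearMap.det_toLin', det_diagonal, Fin.prod_univ_three]
  simp only [cons_val_zero, cons_val_one, cons_val]
  rw [show d * r * (d * q) * (d * p) = d * (d ^ 2 * (p * q * r)) by ring, hd2, mul_one,
    abs_of_pos hd0]

/-- With `P` the product of the three off-diagonal entries, the determinant is at most `3 * P`,
while the body has volume at most a constant times `P^(-1/2)`; the dependence on `C` cancels. -/
lemma IsLorentzian.normVolume_three_le {C : Matrix (Fin 3) (Fin 3) ℝ} (hC : IsLorentzian C) :
    normVolume C ≤ ENNReal.ofReal √3 *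
      volume {t : Fin 3 → ℝ | (∀ i, 0 ≤ t i) ∧ ∀ i j, i ≠ j → t i * t j < 1} := by
  have hs10 : C 1 0 = C 0 1 := hC.symm.apply _ _
  have hs20 : C 2 0 = C 0 2 := hC.symm.apply _ _
  have hs21 : C 2 1 = C 1 2 := hC.symm.apply _ _
  have p01 := hC.pos 0 1
  have p02 := hC.pos 0 2
  have p12 := hC.pos 1 2
  have p00 := hC.pos 0 0
  have p11 := hC.pos 1 1
  have p22 := hC.pos 2 2
  have d01 := hC.diag_mul_diag_le 0 1
  have d02 := hC.diag_mul_diag_le 0 2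
  have d12 := hC.diag_mul_diag_le 1 2
  set P := C 0 1 * C 0 2 * C 1 2 with hP
  have hP0 : 0 < P := by positivity
  have hdet : |C.det| ≤ 3 * P := by
    -- By Cramer's rule the determinant is the quotient of a nonpositive `2 × 2` minor by a negative
    -- diagonal entry of the inverse.
    have hdet0 : 0 ≤ C.det := by
      have h1 := inv_diag_mul_det hC.det_ne_zero 0
      have h2 := hC.inv_diag_neg 0
      have h3 : (C.submatrix (Fin.succAbove 0) (Fin.succAbove 0)).det ≤ 0 := by
        simp only [det_fin_two, submatrix_apply]
        simp [Fin.succAbove]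
        nlinarith
      nlinarith
    rw [abs_of_nonneg hdet0, det_fin_three, hs10, hs20, hs21]
    have hdiag : C 0 0 * C 1 1 * C 2 2 ≤ P := by
      refine (pow_le_pow_iff_left₀ (by positivity) hP0.le two_ne_zero).1 ?_
      calc (C 0 0 * C 1 1 * C 2 2) ^ 2 = (C 0 0 * C 1 1) * (C 0 0 * C 2 2) * (C 1 1 * C 2 2) := by
            ring
        _ ≤ C 0 1 ^ 2 * C 0 2 ^ 2 * C 1 2 ^ 2 := by gcongr
        _ = P ^ 2 := by rw [hP]; ring
    have : 0 ≤ C 0 0 * C 1 2 ^ 2 + C 1 1 * C 0 2 ^ 2 + C 2 2 * C 0 1 ^ 2 := by positivity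
    nlinarith
  have hvol : volume (orthantBody C) ≤ ENNReal.ofReal (√P)⁻¹ *
      volume {t : Fin 3 → ℝ | (∀ i, 0 ≤ t i) ∧ ∀ i j, i ≠ j → t i * t j < 1} := by
    refine (measure_mono ?_).trans (volume_three_le p01 p02 p12)
    rintro t ⟨h0, h1⟩
    have h (i j) := single_entry_le_quad (fun i j => (hC.pos i j).le) h0 i j
    exact ⟨h0, (h 0 1).trans_lt h1, (h 0 2).trans_lt h1, (h 1 2).trans_lt h1⟩
  calc normVolume C ≤ ENNReal.ofReal √(3 * P) * (ENNReal.ofReal (√P)⁻¹ *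
      volume {t : Fin 3 → ℝ | (∀ i, 0 ≤ t i) ∧ ∀ i j, i ≠ j → t i * t j < 1}) := by
        unfold normVolume; gcongr
    _ = _ := by
        rw [← mul_assoc, ← ENNReal.ofReal_mul (by positivity), Real.sqrt_mul (by norm_num)]
        congr 2
        have := Real.sqrt_pos.2 hP0
        field_simp

/-- The volumes of hyperbolic simplices of a given dimension at least two are bounded. -/
lemma exists_normVolume_bound (m : ℕ) : ∃ K : ENNReal, K ≠ ⊤ ∧
    ∀ C : Matrix (Fin (m + 3)) (Fin (m + 3)) ℝ, IsLorentzian C → normVolume C ≤ K := by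
  induction m with
  | zero => exact ⟨_, ENNReal.mul_ne_top ENNReal.ofReal_ne_top
      (volume_pairwise_mul_lt_lt_top le_rfl one_pos).ne, fun C hC => hC.normVolume_three_le⟩
  | succ m ih =>
    obtain ⟨K, hK, h⟩ := ih
    refine ⟨ENNReal.ofReal (2 ^ (m + 3) * Real.pi) * K, ENNReal.mul_ne_top ENNReal.ofReal_ne_top hK,
      fun C hC => (hC.normVolume_le (by omega) 0).trans ?_⟩
    gcongr
    exact h _ (hC.submatrix 0)

end SimplexVolume

/-! ### Bounding the volume by the inradius -/

namespace SimplexVolume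

open Filter Topology Matrix Pointwise

lemma volume_subset_translate_le {m : ℕ} (s : ℝ) {E F : Set (Fin m → ℝ)}
    (h : ∀ t ∈ E, (fun j => t j - s) ∈ F) : volume E ≤ volume F := by
  have : E ⊆ (fun t => t + fun _ => -s) ⁻¹' F := fun t ht => h t ht
  exact (measure_mono this).trans (measure_preimage_add_right _ _ _).le

namespace IsLorentzian

variable {m : ℕ}

/-- The normalisation `C⁻¹ i i = -1` says that the scaled vertices are dual to unit normals. The
all-ones vector then has the same product with each normal, so it points to the incenter. -/
lemma det_submatrix_abs {C : Matrix (Fin (m + 1)) (Fin (m + 1)) ℝ} (hC : IsLorentzian C)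
    (hinv : ∀ i, C⁻¹ i i = -1) (i : Fin (m + 1)) :
    |(C.submatrix i.succAbove i.succAbove).det| = |C.det| := by
  rw [← inv_diag_mul_det hC.det_ne_zero i, hinv]; simp

/-- The part of the orthant body in the cone over the `i`-th facet with apex the incenter. -/
def facetCone (C : Matrix (Fin (m + 1)) (Fin (m + 1)) ℝ) (i : Fin (m + 1)) :
    Set (Fin (m + 1) → ℝ) :=
  orthantBody C ∩ {t | ∀ j, t i ≤ t j}

lemma measurableSet_facetCone (C : Matrix (Fin (m + 1)) (Fin (m + 1)) ℝ) (i : Fin (m + 1)) :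
    MeasurableSet (facetCone C i) := by
  refine (measurableSet_orthantBody C).inter ?_
  have : {t : Fin (m + 1) → ℝ | ∀ j, t i ≤ t j} = ⋂ j, {t | t i ≤ t j} := by ext t; simp
  rw [this]
  exact MeasurableSet.iInter fun j => measurableSet_le (measurable_pi_apply _) (measurable_pi_apply _)

lemma orthantBody_subset_iUnion (C : Matrix (Fin (m + 1)) (Fin (m + 1)) ℝ) :
    orthantBody C ⊆ ⋃ i, facetCone C i := by
  intro t ht
  obtain ⟨i, hi⟩ := Finite.exists_min t
  exact Set.mem_iUnion.2 ⟨i, ht, hi⟩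

/-- Expansion of the quadratic form in coordinates centred at the incenter. -/
lemma facetCone_slice {C : Matrix (Fin (m + 1)) (Fin (m + 1)) ℝ} (hC : IsLorentzian C)
    {i : Fin (m + 1)} {s : ℝ} {t : Fin m → ℝ}
    (h : (i.insertNth s t : Fin (m + 1) → ℝ) ∈ facetCone C i) :
    0 ≤ s ∧ (∀ j, 0 ≤ t j - s) ∧ s ^ 2 * (∑ i, ∑ j, C i j) +
      2 * s * (∑ j, (∑ l, C (i.succAbove j) l) * (t j - s)) +
      (fun j => t j - s) ⬝ᵥ C.submatrix i.succAbove i.succAbove *ᵥ (fun j => t j - s) < 1 := by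
  obtain ⟨⟨h0, h1⟩, h2⟩ := h
  refine ⟨by simpa using h0 i, fun j => by simpa using h2 (i.succAbove j), ?_⟩
  set u : Fin (m + 1) → ℝ := i.insertNth 0 (fun j => t j - s) with hu
  -- Since `t i` is the smallest coordinate, the point is `s` times the incenter direction plus a
  -- vector in the cone over the `i`-th facet.
  have hdec : (i.insertNth s t : Fin (m + 1) → ℝ) = s • (1 : Fin (m + 1) → ℝ) + u := by
    ext j
    rcases Fin.eq_self_or_eq_succAbove i j with rfl | ⟨j, rfl⟩ <;> simp [hu]
  have huu : u ⬝ᵥ C *ᵥ u =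
      (fun j => t j - s) ⬝ᵥ C.submatrix i.succAbove i.succAbove *ᵥ (fun j => t j - s) := by
    rw [hu, quad_insertNth]; ring
  have h11 : (1 : Fin (m + 1) → ℝ) ⬝ᵥ C *ᵥ 1 = ∑ i, ∑ j, C i j := by
    simp [quad_eq_sum]
  have hu1 : u ⬝ᵥ C *ᵥ 1 = ∑ j, (∑ l, C (i.succAbove j) l) * (t j - s) := by
    rw [dotProduct, Fin.sum_univ_succAbove _ i]
    simp only [hu, Fin.insertNth_apply_same, zero_mul, zero_add, Fin.insertNth_apply_succAbove,
      mulVec, dotProduct, Pi.one_apply, mul_one]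
    exact Finset.sum_congr rfl fun j _ => mul_comm _ _
  rw [hdec] at h1
  simp only [mulVec_add, mulVec_smul, dotProduct_add, dotProduct_smul, add_dotProduct,
    smul_dotProduct, smul_eq_mul, quad_comm hC.symm 1 u, huu, h11, hu1] at h1
  linarith

lemma sum_pos {C : Matrix (Fin (m + 1)) (Fin (m + 1)) ℝ} (hC : IsLorentzian C) :
    0 < ∑ i, ∑ j, C i j :=
  Finset.sum_pos (fun i _ => Finset.sum_pos (fun j _ => hC.pos i j) Finset.univ_nonempty)
    Finset.univ_nonempty

/-- All terms of the expansion centred at the incenter are nonnegative. Hence `s` ranges over an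
interval of length `(√σ)⁻¹`, and each slice is, up to translation, contained in the facet body. -/
lemma volume_facetCone_le {C : Matrix (Fin (m + 1)) (Fin (m + 1)) ℝ} (hC : IsLorentzian C)
    (i : Fin (m + 1)) : volume (facetCone C i) ≤ ENNReal.ofReal (√(∑ i, ∑ j, C i j))⁻¹ *
      volume (orthantBody (C.submatrix i.succAbove i.succAbove)) := by
  set σ := ∑ i, ∑ j, C i j with hσ
  have hσ0 : 0 < σ := hC.sum_pos
  rw [volume_eq_lintegral_slices i (measurableSet_facetCone C i)]
  calc _ ≤ ∫⁻ s : ℝ, (Set.Icc 0 (√σ)⁻¹).indicator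
        (fun _ => volume (orthantBody (C.submatrix i.succAbove i.succAbove))) s := by
        refine lintegral_mono fun s => ?_
        by_cases hs : s ∈ Set.Icc 0 (√σ)⁻¹
        · rw [Set.indicator_of_mem hs]
          refine volume_subset_translate_le s fun t ht => ?_
          obtain ⟨h0, h1, h2⟩ := hC.facetCone_slice ht
          refine ⟨h1, ?_⟩
          have : 0 ≤ ∑ j, (∑ l, C (i.succAbove j) l) * (t j - s) :=
            Finset.sum_nonneg fun j _ => mul_nonneg (Finset.sum_nonneg fun l _ => (hC.pos _ _).le)
              (h1 j)
          nlinarith [mul_nonneg h0 this, mul_nonneg (sq_nonneg s) hσ0.le]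
        · rw [Set.indicator_of_notMem hs]
          refine le_of_eq ?_
          convert measure_empty (μ := (volume : Measure (Fin m → ℝ)))
          ext t
          simp only [Set.mem_ofPred_eq, Set.mem_empty_iff_false, iff_false]
          intro ht
          obtain ⟨h0, h1, h2⟩ := hC.facetCone_slice ht
          refine hs ⟨h0, ?_⟩
          have h3 : 0 ≤ ∑ j, (∑ l, C (i.succAbove j) l) * (t j - s) :=
            Finset.sum_nonneg fun j _ => mul_nonneg (Finset.sum_nonneg fun l _ => (hC.pos _ _).le)
              (h1 j)
          have h4 : 0 ≤ (fun j => t j - s) ⬝ᵥ C.submatrix i.succAbove i.succAbove *ᵥ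
              (fun j => t j - s) := by
            rw [quad_eq_sum]
            exact Finset.sum_nonneg fun j _ => Finset.sum_nonneg fun l _ =>
              mul_nonneg (hC.pos _ _).le (mul_nonneg (h1 j) (h1 l))
          rw [← one_div, le_div_iff₀ (by positivity)]
          refine (pow_le_pow_iff_left₀ (by positivity) one_pos.le two_ne_zero).1 ?_
          rw [mul_pow, Real.sq_sqrt hσ0.le]
          nlinarith [mul_nonneg h0 h3]
    _ = _ := by
        rw [lintegral_indicator measurableSet_Icc, setLIntegral_const, Real.volume_Icc, sub_zero,
          mul_comm]

lemma normVolume_le_sum (C : Matrix (Fin (m + 1)) (Fin (m + 1)) ℝ) :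
    normVolume C ≤ ∑ i, ENNReal.ofReal √|C.det| * volume (facetCone C i) := by
  rw [← Finset.mul_sum]
  unfold normVolume
  gcongr
  refine (measure_mono (orthantBody_subset_iUnion C)).trans ((measure_iUnion_le _).trans ?_)
  rw [tsum_fintype]

/-- The area of a triangle cut out by the incenter is bounded by the inradius. -/
lemma facetCone_three_le {C : Matrix (Fin 3) (Fin 3) ℝ} (hC : IsLorentzian C)
    (hinv : ∀ i, C⁻¹ i i = -1) (i : Fin 3) :
    ENNReal.ofReal √|C.det| * volume (facetCone C i) ≤
      volume {t : Fin 3 → ℝ | (∀ i, 0 ≤ t i) ∧ ∀ i j, i ≠ j → t i * t j < 1} *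
      ENNReal.ofReal (√(∑ i, ∑ j, C i j))⁻¹ := by
  set σ := ∑ i, ∑ j, C i j with hσ
  have hσ0 : 0 < σ := hC.sum_pos
  set r := C (i.succAbove 0) (i.succAbove 1) with hr
  set p := ∑ l, C (i.succAbove 0) l with hp
  set q := ∑ l, C (i.succAbove 1) l with hq
  have hr0 : 0 < r := hC.pos _ _
  have hp0 : 0 < p := Finset.sum_pos (fun l _ => hC.pos _ _) Finset.univ_nonempty
  have hq0 : 0 < q := Finset.sum_pos (fun l _ => hC.pos _ _) Finset.univ_nonempty
  have hdet : |C.det| ≤ r ^ 2 := by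
    rw [← hC.det_submatrix_abs hinv i]
    simp only [det_fin_two, submatrix_apply]
    rw [hC.symm.apply (i.succAbove 0) (i.succAbove 1)]
    have h1 := hC.diag_mul_diag_le (i.succAbove 0) (i.succAbove 1)
    have h2 := mul_pos (hC.pos (i.succAbove 0) (i.succAbove 0))
      (hC.pos (i.succAbove 1) (i.succAbove 1))
    rw [abs_le]
    constructor <;> nlinarith
  -- The triangle inequality through the incenter: it trades the length of the side, encoded in `r`,
  -- for its two distances to the vertices, encoded in `p` and `q`.
  have hpq : σ * r ≤ 2 * p * q := by
    have h11 : (1 : Fin 3 → ℝ) ⬝ᵥ C *ᵥ 1 = σ := by simp [quad_eq_sum, hσ]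
    have h1 (j : Fin 3) : (1 : Fin 3 → ℝ) ⬝ᵥ C *ᵥ (Pi.single j 1) = ∑ l, C j l := by
      rw [quad_comm hC.symm]; simp [mulVec, dotProduct, Pi.single_apply]
    have := hC.quad_mul_le_two_mul (o := 1) (x := Pi.single (i.succAbove 0) 1)
      (y := Pi.single (i.succAbove 1) 1) (by rw [h11]; exact hσ0)
      (by rw [single_quad]; exact (hC.pos _ _).le) (by rw [single_quad]; exact (hC.pos _ _).le)
      (by rw [h1]; exact hp0.le) (by rw [h1]; exact hq0.le)
    simpa only [h11, h1, single_quad] using this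
  have hvol : volume (facetCone C i) ≤ ENNReal.ofReal (√(2 * p * (2 * q) * (2 * r)))⁻¹ *
      volume {t : Fin 3 → ℝ | (∀ i, 0 ≤ t i) ∧ ∀ i j, i ≠ j → t i * t j < 1} := by
    refine le_trans ?_ (volume_three_le (p := 2 * p) (q := 2 * q) (r := 2 * r) (by positivity)
      (by positivity) (by positivity))
    have hmeas : MeasurableSet {x : Fin 3 → ℝ | (∀ i, 0 ≤ x i) ∧ 2 * p * (x 0 * x 1) < 1 ∧
        2 * q * (x 0 * x 2) < 1 ∧ 2 * r * (x 1 * x 2) < 1} := by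
      have : {x : Fin 3 → ℝ | (∀ i, 0 ≤ x i) ∧ 2 * p * (x 0 * x 1) < 1 ∧
          2 * q * (x 0 * x 2) < 1 ∧ 2 * r * (x 1 * x 2) < 1} = {x | ∀ i, 0 ≤ x i} ∩
            ({x | 2 * p * (x 0 * x 1) < 1} ∩ ({x | 2 * q * (x 0 * x 2) < 1} ∩
              {x | 2 * r * (x 1 * x 2) < 1})) := by ext; rfl
      rw [this]
      refine measurableSet_nonneg.inter ((measurableSet_lt ?_ measurable_const).inter
        ((measurableSet_lt ?_ measurable_const).inter (measurableSet_lt ?_ measurable_const))) <;>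
      fun_prop
    rw [volume_eq_lintegral_slices i (measurableSet_facetCone C i),
      volume_eq_lintegral_slices 0 hmeas]
    -- Each of the three mixed products is one term of the expansion centred at the incenter, so
    -- each is less than `1`.
    refine lintegral_mono fun s => volume_subset_translate_le s fun t ht => ?_
    obtain ⟨h0, h1, h2⟩ := hC.facetCone_slice ht
    have h10 := h1 0
    have h11 := h1 1
    have hquad := single_entry_le_quad
      (C := C.submatrix i.succAbove i.succAbove) (fun i j => (hC.pos _ _).le) h1
    have hq2 : 2 * r * ((t 0 - s) * (t 1 - s)) ≤
        (fun j => t j - s) ⬝ᵥ C.submatrix i.succAbove i.succAbove *ᵥ (fun j => t j - s) := by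
      have a0 := mul_nonneg (hC.pos (i.succAbove 0) (i.succAbove 0)).le (mul_nonneg h10 h10)
      have a1 := mul_nonneg (hC.pos (i.succAbove 1) (i.succAbove 1)).le (mul_nonneg h11 h11)
      rw [quad_eq_sum]
      simp only [Fin.sum_univ_two, submatrix_apply]
      rw [hC.symm.apply (i.succAbove 0) (i.succAbove 1), ← hr]
      linarith
    rw [Fin.sum_univ_two, ← hp, ← hq, ← hσ] at h2
    have b0 : 0 ≤ s * (p * (t 0 - s)) := by positivity
    have b1 : 0 ≤ s * (q * (t 1 - s)) := by positivity
    have b2 : 0 ≤ s ^ 2 * σ := by positivity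
    have b3 : 0 ≤ 2 * r * ((t 0 - s) * (t 1 - s)) := by positivity
    refine ⟨?_, ?_, ?_, ?_⟩
    · intro j
      refine Fin.cases ?_ (fun j => ?_) j
      · simpa using h0
      · simpa using h1 j
    · change 2 * p * (s * (t 0 - s)) < 1
      linarith
    · change 2 * q * (s * (t 1 - s)) < 1
      linarith
    · change 2 * r * ((t 0 - s) * (t 1 - s)) < 1
      linarith
  calc _ ≤ ENNReal.ofReal r * (ENNReal.ofReal (√(2 * p * (2 * q) * (2 * r)))⁻¹ *
      volume {t : Fin 3 → ℝ | (∀ i, 0 ≤ t i) ∧ ∀ i j, i ≠ j → t i * t j < 1}) := by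
        gcongr
        rw [← Real.sqrt_sq hr0.le]
        exact Real.sqrt_le_sqrt hdet
    _ = ENNReal.ofReal (r * (√(2 * p * (2 * q) * (2 * r)))⁻¹) *
      volume {t : Fin 3 → ℝ | (∀ i, 0 ≤ t i) ∧ ∀ i j, i ≠ j → t i * t j < 1} := by
        rw [ENNReal.ofReal_mul hr0.le]
        exact (mul_assoc _ _ _).symm
    _ ≤ _ := by
        rw [mul_comm]
        gcongr
        rw [← div_eq_mul_inv, div_le_iff₀ (by positivity), ← div_eq_inv_mul,
          le_div_iff₀ (by positivity)]
        rw [← Real.sqrt_sq hr0.le, ← Real.sqrt_mul (by positivity)]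
        rw [Real.sqrt_sq hr0.le]
        refine Real.sqrt_le_sqrt ?_
        nlinarith [mul_le_mul_of_nonneg_left hpq hr0.le, mul_pos (mul_pos hp0 hq0) hr0]

/-- Simplexes with small inradius have small volume. -/
lemma exists_normVolume_le_inradius (m : ℕ) : ∃ K : ENNReal, K ≠ ⊤ ∧
    ∀ C : Matrix (Fin (m + 3)) (Fin (m + 3)) ℝ, IsLorentzian C → (∀ i, C⁻¹ i i = -1) →
      normVolume C ≤ K * ENNReal.ofReal (√(∑ i, ∑ j, C i j))⁻¹ := by
  -- For triangles the facets are edges, whose lengths are not bounded, so the areas of the three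
  -- pieces are estimated directly. In higher dimension the facet volumes have a uniform bound.
  obtain _ | m := m
  · refine ⟨∑ _i : Fin 3, volume {t : Fin 3 → ℝ | (∀ i, 0 ≤ t i) ∧ ∀ i j, i ≠ j → t i * t j < 1},
      ENNReal.sum_ne_top.2 fun _ _ => (volume_pairwise_mul_lt_lt_top le_rfl one_pos).ne,
      fun C hC hinv => (normVolume_le_sum C).trans ?_⟩
    rw [Finset.sum_mul]
    exact Finset.sum_le_sum fun i _ => hC.facetCone_three_le hinv i
  · obtain ⟨K, hK, h⟩ := exists_normVolume_bound m
    refine ⟨∑ _i : Fin (m + 4), K, ENNReal.sum_ne_top.2 fun _ _ => hK,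
      fun C hC hinv => (normVolume_le_sum C).trans ?_⟩
    rw [Finset.sum_mul]
    refine Finset.sum_le_sum fun i _ => ?_
    have h2 := h _ (hC.submatrix i)
    unfold normVolume at h2
    rw [hC.det_submatrix_abs hinv i] at h2
    calc _ ≤ ENNReal.ofReal √|C.det| * (ENNReal.ofReal (√(∑ i, ∑ j, C i j))⁻¹ *
          volume (orthantBody (C.submatrix i.succAbove i.succAbove))) := by
          gcongr; exact hC.volume_facetCone_le i
      _ = ENNReal.ofReal √|C.det| * volume (orthantBody (C.submatrix i.succAbove i.succAbove)) *
          ENNReal.ofReal (√(∑ i, ∑ j, C i j))⁻¹ := by ring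
      _ ≤ _ := by gcongr

end IsLorentzian

end SimplexVolume

/-! ### Lorentz geometry and angle Gram matrices of hyperbolic simplexes -/

namespace SimplexVolume

open Filter Topology Matrix Pointwise

section Lorentz

variable {n : ℕ}

lemma lorentz_comm (x y : Minkowski n) : lorentz x y = lorentz y x := by
  unfold lorentz; rw [real_inner_comm, mul_comm]

lemma lorentz_add_left (x y z : Minkowski n) : lorentz (x + y) z = lorentz x z + lorentz y z := by
  simp only [lorentz, Prod.fst_add, Prod.snd_add, inner_add_left]; ring

lemma lorentz_smul_left (a : ℝ) (x z : Minkowski n) : lorentz (a • x) z = a * lorentz x z := by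
  simp only [lorentz, Prod.smul_fst, Prod.smul_snd, real_inner_smul_left, smul_eq_mul]; ring

lemma lorentz_smul_right (a : ℝ) (x z : Minkowski n) : lorentz x (a • z) = a * lorentz x z := by
  rw [lorentz_comm, lorentz_smul_left, lorentz_comm]

lemma lorentz_sum_left {ι : Type*} (s : Finset ι) (f : ι → Minkowski n) (z : Minkowski n) :
    lorentz (∑ i ∈ s, f i) z = ∑ i ∈ s, lorentz (f i) z := by
  classical
  induction s using Finset.induction_on with
  | empty => simp [lorentz]
  | insert a s ha ih => rw [Finset.sum_insert ha, Finset.sum_insert ha, lorentz_add_left, ih]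

lemma lorentz_sum_right {ι : Type*} (s : Finset ι) (f : ι → Minkowski n) (z : Minkowski n) :
    lorentz z (∑ i ∈ s, f i) = ∑ i ∈ s, lorentz z (f i) := by
  rw [lorentz_comm, lorentz_sum_left]
  exact Finset.sum_congr rfl fun i _ => lorentz_comm _ _

lemma lorentz_linear_combination {k : ℕ} (x y : Fin k → ℝ) (v w : Fin k → Minkowski n) :
    lorentz (∑ i, x i • v i) (∑ j, y j • w j) =
      x ⬝ᵥ (Matrix.of fun i j => lorentz (v i) (w j)) *ᵥ y := by
  rw [quad_eq_sum, lorentz_sum_left]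
  refine Finset.sum_congr rfl fun i _ => ?_
  rw [lorentz_sum_right]
  refine Finset.sum_congr rfl fun j _ => ?_
  rw [lorentz_smul_left, lorentz_smul_right, of_apply]; ring

/-- The orthogonal complement of a timelike vector is spacelike. -/
lemma lorentz_pos_of_orth {a b : Minkowski n} (ha : lorentz a a < 0) (hab : lorentz a b = 0)
    (hb : b ≠ 0) : 0 < lorentz b b := by
  obtain ⟨p, s⟩ := a
  obtain ⟨q, t⟩ := b
  simp only [lorentz, real_inner_self_eq_norm_sq] at *
  have h1 := abs_real_inner_le_norm p q
  have h2 : ⟪p, q⟫ ^ 2 ≤ ‖p‖ ^ 2 * ‖q‖ ^ 2 := by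
    rw [← sq_abs, ← mul_pow]; gcongr
  by_contra hcon
  push Not at hcon
  have h3 : ⟪p, q⟫ = s * t := by linarith
  rw [h3] at h2
  have h4 : t = 0 := by
    by_contra ht
    have : 0 < t ^ 2 := by positivity
    nlinarith [mul_le_mul_of_nonneg_left (show ‖q‖ ^ 2 ≤ t ^ 2 by linarith) (sq_nonneg ‖p‖)]
  have h5 : q = 0 := by
    rw [← norm_eq_zero, ← sq_eq_zero_iff]
    rw [h4] at hcon
    nlinarith [sq_nonneg ‖q‖]
  exact hb (by rw [h4, h5]; rfl)

lemma norm_fst_lt_snd {a : Minkowski n} (ha : lorentz a a < 0) (h : 0 < a.2) : ‖a.1‖ < a.2 := by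
  simp only [lorentz, real_inner_self_eq_norm_sq] at ha
  exact lt_of_pow_lt_pow_left₀ 2 h.le (by linarith)

/-- Two timelike vectors in the future half of the light cone have negative Lorentz product. -/
lemma lorentz_neg_of_future {a b : Minkowski n} (ha : lorentz a a < 0) (ha' : 0 < a.2)
    (hb : lorentz b b < 0) (hb' : 0 < b.2) : lorentz a b < 0 := by
  have h1 := norm_fst_lt_snd ha ha'
  have h2 := norm_fst_lt_snd hb hb'
  have h3 := real_inner_le_norm a.1 b.1
  unfold lorentz
  nlinarith [norm_nonneg a.1, norm_nonneg b.1, mul_le_mul h1.le h2.le (norm_nonneg _) ha'.le]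

/-- The basis of Minkowski space given by the vertices of a simplex. -/
noncomputable def minkowskiBasis {w : Fin (n + 1) → Minkowski n} (hw : LinearIndependent ℝ w) :
    Module.Basis (Fin (n + 1)) ℝ (Minkowski n) :=
  basisOfLinearIndependentOfCardEqFinrank hw (by simp)

@[simp] lemma coe_minkowskiBasis {w : Fin (n + 1) → Minkowski n} (hw : LinearIndependent ℝ w) :
    ⇑(minkowskiBasis hw) = w := coe_basisOfLinearIndependentOfCardEqFinrank _ _

lemma cone_basis {E : Type*} [AddCommGroup E] [Module ℝ E] (b : Module.Basis (Fin (n + 1)) ℝ E) :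
    cone b = {x | ∀ i, 0 ≤ b.equivFun x i} := by
  ext x
  constructor
  · rintro ⟨t, ht, rfl⟩ i
    rw [← b.equivFun_symm_apply, LinearEquiv.apply_symm_apply]
    exact ht i
  · intro h
    exact ⟨b.equivFun x, h, b.sum_equivFun x⟩

lemma cone_smul {E : Type*} [AddCommGroup E] [Module ℝ E] (u : Fin (n + 1) → E)
    {d : Fin (n + 1) → ℝ} (hd : ∀ i, 0 < d i) : cone (fun i => d i • u i) = cone u := by
  ext x
  constructor
  · rintro ⟨t, ht, rfl⟩
    exact ⟨fun i => t i * d i, fun i => mul_nonneg (ht i) (hd i).le, by simp [mul_smul]⟩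
  · rintro ⟨t, ht, rfl⟩
    refine ⟨fun i => t i / d i, fun i => div_nonneg (ht i) (hd i).le,
      Finset.sum_congr rfl fun i _ => ?_⟩
    rw [smul_smul, div_mul_cancel₀ _ (hd i).ne']

/-- The Lorentz Gram matrix of timelike future vectors, with the opposite sign. -/
lemma isLorentzian_of_timelike {w : Fin (n + 1) → Minkowski n} (hw : LinearIndependent ℝ w)
    (htime : ∀ i, lorentz (w i) (w i) < 0) (hpos : ∀ i, 0 < (w i).2) :
    IsLorentzian (-(Matrix.of fun i j => lorentz (w i) (w j))) := by
  have hq (x y : Fin (n + 1) → ℝ) : x ⬝ᵥ (-(Matrix.of fun i j => lorentz (w i) (w j))) *ᵥ y =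
      -lorentz (∑ i, x i • w i) (∑ i, y i • w i) := by
    rw [lorentz_linear_combination, neg_mulVec, dotProduct_neg]
  refine ⟨?_, ?_, ?_⟩
  · ext i j; simp [lorentz_comm (w i)]
  · intro i j
    simpa using lorentz_neg_of_future (htime i) (hpos i) (htime j) (hpos j)
  · intro x y hx hxy hy
    rw [hq] at hx hxy ⊢
    have hy' : ∑ i, y i • w i ≠ 0 := fun h => hy (funext (Fintype.linearIndependent_iff.1 hw y h))
    have := lorentz_pos_of_orth (by linarith) (by linarith : lorentz _ _ = 0) hy'
    linarith

end Lorentz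

/-- The properties of angle Gram matrices of hyperbolic simplexes used here. -/
structure IsHyperbolicMatrix {k : ℕ} (A : Matrix (Fin k) (Fin k) ℝ) : Prop where
  symm : A.IsSymm
  diag : ∀ i, A i i = 1
  facet : ∀ x i, x i = 0 → 0 ≤ x ⬝ᵥ A *ᵥ x
  det_ne_zero : A.det ≠ 0
  lorentzian : IsLorentzian (-A⁻¹)

section Gram

variable {n : ℕ} {u v : Fin (n + 1) → Minkowski n}

lemma neg_cos_pi_sub_arccos {x : ℝ} (h1 : -1 ≤ x) (h2 : x ≤ 1) :
    -Real.cos (Real.pi - Real.arccos x) = x := by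
  rw [Real.cos_pi_sub, neg_neg, Real.cos_arccos h1 h2]

lemma IsHyperbolicSimplex.lorentz_nonneg (hu : IsHyperbolicSimplex u) {x : Minkowski n}
    {i : Fin (n + 1)} (hx : lorentz x (u i) = 0) : 0 ≤ lorentz x x := by
  by_cases h : x = 0
  · simp [h, lorentz]
  · exact (lorentz_pos_of_orth (by rw [hu.lorentz_self i]; norm_num)
      (by rw [lorentz_comm]; exact hx) h).le

/-- For `n ≥ 2` there is a vertex lying on both facets. Its orthogonal complement is spacelike and
contains both normals, so their product lies in `[-1, 1]` and `arccos` does not truncate it. -/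
lemma angleGram_hyperbolic (hn : 2 ≤ n) (hu : IsHyperbolicSimplex u)
    (hv : IsHyperbolicNormals u v) : (angleGram fun i j => lorentz (v i) (v j)) =
      Matrix.of fun i j => lorentz (v i) (v j) := by
  ext i j
  simp only [angleGram, of_apply]
  obtain ⟨k, hki, hkj⟩ : ∃ k, k ≠ i ∧ k ≠ j := by
    have : ({i, j} : Finset (Fin (n + 1))).card < Fintype.card (Fin (n + 1)) := by
      refine (Finset.card_le_two).trans_lt ?_
      simp; omega
    obtain ⟨k, -, hk⟩ := Finset.exists_mem_notMem_of_card_lt_card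
      (s := {i, j}) (t := Finset.univ) this
    simp only [Finset.mem_insert, Finset.mem_singleton, not_or] at hk
    exact ⟨k, hk⟩
  have h (a : ℝ) : 0 ≤ 1 + a ^ 2 + 2 * a * lorentz (v i) (v j) := by
    have := hu.lorentz_nonneg (x := v i + a • v j) (i := k) (by
      rw [lorentz_add_left, lorentz_smul_left, hv.orth i k hki, hv.orth j k hkj]; simp)
    rw [lorentz_add_left, lorentz_smul_left, lorentz_comm _ (v i + _), lorentz_comm _ (v i + _),
      lorentz_add_left, lorentz_smul_left, lorentz_add_left, lorentz_smul_left,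
      hv.lorentz_self, hv.lorentz_self, lorentz_comm (v j)] at this
    linarith
  have h1 := h 1
  have h2 := h (-1)
  exact neg_cos_pi_sub_arccos (by linarith) (by linarith)

/-- The basis of multiples of the vertices dual (up to sign) to the normals. -/
noncomputable def dualVertex (u v : Fin (n + 1) → Minkowski n) (i : Fin (n + 1)) : Minkowski n :=
  (-lorentz (v i) (u i))⁻¹ • u i

lemma linearIndependent_dualVertex (hu : IsHyperbolicSimplex u) (hv : IsHyperbolicNormals u v) :
    LinearIndependent ℝ (dualVertex u v) := by
  have hd : ∀ i, (-lorentz (v i) (u i))⁻¹ ≠ 0 := fun i =>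
    inv_ne_zero (neg_ne_zero.2 (hv.outward i).ne)
  exact hu.linearIndependent.units_smul (fun i => Units.mk0 _ (hd i))

lemma dualVertex_timelike (hu : IsHyperbolicSimplex u) (hv : IsHyperbolicNormals u v)
    (i : Fin (n + 1)) : lorentz (dualVertex u v i) (dualVertex u v i) < 0 := by
  have hd := inv_pos.2 (neg_pos.2 (hv.outward i))
  rw [dualVertex, lorentz_smul_left, lorentz_smul_right, hu.lorentz_self]
  nlinarith

lemma dualVertex_future (hu : IsHyperbolicSimplex u) (hv : IsHyperbolicNormals u v)
    (i : Fin (n + 1)) : 0 < (dualVertex u v i).2 := by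
  have hd := inv_pos.2 (neg_pos.2 (hv.outward i))
  exact mul_pos hd (hu.pos i)

/-- The families satisfy `⟨v i, w j⟩ = -δ_ij`. Expanding `v i` in the basis `w`, the coefficients
are therefore `-⟨v i, v j⟩`; pairing the expansion with `w j` gives the matrix identity. -/
lemma gram_mul_dual (hu : IsHyperbolicSimplex u) (hv : IsHyperbolicNormals u v) :
    (Matrix.of fun i j => lorentz (v i) (v j)) *
      (Matrix.of fun i j => lorentz (dualVertex u v i) (dualVertex u v j)) = 1 := by
  set w := dualVertex u v with hw
  have hvw : ∀ i j, lorentz (v i) (w j) = if i = j then -1 else 0 := by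
    intro i j
    rw [hw, dualVertex, lorentz_smul_right]
    split_ifs with h
    · subst h
      have := (hv.outward i).ne
      field_simp
    · rw [hv.orth i j (Ne.symm h), mul_zero]
  set b := minkowskiBasis (linearIndependent_dualVertex hu hv) with hb
  have hexp : ∀ i, v i = ∑ k, (b.equivFun (v i) k) • w k := fun i => by
    conv_lhs => rw [← b.sum_equivFun (v i)]
    simp [hb, hw]
  have hvv : ∀ i j, lorentz (v i) (v j) = -b.equivFun (v i) j := by
    intro i j
    conv_lhs => rw [hexp i, lorentz_sum_left]
    simp only [lorentz_smul_left]
    rw [Finset.sum_eq_single j]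
    · rw [lorentz_comm, hvw, if_pos rfl]; ring
    · intro k _ hk
      rw [lorentz_comm, hvw, if_neg hk.symm, mul_zero]
    · simp
  ext i j
  simp only [mul_apply, of_apply, hvv]
  have := hvw i j
  rw [hexp i, lorentz_sum_left] at this
  simp only [lorentz_smul_left] at this
  simp only [neg_mul, Finset.sum_neg_distrib, this, one_apply]
  split_ifs <;> simp

lemma HasHyperbolicGram.exists_dual (hn : 2 ≤ n) {A : Matrix (Fin (n + 1)) (Fin (n + 1)) ℝ}
    (h : HasHyperbolicGram u A) : IsHyperbolicMatrix A ∧ ∃ w : Fin (n + 1) → Minkowski n,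
      LinearIndependent ℝ w ∧ (∀ i, lorentz (w i) (w i) < 0) ∧ (∀ i, 0 < (w i).2) ∧
      cone w = cone u ∧ -A⁻¹ = -(Matrix.of fun i j => lorentz (w i) (w j)) := by
  obtain ⟨hu, v, hv, rfl⟩ := h
  rw [angleGram_hyperbolic hn hu hv]
  have hmul := gram_mul_dual hu hv
  have hinv := inv_eq_right_inv hmul
  have hlor := isLorentzian_of_timelike (linearIndependent_dualVertex hu hv)
    (dualVertex_timelike hu hv) (dualVertex_future hu hv)
  refine ⟨⟨?_, ?_, ?_, ?_, ?_⟩, dualVertex u v, linearIndependent_dualVertex hu hv,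
    dualVertex_timelike hu hv, dualVertex_future hu hv,
    cone_smul u fun i => inv_pos.2 (neg_pos.2 (hv.outward i)), by rw [hinv]⟩
  · ext i j; simp [lorentz_comm (v i)]
  · intro i; simp [hv.lorentz_self]
  -- A combination of normals omitting the `i`-th one is orthogonal to the timelike vertex `u i`.
  · intro x i hx
    rw [← lorentz_linear_combination]
    refine hu.lorentz_nonneg (i := i) ?_
    rw [lorentz_sum_left]
    refine Finset.sum_eq_zero fun j _ => ?_
    rw [lorentz_smul_left]
    rcases eq_or_ne i j with rfl | hij
    · rw [hx, zero_mul]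
    · rw [hv.orth j i hij, mul_zero]
  · intro h0
    have := congrArg det hmul
    rw [det_mul, h0] at this
    simp at this
  · rw [hinv]; exact hlor

end Gram

end SimplexVolume

/-! ### Hyperbolic volume as the volume of a truncated cone -/

namespace SimplexVolume

open Filter Topology Matrix Pointwise

section ChangeOfVariables

variable {n : ℕ}

/-- Minkowski space as a space of column vectors, the time coordinate being the first one. -/
noncomputable def minkowskiCoord (n : ℕ) : Minkowski n ≃ᵐ (Fin (n + 1) → ℝ) :=
  (MeasurableEquiv.prodComm.trans ((MeasurableEquiv.refl ℝ).prodCongr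
    (MeasurableEquiv.toLp 2 (Fin n → ℝ)).symm)).trans
      (MeasurableEquiv.piFinSuccAbove (fun _ => ℝ) 0).symm

lemma minkowskiCoord_zero (X : Minkowski n) : minkowskiCoord n X 0 = X.2 := rfl

lemma minkowskiCoord_succ (X : Minkowski n) (j : Fin n) : minkowskiCoord n X j.succ = X.1 j := rfl

lemma measurePreserving_minkowskiCoord : MeasurePreserving (minkowskiCoord n) := by
  refine ((volume_preserving_piFinSuccAbove (fun _ => ℝ) (0 : Fin (n + 1))).symm).comp ?_
  exact ((MeasurePreserving.id volume).prod (PiLp.volume_preserving_ofLp (Fin n))).comp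
    Measure.measurePreserving_swap

/-- The volume of a truncated cone in Minkowski space. -/
lemma volume_truncated_cone (w : Fin (n + 1) → Minkowski n) :
    volume {X | X ∈ cone w ∧ -lorentz X X < 1} =
      normVolume (-(Matrix.of fun i j => lorentz (w i) (w j))) := by
  set W : Matrix (Fin (n + 1)) (Fin (n + 1)) ℝ := Matrix.of fun i j => minkowskiCoord n (w i) j
    with hW
  set J : Fin (n + 1) → ℝ := Fin.cons 1 fun _ => -1 with hJ
  set C : Matrix (Fin (n + 1)) (Fin (n + 1)) ℝ := -(Matrix.of fun i j => lorentz (w i) (w j)) with hC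
  -- The rows of `W` are the coordinates of the `w i`. Hence `√|C.det|` is the Jacobian of the map
  -- carrying `orthantBody C` onto the truncated cone.
  have hCW : C = W * diagonal J * Wᵀ := by
    ext i j
    have hij : C i j = -lorentz (w i) (w j) := rfl
    rw [hij, mul_apply]
    simp only [mul_diagonal, transpose_apply, hW, of_apply, lorentz, hJ]
    rw [Fin.sum_univ_succ]
    simp only [Fin.cons_zero, Fin.cons_succ, minkowskiCoord_zero, minkowskiCoord_succ,
      PiLp.inner_apply, RCLike.inner_apply, conj_trivial]
    simp only [mul_neg, mul_one, neg_mul, Finset.sum_neg_distrib]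
    have : ∑ x, (w j).1 x * (w i).1 x = ∑ x, (w i).1 x * (w j).1 x :=
      Finset.sum_congr rfl fun x _ => mul_comm _ _
    rw [this]; ring
  have hdet : √|C.det| = |W.det| := by
    rw [hCW, det_mul, det_mul, det_transpose, det_diagonal, Fin.prod_univ_succ]
    simp only [hJ, Fin.cons_zero, Fin.cons_succ, Finset.prod_const, one_mul]
    rw [abs_mul, abs_mul, abs_pow, abs_neg, abs_one, one_pow, mul_one, Real.sqrt_mul_self
      (abs_nonneg _)]
  have himage : minkowskiCoord n ⁻¹' (toLin' Wᵀ '' orthantBody C) =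
      {X | X ∈ cone w ∧ -lorentz X X < 1} := by
    have hlin (t : Fin (n + 1) → ℝ) : toLin' Wᵀ t = minkowskiCoord n (∑ i, t i • w i) := by
      ext j
      rw [toLin'_apply, mulVec_transpose, vecMul, dotProduct]
      refine Fin.cases ?_ (fun j => ?_) j
      · rw [minkowskiCoord_zero, Prod.snd_sum]
        simp [hW, minkowskiCoord_zero]
      · rw [minkowskiCoord_succ, Prod.fst_sum]
        simp [hW, minkowskiCoord_succ]
    have hquad (t : Fin (n + 1) → ℝ) : t ⬝ᵥ C *ᵥ t =
        -lorentz (∑ i, t i • w i) (∑ i, t i • w i) := by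
      rw [lorentz_linear_combination, hC, neg_mulVec, dotProduct_neg]
    ext X
    constructor
    · rintro ⟨t, ⟨h0, h1⟩, h2⟩
      rw [hlin] at h2
      have h3 := (minkowskiCoord n).injective h2
      exact ⟨⟨t, h0, h3⟩, by rw [← h3, ← hquad]; exact h1⟩
    · rintro ⟨⟨t, h0, rfl⟩, h1⟩
      exact ⟨t, ⟨h0, by rw [hquad]; exact h1⟩, hlin t⟩
  rw [← himage, measurePreserving_minkowskiCoord.measure_preimage_equiv,
    Measure.addHaar_image_linearMap, LinearMap.det_toLin', det_transpose, ← hdet]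
  rfl

end ChangeOfVariables

section Polar

variable {n : ℕ}

lemma smul_hyperboloidChart (r : ℝ) (x : EuclideanSpace ℝ (Fin n)) :
    r • hyperboloidChart x = (r • x, r * √(1 + ‖x‖ ^ 2)) := rfl

lemma smul_mem_cone {E : Type*} [AddCommGroup E] [Module ℝ E] {u : Fin (n + 1) → E} {r : ℝ}
    (hr : 0 < r) {x : E} : r • x ∈ cone u ↔ x ∈ cone u := by
  constructor
  · rintro ⟨t, ht, h⟩
    refine ⟨fun i => r⁻¹ * t i, fun i => mul_nonneg (inv_pos.2 hr).le (ht i), ?_⟩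
    simp only [mul_smul, ← Finset.smul_sum, h]
    rw [smul_smul, inv_mul_cancel₀ hr.ne', one_smul]
  · rintro ⟨t, ht, rfl⟩
    exact ⟨fun i => r * t i, fun i => mul_nonneg hr.le (ht i), by simp [mul_smul, Finset.smul_sum]⟩

lemma isClosed_cone {w : Fin (n + 1) → Minkowski n} (hw : LinearIndependent ℝ w) :
    IsClosed (cone w) := by
  have := cone_basis (minkowskiBasis hw)
  rw [coe_minkowskiBasis] at this
  rw [this]
  have h : {x | ∀ i, 0 ≤ (minkowskiBasis hw).equivFun x i} =
      ⋂ i, {x | 0 ≤ (minkowskiBasis hw).equivFun x i} := by ext; simp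
  rw [h]
  refine isClosed_iInter fun i => isClosed_le continuous_const ?_
  exact (continuous_apply i).comp
    (LinearMap.continuous_of_finiteDimensional (minkowskiBasis hw).equivFun.toLinearMap)

lemma norm_fst_le_snd_of_mem_cone {w : Fin (n + 1) → Minkowski n}
    (htime : ∀ i, lorentz (w i) (w i) < 0) (hpos : ∀ i, 0 < (w i).2) {X : Minkowski n}
    (hX : X ∈ cone w) : ‖X.1‖ ≤ X.2 := by
  obtain ⟨t, ht, rfl⟩ := hX
  rw [Prod.fst_sum, Prod.snd_sum]
  refine (norm_sum_le _ _).trans (Finset.sum_le_sum fun i _ => ?_)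
  rw [Prod.smul_fst, Prod.smul_snd, norm_smul, Real.norm_of_nonneg (ht i), smul_eq_mul]
  exact mul_le_mul_of_nonneg_left (norm_fst_lt_snd (htime i) (hpos i)).le (ht i)

lemma lorentz_self (X : Minkowski n) : lorentz X X = ‖X.1‖ ^ 2 - X.2 ^ 2 := by
  rw [lorentz, real_inner_self_eq_norm_sq]; ring

/-- The fibre of a truncated cone over a point of the spacelike hyperplane. -/
lemma volume_fibre_truncated_cone {w : Fin (n + 1) → Minkowski n} (hw : LinearIndependent ℝ w)
    (htime : ∀ i, lorentz (w i) (w i) < 0) (hpos : ∀ i, 0 < (w i).2)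
    (p : EuclideanSpace ℝ (Fin n)) :
    volume {t : ℝ | (p, t) ∈ {X | X ∈ cone w ∧ -lorentz X X < 1}} =
      ∫⁻ r in Set.Ioo (0 : ℝ) 1, Set.indicator {r : ℝ | (p, √(r ^ 2 + ‖p‖ ^ 2)) ∈ cone w}
        (fun r => ENNReal.ofReal (r / √(r ^ 2 + ‖p‖ ^ 2))) r := by
  set S : Set ℝ := {r : ℝ | (p, √(r ^ 2 + ‖p‖ ^ 2)) ∈ cone w} with hS
  have hSm : MeasurableSet S :=
    ((isClosed_cone hw).preimage (f := fun r : ℝ => (p, √(r ^ 2 + ‖p‖ ^ 2)))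
      (by fun_prop)).measurableSet
  -- Substitution by the Lorentz length `r`, with `t = √(r ^ 2 + ‖p‖ ^ 2)`. Only the lightlike point
  -- `t = ‖p‖` can be lost, a null set.
  have hae : volume {t : ℝ | (p, t) ∈ {X | X ∈ cone w ∧ -lorentz X X < 1}} =
      volume ((fun r : ℝ => √(r ^ 2 + ‖p‖ ^ 2)) '' (S ∩ Set.Ioo 0 1)) := by
    have himage : (fun r : ℝ => √(r ^ 2 + ‖p‖ ^ 2)) '' (S ∩ Set.Ioo 0 1) =
        {t : ℝ | (p, t) ∈ {X | X ∈ cone w ∧ -lorentz X X < 1}} \ {‖p‖} := by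
      ext t
      constructor
      · rintro ⟨r, ⟨h1, h2, h3⟩, rfl⟩
        have h4 : -lorentz (p, √(r ^ 2 + ‖p‖ ^ 2)) (p, √(r ^ 2 + ‖p‖ ^ 2)) < 1 := by
          rw [lorentz_self, Real.sq_sqrt (by positivity)]; nlinarith
        refine ⟨⟨h1, h4⟩, ?_⟩
        · intro h
          have h' := Real.sq_sqrt (show 0 ≤ r ^ 2 + ‖p‖ ^ 2 by positivity)
          rw [show √(r ^ 2 + ‖p‖ ^ 2) = ‖p‖ from h] at h'
          nlinarith
      · intro ht
        have h1 : (p, t) ∈ cone w := ht.1.1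
        have h2 : -lorentz (p, t) (p, t) < 1 := ht.1.2
        have h3 : t ≠ ‖p‖ := ht.2
        have h4 : ‖p‖ ≤ t := norm_fst_le_snd_of_mem_cone (X := (p, t)) htime hpos h1
        have h5 : ‖p‖ < t := lt_of_le_of_ne h4 (Ne.symm h3)
        have h6 : 0 < t ^ 2 - ‖p‖ ^ 2 := by nlinarith [norm_nonneg p]
        rw [lorentz_self] at h2
        have h7 : √(√(t ^ 2 - ‖p‖ ^ 2) ^ 2 + ‖p‖ ^ 2) = t := by
          rw [Real.sq_sqrt h6.le, sub_add_cancel, Real.sqrt_sq ((norm_nonneg p).trans h4)]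
        refine ⟨√(t ^ 2 - ‖p‖ ^ 2), ⟨?_, Real.sqrt_pos.2 h6, ?_⟩, h7⟩
        · simp only [hS, Set.mem_ofPred_eq, h7]; exact h1
        · rw [Real.sqrt_lt' one_pos]; linarith
    rw [himage, measure_sdiff_null (by simp)]
  rw [hae, ← setLIntegral_one, lintegral_image_eq_lintegral_abs_deriv_mul
    (f' := fun r => r / √(r ^ 2 + ‖p‖ ^ 2)) (hSm.inter measurableSet_Ioo)]
  · rw [setLIntegral_indicator hSm]
    refine setLIntegral_congr_fun (hSm.inter measurableSet_Ioo) fun r hr => ?_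
    simp only [mul_one]
    rw [abs_of_nonneg (div_nonneg hr.2.1.le (Real.sqrt_nonneg _))]
  · intro r hr
    have h0 : r ^ 2 + ‖p‖ ^ 2 ≠ 0 := by have := hr.2.1; positivity
    have := (((hasDerivAt_id r).pow 2).add_const (‖p‖ ^ 2)).sqrt h0
    refine (this.congr_deriv ?_).hasDerivWithinAt
    simp
    field_simp
  · intro r hr s hs hrs
    simp only at hrs
    rw [Real.sqrt_inj (by positivity) (by positivity)] at hrs
    have h1 := hr.2.1
    have h2 := hs.2.1
    nlinarith

lemma lintegral_smul_comp (f : EuclideanSpace ℝ (Fin n) → ENNReal) {r : ℝ} (hr : 0 < r)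
    (hf : Measurable f) : ∫⁻ p, f p = ENNReal.ofReal (r ^ n) * ∫⁻ x, f (r • x) := by
  have h := Measure.map_addHaar_smul (volume : Measure (EuclideanSpace ℝ (Fin n))) hr.ne'
  have h2 : ∫⁻ x, f (r • x) = ENNReal.ofReal |(r ^ n)⁻¹| * ∫⁻ p, f p := by
    rw [← lintegral_map hf (measurable_const_smul r), h, lintegral_smul_measure]
    simp
  rw [h2, ← mul_assoc, ← ENNReal.ofReal_mul (by positivity), abs_of_pos (by positivity),
    mul_inv_cancel₀ (by positivity), ENNReal.ofReal_one, one_mul]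

/-- Polar coordinates `(r, x) ↦ r • hyperboloidChart x`: after Fubini, the scaling `p = r • x`
contributes `r ^ n`, and the radial integral over the unit interval is `1 / (n + 1)`. -/
lemma lintegral_hyperboloidChart {w : Fin (n + 1) → Minkowski n} (hw : LinearIndependent ℝ w)
    (htime : ∀ i, lorentz (w i) (w i) < 0) (hpos : ∀ i, 0 < (w i).2) :
    ∫⁻ x in {x : EuclideanSpace ℝ (Fin n) | hyperboloidChart x ∈ cone w},
      ENNReal.ofReal (1 / √(1 + ‖x‖ ^ 2)) =
        (n + 1) * volume {X | X ∈ cone w ∧ -lorentz X X < 1} := by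
  have hD : MeasurableSet {X : Minkowski n | X ∈ cone w ∧ -lorentz X X < 1} := by
    have : {X : Minkowski n | X ∈ cone w ∧ -lorentz X X < 1} =
        cone w ∩ {X | -lorentz X X < 1} := by ext; rfl
    rw [this]
    refine (isClosed_cone hw).measurableSet.inter
      (isOpen_lt ?_ continuous_const).measurableSet
    unfold lorentz; fun_prop
  have hchart : MeasurableSet {x : EuclideanSpace ℝ (Fin n) | hyperboloidChart x ∈ cone w} :=
    ((isClosed_cone hw).preimage (f := hyperboloidChart)
      (by unfold hyperboloidChart; fun_prop)).measurableSet
  set F : EuclideanSpace ℝ (Fin n) → ℝ → ENNReal := fun p r =>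
    Set.indicator {r : ℝ | (p, √(r ^ 2 + ‖p‖ ^ 2)) ∈ cone w}
      (fun r => ENNReal.ofReal (r / √(r ^ 2 + ‖p‖ ^ 2))) r with hF
  have hFm : Measurable (Function.uncurry F) := by
    have : Function.uncurry F = Set.indicator
        {z : EuclideanSpace ℝ (Fin n) × ℝ | (z.1, √(z.2 ^ 2 + ‖z.1‖ ^ 2)) ∈ cone w}
        (fun z => ENNReal.ofReal (z.2 / √(z.2 ^ 2 + ‖z.1‖ ^ 2))) := by
      ext z; rfl
    rw [this]
    refine Measurable.indicator (by fun_prop) ?_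
    exact ((isClosed_cone hw).preimage
      (f := fun z : EuclideanSpace ℝ (Fin n) × ℝ => (z.1, √(z.2 ^ 2 + ‖z.1‖ ^ 2)))
      (by fun_prop)).measurableSet
  set I := ∫⁻ x in {x : EuclideanSpace ℝ (Fin n) | hyperboloidChart x ∈ cone w},
      ENNReal.ofReal (1 / √(1 + ‖x‖ ^ 2)) with hI
  have hinner : ∀ r ∈ Set.Ioo (0 : ℝ) 1, ∫⁻ p, F p r = ENNReal.ofReal (r ^ n) * I := by
    intro r hr
    rw [lintegral_smul_comp (fun p => F p r) hr.1
      (hFm.comp (measurable_id.prodMk measurable_const)), hI, ← lintegral_indicator hchart]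
    congr 1
    refine lintegral_congr fun x => ?_
    have hsq : √(r ^ 2 + ‖r • x‖ ^ 2) = r * √(1 + ‖x‖ ^ 2) := by
      rw [norm_smul, Real.norm_of_nonneg hr.1.le, mul_pow,
        show r ^ 2 + r ^ 2 * ‖x‖ ^ 2 = r ^ 2 * (1 + ‖x‖ ^ 2) by ring,
        Real.sqrt_mul (by positivity), Real.sqrt_sq hr.1.le]
    have hmem : (r • x, √(r ^ 2 + ‖r • x‖ ^ 2)) ∈ cone w ↔ hyperboloidChart x ∈ cone w := by
      rw [hsq, ← smul_hyperboloidChart, smul_mem_cone hr.1]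
    have hval : r / √(r ^ 2 + ‖r • x‖ ^ 2) = 1 / √(1 + ‖x‖ ^ 2) := by
      rw [hsq, ← div_div, div_self hr.1.ne']
    by_cases hx : hyperboloidChart x ∈ cone w
    · rw [Set.indicator_of_mem (by exact hx)]
      simp only [hF]
      rw [Set.indicator_of_mem (by exact hmem.2 hx), hval]
    · rw [Set.indicator_of_notMem (by exact hx)]
      simp only [hF]
      rw [Set.indicator_of_notMem (by exact fun h => hx (hmem.1 h))]
  have hvol : volume {X | X ∈ cone w ∧ -lorentz X X < 1} =
      ENNReal.ofReal (1 / (n + 1)) * I := by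
    calc volume {X | X ∈ cone w ∧ -lorentz X X < 1}
        = ∫⁻ p, ∫⁻ r in Set.Ioo (0 : ℝ) 1, F p r := by
          rw [Measure.volume_eq_prod, Measure.prod_apply hD]
          exact lintegral_congr fun p => volume_fibre_truncated_cone hw htime hpos p
      _ = ∫⁻ r in Set.Ioo (0 : ℝ) 1, ∫⁻ p, F p r := lintegral_lintegral_swap hFm.aemeasurable
      _ = ∫⁻ r in Set.Ioo (0 : ℝ) 1, ENNReal.ofReal (r ^ n) * I :=
          setLIntegral_congr_fun measurableSet_Ioo hinner
      _ = ENNReal.ofReal (1 / (n + 1)) * I := by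
          rw [lintegral_mul_const _ (by fun_prop)]
          congr 1
          rw [← ofReal_integral_eq_lintegral_ofReal]
          · rw [← integral_Ioc_eq_integral_Ioo, ← intervalIntegral.integral_of_le zero_le_one,
              integral_pow]
            simp
          · exact ((continuous_pow n).integrableOn_Icc (a := 0) (b := 1)).mono_set
              Set.Ioo_subset_Icc_self
          · exact (ae_restrict_iff' measurableSet_Ioo).2
              (Eventually.of_forall fun r hr => pow_nonneg hr.1.le n)
  rw [hvol, ← mul_assoc]
  have : ((n : ENNReal) + 1) = ENNReal.ofReal (n + 1) := by
    rw [ENNReal.ofReal_add (by positivity) one_pos.le]; simp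
  rw [this, ← ENNReal.ofReal_mul (by positivity), mul_one_div_cancel (by positivity)]
  simp

/-- The volume of a hyperbolic simplex in terms of its angle Gram matrix. -/
lemma HasHyperbolicGram.volume_eq (hn : 2 ≤ n) {u : Fin (n + 1) → Minkowski n}
    {A : Matrix (Fin (n + 1)) (Fin (n + 1)) ℝ} (h : HasHyperbolicGram u A) :
    hyperbolicVolume u = (n + 1) * (normVolume (-A⁻¹)).toReal := by
  obtain ⟨-, w, hw, htime, hpos, hcone, hA⟩ := h.exists_dual hn
  rw [hyperbolicVolume, ← hcone, lintegral_hyperboloidChart hw htime hpos,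
    volume_truncated_cone w, hA, ENNReal.toReal_mul]
  congr 1

end Polar

end SimplexVolume

/-! ### Polar bodies and spherical volume -/

namespace SimplexVolume

open Filter Topology Matrix Pointwise MatrixOrder

variable {n k : ℕ}

/-- The part of the unit ball where all coordinates of `M x` are nonpositive. -/
def polarBody (M : Matrix (Fin k) (Fin k) ℝ) : Set (EuclideanSpace ℝ (Fin k)) :=
  {x | ‖x‖ < 1 ∧ ∀ i, (M *ᵥ x.ofLp) i ≤ 0}

lemma continuous_mulVec_ofLp (M : Matrix (Fin k) (Fin k) ℝ) (i : Fin k) :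
    Continuous fun x : EuclideanSpace ℝ (Fin k) => (M *ᵥ x.ofLp) i := by
  simp only [mulVec, dotProduct]
  fun_prop

lemma measurableSet_polarBody (M : Matrix (Fin k) (Fin k) ℝ) : MeasurableSet (polarBody M) := by
  have : polarBody M = Metric.ball 0 1 ∩ ⋂ i, {x | (M *ᵥ x.ofLp) i ≤ 0} := by
    ext x; simp [polarBody]
  rw [this]
  exact measurableSet_ball.inter (MeasurableSet.iInter fun i =>
    (isClosed_le (continuous_mulVec_ofLp M i) continuous_const).measurableSet)

lemma polarBody_subset_ball (M : Matrix (Fin k) (Fin k) ℝ) : polarBody M ⊆ Metric.ball 0 1 := by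
  intro x hx; simpa using hx.1

lemma volume_polarBody_lt_top (M : Matrix (Fin k) (Fin k) ℝ) : volume (polarBody M) < ⊤ :=
  (measure_mono (polarBody_subset_ball M)).trans_lt measure_ball_lt_top

lemma volume_row_eq_zero {M : Matrix (Fin k) (Fin k) ℝ} {i : Fin k} (hi : M i ≠ 0) :
    volume {x : EuclideanSpace ℝ (Fin k) | (M *ᵥ x.ofLp) i = 0} = 0 := by
  have h := Measure.addHaar_submodule (volume : Measure (EuclideanSpace ℝ (Fin k)))
    (LinearMap.ker (innerₛₗ ℝ (WithLp.toLp 2 (M i)))) (by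
      intro htop
      rw [LinearMap.ker_eq_top] at htop
      have := congrArg (fun f => f (WithLp.toLp 2 (M i))) htop
      simp only [innerₛₗ_apply_apply, LinearMap.zero_apply, inner_self_eq_zero] at this
      exact hi (by simpa using this))
  convert h using 2
  ext x
  simp [mulVec, dotProduct, PiLp.inner_apply, mul_comm]

/-- Everything is dominated by the unit ball, and membership is eventually constant off the
hyperplanes defined by the nonzero rows of the limit. -/
lemma tendsto_volume_polarBody {α : Type*} {l : Filter α} [l.IsCountablyGenerated]
    {M : α → Matrix (Fin k) (Fin k) ℝ} {M₀ : Matrix (Fin k) (Fin k) ℝ} (hlim : Tendsto M l (𝓝 M₀))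
    (h0 : ∀ i, M₀ i ≠ 0) :
    Tendsto (fun a => volume (polarBody (M a))) l (𝓝 (volume (polarBody M₀))) := by
  refine tendsto_measure_of_ae_tendsto_indicator l (measurableSet_polarBody M₀)
    (fun a => measurableSet_polarBody (M a)) measurableSet_ball
    (measure_ball_lt_top (x := (0 : EuclideanSpace ℝ (Fin k))) (r := 1)).ne
    (Eventually.of_forall fun a => polarBody_subset_ball (M a)) ?_
  have hae : ∀ᵐ x : EuclideanSpace ℝ (Fin k), ∀ i, (M₀ *ᵥ x.ofLp) i ≠ 0 := by
    rw [ae_all_iff]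
    intro i
    rw [ae_iff]
    simpa using volume_row_eq_zero (h0 i)
  filter_upwards [hae] with x hx
  have hev : ∀ᶠ a in l, ∀ i, ((M a *ᵥ x.ofLp) i ≤ 0 ↔ (M₀ *ᵥ x.ofLp) i ≤ 0) := by
    refine eventually_all.2 fun i => ?_
    have ht : Tendsto (fun a => (M a *ᵥ x.ofLp) i) l (𝓝 ((M₀ *ᵥ x.ofLp) i)) := by
      simp only [mulVec, dotProduct]
      exact tendsto_finsetSum _ fun j _ =>
        (((continuous_id.matrix_elem i j).tendsto M₀).comp hlim).mul_const _
    rcases (hx i).lt_or_gt with h | h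
    · filter_upwards [ht.eventually_lt_const h] with a ha
      exact ⟨fun _ => h.le, fun _ => ha.le⟩
    · filter_upwards [ht.eventually_const_lt h] with a ha
      exact ⟨fun h' => absurd h' ha.not_ge, fun h' => absurd h' h.not_ge⟩
  filter_upwards [hev] with a ha
  exact ⟨fun h => ⟨h.1, fun i => (ha i).1 (h.2 i)⟩, fun h => ⟨h.1, fun i => (ha i).2 (h.2 i)⟩⟩

section Sqrt

variable {A : Matrix (Fin k) (Fin k) ℝ}

lemma sqrt_mul_sqrt (hA : A.PosSemidef) : CFC.sqrt A * CFC.sqrt A = A :=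
  CFC.sqrt_mul_sqrt_self A (nonneg_iff_posSemidef.2 hA)

lemma posSemidef_sqrt (A : Matrix (Fin k) (Fin k) ℝ) : (CFC.sqrt A).PosSemidef :=
  nonneg_iff_posSemidef.1 (CFC.sqrt_nonneg A)

lemma isSymm_sqrt (A : Matrix (Fin k) (Fin k) ℝ) : (CFC.sqrt A).IsSymm := by
  have := (posSemidef_sqrt A).1
  rwa [IsHermitian, conjTranspose_eq_transpose_of_trivial] at this

lemma sqrt_row_inner (hA : A.PosSemidef) (i j : Fin k) :
    CFC.sqrt A i ⬝ᵥ CFC.sqrt A j = A i j := by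
  conv_rhs => rw [← sqrt_mul_sqrt hA, mul_apply]
  exact Finset.sum_congr rfl fun l _ => by rw [(isSymm_sqrt A).apply l j]

lemma sqrt_row_ne_zero (hA : A.PosSemidef) (h1 : ∀ i, A i i = 1) (i : Fin k) :
    CFC.sqrt A i ≠ 0 := by
  intro h
  have := sqrt_row_inner hA i i
  rw [h, h1] at this
  simp at this

lemma isClosed_posSemidef : IsClosed {A : Matrix (Fin k) (Fin k) ℝ | A.PosSemidef} := by
  have : {A : Matrix (Fin k) (Fin k) ℝ | A.PosSemidef} =
      {A | Aᵀ = A} ∩ ⋂ x : Fin k → ℝ, {A | 0 ≤ x ⬝ᵥ A *ᵥ x} := by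
    ext A
    simp [posSemidef_iff_dotProduct_mulVec, IsHermitian]
  rw [this]
  refine (isClosed_eq (by fun_prop) continuous_id).inter (isClosed_iInter fun x =>
    isClosed_le continuous_const ?_)
  simp only [quad_eq_sum]
  fun_prop

open scoped Matrix.Norms.L2Operator in
lemma continuousOn_matrix_sqrt :
    ContinuousOn CFC.sqrt {A : Matrix (Fin k) (Fin k) ℝ | A.PosSemidef} := by
  simpa only [nonneg_iff_posSemidef] using
    CFC.continuousOn_sqrt (A := Matrix (Fin k) (Fin k) ℝ)

end Sqrt

section Zero

/-- Gordan's alternative for a symmetric matrix. -/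
lemma exists_mulVec_neg_or {M : Matrix (Fin k) (Fin k) ℝ} (hM : M.IsSymm) :
    (∃ x : Fin k → ℝ, ∀ i, (M *ᵥ x) i < 0) ∨ ∃ y ∈ stdSimplex ℝ (Fin k), M *ᵥ y = 0 := by
  by_cases hdisj : Disjoint {z : Fin k → ℝ | ∀ i, z i < 0} (Set.range (M *ᵥ ·))
  · right
    have hopen : IsOpen {z : Fin k → ℝ | ∀ i, z i < 0} := by
      simp only [Set.ofPred_forall]
      exact isOpen_iInter_of_finite fun i => isOpen_lt (continuous_apply i) continuous_const
    have hconv : Convex ℝ {z : Fin k → ℝ | ∀ i, z i < 0} := by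
      simp only [Set.ofPred_forall]
      exact convex_iInter fun i => convex_halfSpace_lt ⟨fun _ _ => rfl, fun _ _ => rfl⟩ 0
    have hconv2 : Convex ℝ (Set.range (M *ᵥ ·)) := by
      rintro _ ⟨x, rfl⟩ _ ⟨y, rfl⟩ a b - - -
      exact ⟨a • x + b • y, by simp [mulVec_add, mulVec_smul]⟩
    obtain ⟨f, c, hf1, hf2⟩ := geometric_hahn_banach_open hconv hopen hconv2 hdisj
    set w : Fin k → ℝ := fun i => f (Pi.single i 1) with hw
    have hfw : ∀ z, f z = w ⬝ᵥ z := by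
      intro z
      conv_lhs => rw [pi_eq_sum_univ' z]
      rw [map_sum, dotProduct]
      exact Finset.sum_congr rfl fun i _ => by rw [map_smul, smul_eq_mul, mul_comm]
    have hc : c ≤ 0 := by simpa using hf2 0 ⟨0, by simp⟩
    -- A functional bounded below on a subspace vanishes there: otherwise rescaling `x` gives the
    -- value `c - 1`.
    have hrange : ∀ x, f (M *ᵥ x) = 0 := by
      intro x
      by_contra hne
      have h := hf2 (M *ᵥ (((c - 1) / f (M *ᵥ x)) • x)) ⟨_, rfl⟩
      rw [mulVec_smul, map_smul, smul_eq_mul, div_mul_cancel₀ _ hne] at h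
      linarith
    have hneg : ∀ z : Fin k → ℝ, (∀ i, z i < 0) → w ⬝ᵥ z < 0 := fun z hz => by
      rw [← hfw]; exact (hf1 z hz).trans_le hc
    have hw0 : ∀ i, 0 ≤ w i := by
      intro i
      by_contra hi
      push Not at hi
      set s := ∑ j, |w j| with hs
      have hs0 : 0 ≤ s := Finset.sum_nonneg fun j _ => abs_nonneg _
      -- A very negative `i`-th coordinate against `w i < 0` contributes `s + 1`, more than the
      -- remaining `-∑ j, w j` can cancel, so the pairing would be positive.
      have h := hneg (fun j => if j = i then -((s + 1) / -w i) - 1 else -1) (fun j => by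
        split_ifs
        · have : 0 ≤ (s + 1) / -w i := div_nonneg (by linarith) (by linarith)
          linarith
        · norm_num)
      have hsplit : w ⬝ᵥ (fun j => if j = i then -((s + 1) / -w i) - 1 else -1) =
          -∑ j, w j + (s + 1) := by
        have : ∀ j, w j * (if j = i then -((s + 1) / -w i) - 1 else -1) =
            -w j + if j = i then (s + 1) else 0 := by
          intro j
          split_ifs with hj
          · subst hj
            have : w j * ((s + 1) / -w j) = -(s + 1) := by
              have := hi.ne
              field_simp
            linear_combination -this
          · ring
        simp only [dotProduct, this, Finset.sum_add_distrib, Finset.sum_ite_eq',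
          Finset.mem_univ, if_true, Finset.sum_neg_distrib]
      rw [hsplit] at h
      have : ∑ j, w j ≤ s := Finset.sum_le_sum fun j _ => le_abs_self _
      linarith
    have hsum : 0 < ∑ i, w i := by
      have := hneg (fun _ => -1) (fun _ => by norm_num)
      simp only [dotProduct, mul_neg, mul_one, Finset.sum_neg_distrib] at this
      linarith
    have hMw : M *ᵥ w = 0 := by
      ext i
      have := hrange (Pi.single i 1)
      rw [hfw, quad_comm hM] at this
      simpa using this
    refine ⟨(∑ i, w i)⁻¹ • w, ⟨fun i => mul_nonneg (inv_nonneg.2 hsum.le) (hw0 i), ?_⟩, ?_⟩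
    · simp only [Pi.smul_apply, smul_eq_mul, ← Finset.mul_sum]
      exact inv_mul_cancel₀ hsum.ne'
    · rw [mulVec_smul, hMw, smul_zero]
  · left
    rw [Set.not_disjoint_iff] at hdisj
    obtain ⟨z, hz, x, rfl⟩ := hdisj
    exact ⟨x, hz⟩

lemma sqrt_mulVec_eq_zero_iff {A : Matrix (Fin k) (Fin k) ℝ} (hA : A.PosSemidef) (y : Fin k → ℝ) :
    CFC.sqrt A *ᵥ y = 0 ↔ A *ᵥ y = 0 := by
  constructor
  · intro h
    rw [← sqrt_mul_sqrt hA, ← mulVec_mulVec, h, mulVec_zero]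
  · intro h
    have h2 : (CFC.sqrt A *ᵥ y) ⬝ᵥ (CFC.sqrt A *ᵥ y) = 0 := by
      have h3 : y ⬝ᵥ A *ᵥ y = 0 := by rw [h, dotProduct_zero]
      rwa [← sqrt_mul_sqrt hA, ← mulVec_mulVec, dotProduct_mulVec, ← mulVec_transpose,
        (isSymm_sqrt A).eq] at h3
    exact dotProduct_self_eq_zero.1 h2

/-- If all the inequalities can hold strictly, the body contains a nonempty open set; otherwise
Gordan's alternative yields the null vector. Conversely, a null vector `y ≥ 0` forces a vanishing
sum of nonpositive terms, so the body lies in the hyperplane of any row `i` with `y i > 0`. -/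
lemma volume_polarBody_eq_zero_iff {A : Matrix (Fin k) (Fin k) ℝ} (hA : A.PosSemidef)
    (h1 : ∀ i, A i i = 1) : volume (polarBody (CFC.sqrt A)) = 0 ↔
      ∃ y ∈ stdSimplex ℝ (Fin k), A *ᵥ y = 0 := by
  constructor
  · intro h0
    rcases exists_mulVec_neg_or (isSymm_sqrt A) with ⟨x, hx⟩ | ⟨y, hy, hy0⟩
    · exfalso
      set O : Set (EuclideanSpace ℝ (Fin k)) :=
        Metric.ball 0 1 ∩ ⋂ i, {x | (CFC.sqrt A *ᵥ x.ofLp) i < 0} with hO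
      have hOo : IsOpen O := Metric.isOpen_ball.inter (isOpen_iInter_of_finite fun i =>
        isOpen_lt (continuous_mulVec_ofLp _ i) continuous_const)
      have hsub : O ⊆ polarBody (CFC.sqrt A) := by
        rintro z ⟨hz1, hz2⟩
        refine ⟨by simpa using hz1, fun i => ?_⟩
        exact (Set.mem_iInter.1 hz2 i : _ < _).le
      have hne : O.Nonempty := by
        set X : EuclideanSpace ℝ (Fin k) := WithLp.toLp 2 x with hX
        have hpos : 0 < (1 + ‖X‖)⁻¹ := by positivity
        refine ⟨(1 + ‖X‖)⁻¹ • X, ?_, Set.mem_iInter.2 fun i => ?_⟩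
        · rw [mem_ball_zero_iff, norm_smul, Real.norm_of_nonneg hpos.le,
            inv_mul_lt_iff₀ (by positivity)]
          linarith
        · change (CFC.sqrt A *ᵥ ((1 + ‖X‖)⁻¹ • x)) i < 0
          rw [mulVec_smul]
          exact mul_neg_of_pos_of_neg hpos (hx i)
      exact (hOo.measure_pos volume hne).ne' (measure_mono_null hsub h0)
    · exact ⟨y, hy, (sqrt_mulVec_eq_zero_iff hA y).1 hy0⟩
  · rintro ⟨y, ⟨hy0, hy1⟩, hy⟩
    obtain ⟨i, hi⟩ : ∃ i, 0 < y i := by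
      by_contra! h
      have : ∑ i, y i ≤ 0 := Finset.sum_nonpos fun i _ => h i
      linarith
    refine measure_mono_null ?_ (volume_row_eq_zero (sqrt_row_ne_zero hA h1 i))
    rintro x ⟨-, hx⟩
    have hsum : ∑ j, y j * (CFC.sqrt A *ᵥ x.ofLp) j = 0 := by
      change y ⬝ᵥ _ = 0
      rw [quad_comm (isSymm_sqrt A), (sqrt_mulVec_eq_zero_iff hA y).2 hy, dotProduct_zero]
    have h2 := (Finset.sum_eq_zero_iff_of_nonpos
      (fun j _ => mul_nonpos_of_nonneg_of_nonpos (hy0 j) (hx j))).1 hsum i (Finset.mem_univ i)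
    exact (mul_eq_zero.1 h2).resolve_left hi.ne'

end Zero

section Spherical

variable {u v : Fin (n + 1) → EuclideanSpace ℝ (Fin (n + 1))}

lemma angleGram_of_unit {m : ℕ} {v : Fin (n + 1) → EuclideanSpace ℝ (Fin m)}
    (hv : ∀ i, ‖v i‖ = 1) : (angleGram fun i j => ⟪v i, v j⟫) = Matrix.gram ℝ v := by
  ext i j
  have h := abs_le.1 (abs_real_inner_le_norm (v i) (v j))
  rw [hv, hv, one_mul] at h
  simp only [angleGram, of_apply]
  exact neg_cos_pi_sub_arccos h.1 h.2

/-- The basis of the ambient space given by the vertices of a spherical simplex. -/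
noncomputable def sphericalBasis {u : Fin (n + 1) → EuclideanSpace ℝ (Fin (n + 1))}
    (hu : LinearIndependent ℝ u) :
    Module.Basis (Fin (n + 1)) ℝ (EuclideanSpace ℝ (Fin (n + 1))) :=
  basisOfLinearIndependentOfCardEqFinrank hu (by simp)

@[simp] lemma coe_sphericalBasis (hu : LinearIndependent ℝ u) : ⇑(sphericalBasis hu) = u :=
  coe_basisOfLinearIndependentOfCardEqFinrank _ _

/-- The `i`-th coordinate of `x` in the basis of vertices is `⟪v i, x⟫ / ⟪v i, u i⟫`, with negative
denominator. -/
lemma IsSphericalNormals.cone_eq (hu : IsSphericalSimplex u) (hv : IsSphericalNormals u v) :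
    cone u = {x | ∀ i, ⟪v i, x⟫ ≤ 0} := by
  have h := cone_basis (sphericalBasis hu.linearIndependent)
  rw [coe_sphericalBasis] at h
  rw [h]
  ext x
  refine forall_congr' fun i => ?_
  have hx : ⟪v i, x⟫ = (sphericalBasis hu.linearIndependent).equivFun x i * ⟪v i, u i⟫ := by
    conv_lhs => rw [← (sphericalBasis hu.linearIndependent).sum_equivFun x]
    rw [inner_sum, Finset.sum_eq_single i]
    · rw [coe_sphericalBasis, real_inner_smul_right]
    · intro j _ hj
      rw [coe_sphericalBasis, real_inner_smul_right, hv.orth i j hj, mul_zero]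
    · simp
  rw [hx]
  have := hv.outward i
  constructor
  · intro h; exact mul_nonpos_of_nonneg_of_nonpos h this.le
  · intro h
    by_contra h'
    push Not at h'
    exact absurd (mul_pos_of_neg_of_neg h' this) h.not_gt

lemma IsSphericalNormals.linearIndependent (hv : IsSphericalNormals u v) :
    LinearIndependent ℝ v := by
  rw [Fintype.linearIndependent_iff]
  intro g hg j
  have h : ⟪∑ i, g i • v i, u j⟫ = g j * ⟪v j, u j⟫ := by
    rw [sum_inner, Finset.sum_eq_single j]
    · rw [real_inner_smul_left]
    · intro i _ hi
      rw [real_inner_smul_left, hv.orth i j hi.symm, mul_zero]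
    · simp
  rw [hg, inner_zero_left] at h
  exact (mul_eq_zero.1 h.symm).resolve_right (hv.outward j).ne

/-- Linearly independent families with the same Gram matrix are congruent. -/
lemma exists_isometry_of_gram (hv : LinearIndependent ℝ v)
    {w : Fin (n + 1) → EuclideanSpace ℝ (Fin (n + 1))} (h : ∀ i j, ⟪w i, w j⟫ = ⟪v i, v j⟫) :
    ∃ T : EuclideanSpace ℝ (Fin (n + 1)) ≃ₗᵢ[ℝ] EuclideanSpace ℝ (Fin (n + 1)),
      ∀ i, T (v i) = w i := by
  set b := sphericalBasis hv with hb
  set T := b.constr ℝ w with hT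
  have hTv : ∀ i, T (v i) = w i := fun i => by
    have := b.constr_basis ℝ w i
    rwa [hb, coe_sphericalBasis] at this
  have hinner : ∀ x y, ⟪T x, T y⟫ = ⟪x, y⟫ := by
    intro x y
    rw [← b.sum_equivFun x, ← b.sum_equivFun y]
    simp only [map_sum, map_smul, sum_inner, inner_sum, real_inner_smul_left,
      real_inner_smul_right, hb, coe_sphericalBasis]
    rw [← hb]
    simp only [hTv, h]
  exact ⟨(T.isometryOfInner hinner).toLinearIsometryEquiv rfl, hTv⟩

/-- The volume of a spherical simplex in terms of its angle Gram matrix. -/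
lemma HasSphericalGram.volume_eq {A : Matrix (Fin (n + 1)) (Fin (n + 1)) ℝ}
    (h : HasSphericalGram u A) : A.PosSemidef ∧ (∀ i, A i i = 1) ∧
      sphericalVolume u = (n + 1) * (volume (polarBody (CFC.sqrt A))).toReal := by
  obtain ⟨hu, v, hv, rfl⟩ := h
  rw [angleGram_of_unit hv.norm_eq]
  have hpsd : (Matrix.gram ℝ v).PosSemidef := posSemidef_gram ℝ v
  refine ⟨hpsd, fun i => by simp [gram_apply, hv.norm_eq], ?_⟩
  set S := CFC.sqrt (Matrix.gram ℝ v) with hS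
  -- The rows of the square root have the same Gram matrix as the normals, so an isometry moves the
  -- simplex to a position determined by the matrix alone.
  obtain ⟨T, hT⟩ := exists_isometry_of_gram hv.linearIndependent
    (w := fun i => WithLp.toLp 2 (S i)) (fun i j => by
      rw [← gram_apply (v := v), ← sqrt_row_inner hpsd i j]
      simp [PiLp.inner_apply, dotProduct, mul_comm, hS])
  have hcone := hv.cone_eq hu
  have hclosed : IsClosed (cone u) := by
    rw [hcone]
    have : {x | ∀ i, ⟪v i, x⟫ ≤ 0} = ⋂ i, {x | ⟪v i, x⟫ ≤ 0} := by ext; simp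
    rw [this]
    exact isClosed_iInter fun i => isClosed_le (by fun_prop) continuous_const
  have hset : Set.Ioo (0 : ℝ) 1 • (Subtype.val '' {x : Metric.sphere
      (0 : EuclideanSpace ℝ (Fin (n + 1))) 1 | (x : EuclideanSpace ℝ (Fin (n + 1))) ∈ cone u}) =
      (T ⁻¹' polarBody S) \ {0} := by
    have hmem : ∀ x, x ∈ T ⁻¹' polarBody S ↔ ‖x‖ < 1 ∧ x ∈ cone u := by
      intro x
      rw [hcone]
      refine and_congr (by rw [T.norm_map]) (forall_congr' fun i => ?_)
      have : (S *ᵥ (T x).ofLp) i = ⟪v i, x⟫ := by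
        rw [← T.inner_map_map, hT]
        simp [mulVec, dotProduct, PiLp.inner_apply, mul_comm]
      rw [this]
    ext x
    rw [Set.mem_sdiff, hmem]
    constructor
    · rintro ⟨r, hr, _, ⟨y, hy, rfl⟩, rfl⟩
      have hy1 : ‖(y : EuclideanSpace ℝ (Fin (n + 1)))‖ = 1 := by simp
      refine ⟨⟨?_, (smul_mem_cone hr.1).2 hy⟩, ?_⟩
      · change ‖r • (y : EuclideanSpace ℝ (Fin (n + 1)))‖ < 1
        rw [norm_smul, hy1, mul_one, Real.norm_of_nonneg hr.1.le]; exact hr.2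
      · intro h0
        have h0' : r • (y : EuclideanSpace ℝ (Fin (n + 1))) = 0 := h0
        rw [← norm_eq_zero, norm_smul, hy1, mul_one, norm_eq_zero] at h0'
        exact hr.1.ne' h0'
    · rintro ⟨⟨h1, h2⟩, h3⟩
      have hx : 0 < ‖x‖ := norm_pos_iff.2 h3
      refine ⟨‖x‖, ⟨hx, h1⟩, ‖x‖⁻¹ • x, ⟨⟨‖x‖⁻¹ • x, ?_⟩, ?_, rfl⟩, ?_⟩
      · rw [mem_sphere_zero_iff_norm, norm_smul, norm_inv, norm_norm, inv_mul_cancel₀ hx.ne']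
      · exact (smul_mem_cone (inv_pos.2 hx)).2 h2
      · change ‖x‖ • (‖x‖⁻¹ • x) = x
        rw [smul_smul, mul_inv_cancel₀ hx.ne', one_smul]
  have hmeas : MeasurableSet {x : Metric.sphere (0 : EuclideanSpace ℝ (Fin (n + 1))) 1 |
      (x : EuclideanSpace ℝ (Fin (n + 1))) ∈ cone u} :=
    hclosed.measurableSet.preimage measurable_subtype_coe
  rw [sphericalVolume, Measure.toSphere_apply' _ hmeas, hset, measure_sdiff_null (by simp),
    T.measurePreserving.measure_preimage (measurableSet_polarBody S).nullMeasurableSet,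
    ENNReal.toReal_mul, finrank_euclideanSpace_fin, ENNReal.toReal_natCast, Nat.cast_succ]

end Spherical

end SimplexVolume

/-! ### The closure of the Euclidean angle Gram matrices -/

namespace SimplexVolume

open Filter Topology Matrix Pointwise MatrixOrder

variable {n k : ℕ}

lemma isClosed_exists_mem_of_isCompact {X Y : Type*} [TopologicalSpace X] [TopologicalSpace Y]
    {K : Set X} (hK : IsCompact K) {F : Set (X × Y)} (hF : IsClosed F) :
    IsClosed {y | ∃ x ∈ K, (x, y) ∈ F} := by
  have : CompactSpace K := isCompact_iff_compactSpace.1 hK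
  have h := isClosedMap_snd_of_compactSpace (X := K) (Y := Y) _
    (hF.preimage (f := fun p : K × Y => ((p.1 : X), p.2)) (by fun_prop))
  convert h
  ext y
  constructor
  · rintro ⟨x, hx, hxy⟩; exact ⟨(⟨x, hx⟩, y), hxy, rfl⟩
  · rintro ⟨⟨x, y'⟩, hxy, rfl⟩; exact ⟨x, x.2, hxy⟩

/-- Normalising null vectors to the compact standard simplex is what makes their existence survive
limits. -/
lemma isClosed_exists_null : IsClosed {A : Matrix (Fin k) (Fin k) ℝ |
    ∃ y ∈ stdSimplex ℝ (Fin k), A *ᵥ y = 0} :=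
  isClosed_exists_mem_of_isCompact (isCompact_stdSimplex ℝ (Fin k))
    (F := {p : (Fin k → ℝ) × Matrix (Fin k) (Fin k) ℝ | p.2 *ᵥ p.1 = 0})
    (isClosed_eq (by fun_prop) continuous_const)

lemma gram_mulVec {m : ℕ} (v : Fin k → EuclideanSpace ℝ (Fin m)) (y : Fin k → ℝ) (i : Fin k) :
    (gram ℝ v *ᵥ y) i = ⟪v i, ∑ j, y j • v j⟫ := by
  simp only [mulVec, dotProduct, gram_apply, inner_sum, real_inner_smul_right, mul_comm]

/-- The outward normals of a Euclidean simplex satisfy a relation with positive coefficients. -/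
lemma exists_null_of_mem_euclideanGram {A : Matrix (Fin (n + 1)) (Fin (n + 1)) ℝ}
    (hA : A ∈ euclideanGram n) : A.PosSemidef ∧ ∃ y ∈ stdSimplex ℝ (Fin (n + 1)), A *ᵥ y = 0 := by
  obtain ⟨s, v, hv, rfl⟩ := hA
  rw [angleGram_of_unit hv.norm_eq]
  refine ⟨posSemidef_gram ℝ v, ?_⟩
  have hdep : ¬ LinearIndependent ℝ v := fun h => by
    have := h.fintype_card_le_finrank
    simp at this
  obtain ⟨g, hg, i, hi⟩ := Fintype.not_linearIndependent_iff.1 hdep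
  have hpos : ∀ j, 0 < g j / g i := by
    intro j
    rcases eq_or_ne j i with rfl | hji
    · rw [div_self hi]; exact one_pos
    -- Pairing the relation with the edge from `j` to `i` kills all normals but the `i`-th and
    -- `j`-th; outwardness then fixes the sign of the ratio of their coefficients.
    · have h0 : ⟪∑ l, g l • v l, s.points i - s.points j⟫ =
          g i * ⟪v i, s.points i - s.points j⟫ + g j * ⟪v j, s.points i - s.points j⟫ := by
        rw [sum_inner, ← Finset.sum_subset (Finset.subset_univ {i, j}), Finset.sum_pair hji.symm,
          real_inner_smul_left, real_inner_smul_left]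
        intro l _ hl
        simp only [Finset.mem_insert, Finset.mem_singleton, not_or] at hl
        rw [real_inner_smul_left, hv.orth l i j (Ne.symm hl.1) (Ne.symm hl.2), mul_zero]
      rw [hg, inner_zero_left] at h0
      have h1 := hv.outward i j hji
      have h2 := hv.outward j i hji.symm
      have h3 : ⟪v j, s.points i - s.points j⟫ = -⟪v j, s.points j - s.points i⟫ := by
        rw [← inner_neg_right, neg_sub]
      rw [h3] at h0
      have h4 : g j / g i = ⟪v i, s.points i - s.points j⟫ / ⟪v j, s.points j - s.points i⟫ := by
        have := h2.ne
        field_simp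
        linarith
      rw [h4]
      exact div_pos_of_neg_of_neg h1 h2
  have hsum : 0 < ∑ j, g j / g i := Finset.sum_pos (fun j _ => hpos j) Finset.univ_nonempty
  refine ⟨(∑ j, g j / g i)⁻¹ • fun j => g j / g i,
    ⟨fun j => mul_nonneg (inv_pos.2 hsum).le (hpos j).le, ?_⟩, ?_⟩
  · simp only [Pi.smul_apply, smul_eq_mul, ← Finset.mul_sum]
    exact inv_mul_cancel₀ hsum.ne'
  · rw [mulVec_smul]
    have : gram ℝ v *ᵥ (fun j => g j / g i) = 0 := by
      ext l
      have h : ∑ j, (g j / g i) • v j = 0 := by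
        simp only [div_eq_inv_mul, mul_smul, ← Finset.smul_sum, hg, smul_zero]
      rw [gram_mulVec, h, inner_zero_right]; rfl
    rw [this, smul_zero]

/-- A positive semidefinite matrix rescaled to have unit diagonal. -/
noncomputable def normalizeDiag (H : Matrix (Fin k) (Fin k) ℝ) : Matrix (Fin k) (Fin k) ℝ :=
  Matrix.of fun i j => (√(H i i))⁻¹ * (√(H j j))⁻¹ * H i j

/-- Realisation of Euclidean simplexes with prescribed angles. -/
lemma normalizeDiag_mem_euclideanGram {H : Matrix (Fin (n + 1)) (Fin (n + 1)) ℝ}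
    (hH : H.PosSemidef) (hd : ∀ i, 0 < H i i) {s : Fin (n + 1) → ℝ} (hs : ∀ i, 0 < s i)
    (hHs : H *ᵥ s = 0) (hker : ∀ x, H *ᵥ x = 0 → ∃ c : ℝ, x = c • s) :
    normalizeDiag H ∈ euclideanGram n := by
  set R := CFC.sqrt H with hR
  have hRsymm : R.IsSymm := isSymm_sqrt H
  have hRs : R *ᵥ s = 0 := (sqrt_mulVec_eq_zero_iff hH s).2 hHs
  set S : EuclideanSpace ℝ (Fin (n + 1)) := WithLp.toLp 2 s with hS
  have hS0 : S ≠ 0 := fun h => by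
    have : s 0 = 0 := congrArg (fun x : EuclideanSpace ℝ (Fin (n + 1)) => x 0) h
    exact (hs 0).ne' this
  have hfact : Fact (Module.finrank ℝ (EuclideanSpace ℝ (Fin (n + 1))) = n + 1) := ⟨by simp⟩
  set ι := (OrthonormalBasis.fromOrthogonalSpanSingleton (𝕜 := ℝ) n hS0).repr with hι
  have hmemW : ∀ x : Fin (n + 1) → ℝ, s ⬝ᵥ x = 0 → WithLp.toLp 2 x ∈ (Submodule.span ℝ {S})ᗮ := by
    intro x hx
    rw [Submodule.mem_orthogonal_singleton_iff_inner_right]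
    simpa [hS, PiLp.inner_apply, dotProduct, mul_comm] using hx
  have hrow : ∀ i, s ⬝ᵥ R i = 0 := fun i => by
    have := congrFun hRs i
    rw [mulVec, dotProduct_comm] at this
    exact this
  set r : Fin (n + 1) → EuclideanSpace ℝ (Fin n) := fun i => ι ⟨_, hmemW _ (hrow i)⟩ with hr
  have hrr : ∀ i j, ⟪r i, r j⟫ = H i j := by
    intro i j
    rw [hr]
    simp only
    rw [LinearIsometryEquiv.inner_map_map, Submodule.coe_inner, ← sqrt_row_inner hH i j]
    simp [PiLp.inner_apply, dotProduct, mul_comm, hR]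
  -- The rank-one term fills in the kernel of `R`, which is the line spanned by `s`. This solves `R
  -- *ᵥ x = f` for `f` orthogonal to `s`, with `x` orthogonal to `s` as well.
  have hunit : IsUnit (R + vecMulVec s s).det := by
    rw [isUnit_iff_ne_zero]
    intro h0
    obtain ⟨x, hx, hx0⟩ := exists_mulVec_eq_zero_iff.2 h0
    have h1 : x ⬝ᵥ (R + vecMulVec s s) *ᵥ x = x ⬝ᵥ R *ᵥ x + (s ⬝ᵥ x) ^ 2 := by
      rw [add_mulVec, dotProduct_add, vecMulVec_mulVec, dotProduct_smul, dotProduct_comm x s]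
      simp [sq]
    rw [hx0, dotProduct_zero] at h1
    have h2 : 0 ≤ x ⬝ᵥ R *ᵥ x := by
      simpa using (posSemidef_sqrt H).dotProduct_mulVec_nonneg x
    have h3 : x ⬝ᵥ R *ᵥ x = 0 := by nlinarith [sq_nonneg (s ⬝ᵥ x)]
    have h4 : s ⬝ᵥ x = 0 := by
      rw [h3] at h1
      exact pow_eq_zero_iff two_ne_zero |>.1 (by linarith)
    have h5 : R *ᵥ x = 0 := by
      have := ((posSemidef_sqrt H).dotProduct_mulVec_zero_iff x).1 (by simpa using h3)
      exact this
    obtain ⟨c, rfl⟩ := hker x ((sqrt_mulVec_eq_zero_iff hH x).1 h5)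
    rw [dotProduct_smul, smul_eq_mul] at h4
    have h6 : 0 < s ⬝ᵥ s := Finset.sum_pos (fun i _ => mul_pos (hs i) (hs i)) Finset.univ_nonempty
    rcases mul_eq_zero.1 h4 with h | h
    · exact hx (by rw [h, zero_smul])
    · exact h6.ne' h
  have hsolve : ∀ f : Fin (n + 1) → ℝ, s ⬝ᵥ f = 0 →
      ∃ p : EuclideanSpace ℝ (Fin n), ∀ i, ⟪r i, p⟫ = f i := by
    intro f hf
    set x := (R + vecMulVec s s)⁻¹ *ᵥ f with hx
    have hxf : R *ᵥ x + (s ⬝ᵥ x) • s = f := by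
      have : (R + vecMulVec s s) *ᵥ x = f := by
        rw [hx, mulVec_mulVec, mul_nonsing_inv _ hunit, one_mulVec]
      rw [add_mulVec, vecMulVec_mulVec] at this
      simpa using this
    have hsx : s ⬝ᵥ x = 0 := by
      have h1 := congrArg (s ⬝ᵥ ·) hxf
      simp only [dotProduct_add, hf, dotProduct_smul, quad_comm hRsymm s x, hRs, dotProduct_zero,
        zero_add, smul_eq_mul] at h1
      have h6 : 0 < s ⬝ᵥ s := Finset.sum_pos (fun i _ => mul_pos (hs i) (hs i)) Finset.univ_nonempty
      exact (mul_eq_zero.1 h1).resolve_right h6.ne'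
    rw [hsx, zero_smul, add_zero] at hxf
    refine ⟨ι ⟨_, hmemW x hsx⟩, fun i => ?_⟩
    rw [hr]
    simp only
    rw [LinearIsometryEquiv.inner_map_map, Submodule.coe_inner, ← hxf]
    simp [PiLp.inner_apply, mulVec, dotProduct, mul_comm]
  set σ := ∑ i, s i with hσ
  have hσ0 : 0 < σ := Finset.sum_pos (fun i _ => hs i) Finset.univ_nonempty
  -- The facets are placed on the hyperplanes `⟪r i, x⟫ = 1`, with the `j`-th vertex below its
  -- opposite facet. The defect `σ / s j` makes the right-hand side orthogonal to `s`, as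
  -- solvability requires.
  have hp : ∀ j, ∃ p : EuclideanSpace ℝ (Fin n), ∀ i, ⟪r i, p⟫ = 1 - if i = j then σ / s j else 0 := by
    intro j
    refine hsolve _ ?_
    simp only [dotProduct, mul_sub, mul_one, Finset.sum_sub_distrib, mul_ite, mul_zero,
      Finset.sum_ite_eq', Finset.mem_univ, if_true]
    rw [mul_div_cancel₀ _ (hs j).ne', hσ, sub_self]
  choose p hp using hp
  have hind : AffineIndependent ℝ p := by
    rw [affineIndependent_iff]
    intro t w hw0 hw1 i hi
    have h : ⟪r i, ∑ e ∈ t, w e • p e⟫ = -(w i * (σ / s i)) := by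
      simp only [inner_sum, real_inner_smul_right, hp, mul_sub, mul_one, Finset.sum_sub_distrib, hw0,
        mul_ite, mul_zero, Finset.sum_ite_eq, hi, if_true, zero_sub]
    rw [hw1, inner_zero_right] at h
    have h2 : 0 < σ / s i := div_pos hσ0 (hs i)
    exact (mul_eq_zero.1 (neg_eq_zero.1 h.symm)).resolve_right h2.ne'
  set v : Fin (n + 1) → EuclideanSpace ℝ (Fin n) := fun i => (√(H i i))⁻¹ • r i with hv
  have hinv : ∀ i, 0 < (√(H i i))⁻¹ := fun i => inv_pos.2 (Real.sqrt_pos.2 (hd i))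
  have hnormals : IsEuclideanNormals ⟨p, hind⟩ v := by
    refine ⟨fun i => ?_, fun i j k hj hk => ?_, fun i j hj => ?_⟩
    · rw [hv]
      simp only
      rw [norm_smul, Real.norm_of_nonneg (hinv i).le, norm_eq_sqrt_real_inner (r i), hrr,
        inv_mul_cancel₀ (Real.sqrt_pos.2 (hd i)).ne']
    · simp only [hv, real_inner_smul_left, inner_sub_right, hp, if_neg hj.symm, if_neg hk.symm]
      simp
    · simp only [hv, real_inner_smul_left, inner_sub_right, hp, if_neg hj.symm, if_true]
      rw [← mul_sub]
      refine mul_neg_of_pos_of_neg (hinv i) ?_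
      have h2 : 0 < σ / s i := div_pos hσ0 (hs i)
      linarith
  refine ⟨⟨p, hind⟩, v, hnormals, ?_⟩
  rw [angleGram_of_unit hnormals.norm_eq]
  ext i j
  simp only [normalizeDiag, of_apply, gram_apply, hv, real_inner_smul_left, real_inner_smul_right,
    hrr]
  ring

section Approximation

/-- The difference operator `x ↦ (ε x i / s i - ε x 0 / s 0)`. -/
noncomputable def diffMatrix (s : Fin (n + 1) → ℝ) (ε : ℝ) : Matrix (Fin (n + 1)) (Fin (n + 1)) ℝ :=
  Matrix.of fun i j => (if j = i then ε / s i else 0) - (if j = 0 then ε / s 0 else 0)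

lemma diffMatrix_mulVec (s : Fin (n + 1) → ℝ) (ε : ℝ) (x : Fin (n + 1) → ℝ) (i : Fin (n + 1)) :
    (diffMatrix s ε *ᵥ x) i = ε * (x i / s i - x 0 / s 0) := by
  simp only [mulVec, dotProduct, diffMatrix, of_apply, sub_mul, ite_mul, zero_mul,
    Finset.sum_sub_distrib, Finset.sum_ite_eq', Finset.mem_univ, if_true]
  ring

/-- The factor `ε` in `diffMatrix` keeps its entries bounded even where `y i = 0` and `s i = ε`; the
additional `ε` in `perturbGram` makes the correction vanish in the limit. -/
lemma abs_diffMatrix_le {s : Fin (n + 1) → ℝ} {ε : ℝ} (hε : 0 < ε) (hs : ∀ i, ε ≤ s i)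
    (i j : Fin (n + 1)) : |diffMatrix s ε i j| ≤ 1 := by
  have h : ∀ l, 0 ≤ ε / s l ∧ ε / s l ≤ 1 := fun l =>
    ⟨div_nonneg hε.le (hε.le.trans (hs l)), (div_le_one (hε.trans_le (hs l))).2 (hs l)⟩
  have h1 := h i
  have h2 := h 0
  simp only [diffMatrix, of_apply]
  rw [abs_le]
  split_ifs <;> constructor <;> linarith [h1.1, h1.2, h2.1, h2.2]

/-- The matrix moving the `j₀`-th vector by a multiple of the sum of all vectors. -/
noncomputable def shiftMatrix (j₀ : Fin k) (c : ℝ) : Matrix (Fin k) (Fin k) ℝ :=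
  1 - vecMulVec (Pi.single j₀ c) 1

/-- Perturbation of a positive semidefinite matrix to one with a prescribed kernel. -/
noncomputable def perturbGram (A : Matrix (Fin (n + 1)) (Fin (n + 1)) ℝ) (y : Fin (n + 1) → ℝ)
    (j₀ : Fin (n + 1)) (ε : ℝ) : Matrix (Fin (n + 1)) (Fin (n + 1)) ℝ :=
  shiftMatrix j₀ (ε / (y j₀ + ε)) * A * (shiftMatrix j₀ (ε / (y j₀ + ε)))ᵀ +
    ε • ((diffMatrix (fun i => y i + ε) ε)ᵀ * diffMatrix (fun i => y i + ε) ε)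

variable {A : Matrix (Fin (n + 1)) (Fin (n + 1)) ℝ} {y : Fin (n + 1) → ℝ} {j₀ : Fin (n + 1)} {ε : ℝ}

lemma posSemidef_perturbGram (hA : A.PosSemidef) (hε : 0 < ε) :
    (perturbGram A y j₀ ε).PosSemidef := by
  have h1 := hA.mul_mul_conjTranspose_same (shiftMatrix j₀ (ε / (y j₀ + ε)))
  have h2 := posSemidef_conjTranspose_mul_self (diffMatrix (fun i => y i + ε) ε)
  rw [conjTranspose_eq_transpose_of_trivial] at h1 h2
  exact h1.add (h2.smul hε.le)

/-- The transposed shift takes `y + ε` back to `y`, which `A` kills, while the difference operator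
kills `y + ε` directly. -/
lemma perturbGram_mulVec (hε : 0 < ε) (hy0 : ∀ i, 0 ≤ y i) (hy : A *ᵥ y = 0) :
    perturbGram A y j₀ ε *ᵥ (fun i => y i + ε) = 0 := by
  have hs : ∀ i, 0 < y i + ε := fun i => by linarith [hy0 i]
  have h1 : (shiftMatrix j₀ (ε / (y j₀ + ε)))ᵀ *ᵥ (fun i => y i + ε) = y := by
    ext i
    rw [shiftMatrix, transpose_sub, transpose_one, transpose_vecMulVec, sub_mulVec, one_mulVec,
      vecMulVec_mulVec]
    simp [(hs j₀).ne']
  have h2 : diffMatrix (fun i => y i + ε) ε *ᵥ (fun i => y i + ε) = 0 := by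
    ext i
    rw [diffMatrix_mulVec, div_self (hs i).ne', div_self (hs 0).ne']
    simp
  rw [perturbGram, add_mulVec, ← mulVec_mulVec, h1, ← mulVec_mulVec, hy, smul_mulVec,
    ← mulVec_mulVec, h2]
  simp

/-- Both summands are positive semidefinite, so a null vector is killed by the difference operator;
its coordinates are thus proportional to `y + ε`. -/
lemma eq_smul_of_perturbGram_mulVec (hA : A.PosSemidef) (hε : 0 < ε) (hy0 : ∀ i, 0 ≤ y i)
    {x : Fin (n + 1) → ℝ} (hx : perturbGram A y j₀ ε *ᵥ x = 0) :
    ∃ c : ℝ, x = c • fun i => y i + ε := by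
  have hs : ∀ i, 0 < y i + ε := fun i => by linarith [hy0 i]
  have h1 := hA.mul_mul_conjTranspose_same (shiftMatrix j₀ (ε / (y j₀ + ε)))
  rw [conjTranspose_eq_transpose_of_trivial] at h1
  have h2 : 0 ≤ x ⬝ᵥ (shiftMatrix j₀ (ε / (y j₀ + ε)) * A *
      (shiftMatrix j₀ (ε / (y j₀ + ε)))ᵀ) *ᵥ x := by
    simpa using h1.dotProduct_mulVec_nonneg x
  set D := diffMatrix (fun i => y i + ε) ε with hD
  have h3 : x ⬝ᵥ (Dᵀ * D) *ᵥ x = (D *ᵥ x) ⬝ᵥ (D *ᵥ x) := by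
    rw [← mulVec_mulVec, dotProduct_mulVec, vecMul_transpose]
  have h4 : 0 ≤ (D *ᵥ x) ⬝ᵥ (D *ᵥ x) := Finset.sum_nonneg fun i _ => mul_self_nonneg _
  have h5 : x ⬝ᵥ perturbGram A y j₀ ε *ᵥ x = 0 := by rw [hx, dotProduct_zero]
  rw [perturbGram, add_mulVec, dotProduct_add, smul_mulVec, dotProduct_smul, ← hD, h3,
    smul_eq_mul] at h5
  have h6 : (D *ᵥ x) ⬝ᵥ (D *ᵥ x) = 0 := by nlinarith
  have h7 := dotProduct_self_eq_zero.1 h6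
  refine ⟨x 0 / (y 0 + ε), funext fun i => ?_⟩
  have h8 := congrFun h7 i
  rw [hD, diffMatrix_mulVec] at h8
  have h9 := (mul_eq_zero.1 h8).resolve_left hε.ne'
  have := (hs i).ne'
  rw [Pi.smul_apply, smul_eq_mul, ← sub_eq_zero.1 h9, div_mul_cancel₀ _ this]

lemma tendsto_perturbGram (hy0 : ∀ i, 0 ≤ y i) (hj : 0 < y j₀) :
    Tendsto (perturbGram A y j₀) (𝓝[>] 0) (𝓝 A) := by
  have hid : Tendsto (fun ε : ℝ => ε) (𝓝[>] 0) (𝓝 0) := tendsto_nhdsWithin_of_tendsto_nhds tendsto_id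
  have h1 : Tendsto (fun ε : ℝ => shiftMatrix j₀ (ε / (y j₀ + ε))) (𝓝[>] 0) (𝓝 1) := by
    have hc : Tendsto (fun ε : ℝ => ε / (y j₀ + ε)) (𝓝[>] 0) (𝓝 0) := by
      have : Tendsto (fun ε : ℝ => ε / (y j₀ + ε)) (𝓝[>] 0) (𝓝 (0 / (y j₀ + 0))) :=
        hid.div (hid.const_add (y j₀)) (by simpa using hj.ne')
      simpa using this
    have hcont : Continuous fun c : ℝ => shiftMatrix j₀ c := by
      unfold shiftMatrix
      refine continuous_const.sub (Continuous.matrix_vecMulVec ?_ continuous_const)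
      refine continuous_pi fun i => ?_
      rcases eq_or_ne i j₀ with rfl | h
      · simpa using continuous_id'
      · simpa [h] using continuous_const
    have h : shiftMatrix j₀ 0 = 1 := by simp [shiftMatrix]
    rw [← h]
    exact (hcont.tendsto 0).comp hc
  have h2 : Tendsto (fun ε : ℝ => ε • ((diffMatrix (fun i => y i + ε) ε)ᵀ *
      diffMatrix (fun i => y i + ε) ε)) (𝓝[>] 0) (𝓝 0) := by
    refine tendsto_pi_nhds.2 fun a => tendsto_pi_nhds.2 fun b => ?_
    have hbound : Tendsto (fun ε : ℝ => ε * (n + 1 : ℝ)) (𝓝[>] 0) (𝓝 0) := by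
      simpa using hid.mul_const (n + 1 : ℝ)
    refine squeeze_zero_norm' ?_ hbound
    filter_upwards [self_mem_nhdsWithin] with ε hε
    have hε' : 0 < ε := hε
    have hD := abs_diffMatrix_le hε' (s := fun i => y i + ε) (fun i => by linarith [hy0 i])
    rw [Matrix.smul_apply, smul_eq_mul, norm_mul, Real.norm_of_nonneg hε'.le, mul_apply]
    gcongr
    refine (norm_sum_le _ _).trans ?_
    calc _ ≤ ∑ _i : Fin (n + 1), (1 : ℝ) := Finset.sum_le_sum fun i _ => by
          rw [norm_mul, transpose_apply]
          exact mul_le_one₀ (hD i a) (norm_nonneg _) (hD i b)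
      _ = n + 1 := by simp
  have h3 : Tendsto (fun ε : ℝ => shiftMatrix j₀ (ε / (y j₀ + ε)) * A *
      (shiftMatrix j₀ (ε / (y j₀ + ε)))ᵀ) (𝓝[>] 0) (𝓝 (1 * A * (1 : Matrix _ _ ℝ)ᵀ)) :=
    (h1.mul tendsto_const_nhds).mul ((continuous_id.matrix_transpose.tendsto _).comp h1)
  have h4 := h3.add h2
  rw [transpose_one, one_mul, mul_one, add_zero] at h4
  exact h4

/-- Positive semidefinite matrices with unit diagonal and a nonnegative null vector are limits of
angle Gram matrices of Euclidean simplexes. -/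
lemma mem_closure_euclideanGram (hA : A.PosSemidef) (h1 : ∀ i, A i i = 1)
    (hy : y ∈ stdSimplex ℝ (Fin (n + 1))) (hAy : A *ᵥ y = 0) : A ∈ closure (euclideanGram n) := by
  obtain ⟨j₀, hj⟩ : ∃ i, 0 < y i := by
    by_contra! h
    have : ∑ i, y i ≤ 0 := Finset.sum_nonpos fun i _ => h i
    linarith [hy.2]
  have hlim := tendsto_perturbGram (A := A) hy.1 hj
  have hent : ∀ i j, Tendsto (fun ε => perturbGram A y j₀ ε i j) (𝓝[>] 0) (𝓝 (A i j)) := fun i j =>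
    ((continuous_id.matrix_elem i j).tendsto A).comp hlim
  have hdiag : ∀ᶠ ε in 𝓝[>] (0 : ℝ), ∀ i, 0 < perturbGram A y j₀ ε i i :=
    eventually_all.2 fun i => (hent i i).eventually_const_lt (by rw [h1]; exact one_pos)
  have hnorm : Tendsto (fun ε => normalizeDiag (perturbGram A y j₀ ε)) (𝓝[>] 0) (𝓝 A) := by
    refine tendsto_pi_nhds.2 fun i => tendsto_pi_nhds.2 fun j => ?_
    have hinv : ∀ i, Tendsto (fun ε => (√(perturbGram A y j₀ ε i i))⁻¹) (𝓝[>] 0) (𝓝 1) := by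
      intro i
      have := ((hent i i).sqrt).inv₀ (by rw [h1]; simp)
      simpa [h1] using this
    simpa [normalizeDiag] using ((hinv i).mul (hinv j)).mul (hent i j)
  refine mem_closure_of_tendsto hnorm ?_
  filter_upwards [hdiag, self_mem_nhdsWithin] with ε hε hε0
  have hε' : 0 < ε := hε0
  exact normalizeDiag_mem_euclideanGram (posSemidef_perturbGram hA hε') hε
    (fun i => by linarith [hy.1 i]) (perturbGram_mulVec hε' hy.1 hAy)
    fun x hx => eq_smul_of_perturbGram_mulVec hA hε' hy.1 hx

lemma posSemidef_of_mem_closure_euclideanGram (hA : A ∈ closure (euclideanGram n)) :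
    A.PosSemidef ∧ ∃ y ∈ stdSimplex ℝ (Fin (n + 1)), A *ᵥ y = 0 :=
  closure_minimal (s := euclideanGram n) (t := {A | A.PosSemidef} ∩ {A | ∃ y ∈
    stdSimplex ℝ (Fin (n + 1)), A *ᵥ y = 0}) (fun _ h => exists_null_of_mem_euclideanGram h)
    (isClosed_posSemidef.inter isClosed_exists_null) hA

end Approximation

end SimplexVolume

/-! ### Limits of hyperbolic angle Gram matrices -/

namespace SimplexVolume

open Filter Topology Matrix Pointwise MatrixOrder

variable {n k m : ℕ}

/-- A closed condition satisfied by the angle Gram matrices of hyperbolic simplexes. The vector `y`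
is proportional to the vector of the areas of the facets of a simplex with equal heights over the
incenter. -/
structure IsWeaklyHyperbolic (A : Matrix (Fin k) (Fin k) ℝ) : Prop where
  symm : A.IsSymm
  diag : ∀ i, A i i = 1
  facet : ∀ x i, x i = 0 → 0 ≤ x ⬝ᵥ A *ᵥ x
  incenter : ∃ y ∈ stdSimplex ℝ (Fin k), (∀ i, (A *ᵥ y) i = y ⬝ᵥ A *ᵥ y) ∧ y ⬝ᵥ A *ᵥ y ≤ 0

lemma isClosed_isWeaklyHyperbolic : IsClosed {A : Matrix (Fin k) (Fin k) ℝ | IsWeaklyHyperbolic A} := by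
  have : {A : Matrix (Fin k) (Fin k) ℝ | IsWeaklyHyperbolic A} =
      {A | Aᵀ = A} ∩ ((⋂ i, {A | A i i = 1}) ∩ ((⋂ x : Fin k → ℝ, ⋂ i, ⋂ _ : x i = 0,
        {A | 0 ≤ x ⬝ᵥ A *ᵥ x}) ∩ {A | ∃ y ∈ stdSimplex ℝ (Fin k), (y, A) ∈
          {p : (Fin k → ℝ) × Matrix (Fin k) (Fin k) ℝ |
            (∀ i, (p.2 *ᵥ p.1) i = p.1 ⬝ᵥ p.2 *ᵥ p.1) ∧ p.1 ⬝ᵥ p.2 *ᵥ p.1 ≤ 0}})) := by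
    ext A
    simp only [Set.mem_inter_iff, Set.mem_iInter, Set.mem_ofPred_eq]
    exact ⟨fun h => ⟨h.1, h.2, h.3, h.4⟩, fun h => ⟨h.1, h.2.1, h.2.2.1, h.2.2.2⟩⟩
  rw [this]
  have hq : Continuous fun p : (Fin k → ℝ) × Matrix (Fin k) (Fin k) ℝ => p.1 ⬝ᵥ p.2 *ᵥ p.1 := by
    simp only [quad_eq_sum]; fun_prop
  refine (isClosed_eq (by fun_prop) continuous_id).inter ((isClosed_iInter fun i =>
    isClosed_eq (by fun_prop) continuous_const).inter ((isClosed_iInter fun x => isClosed_iInter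
      fun i => isClosed_iInter fun _ => isClosed_le continuous_const ?_).inter ?_))
  · simp only [quad_eq_sum]; fun_prop
  · refine isClosed_exists_mem_of_isCompact (isCompact_stdSimplex ℝ (Fin k)) ?_
    have : {p : (Fin k → ℝ) × Matrix (Fin k) (Fin k) ℝ |
        (∀ i, (p.2 *ᵥ p.1) i = p.1 ⬝ᵥ p.2 *ᵥ p.1) ∧ p.1 ⬝ᵥ p.2 *ᵥ p.1 ≤ 0} =
        (⋂ i, {p | (p.2 *ᵥ p.1) i = p.1 ⬝ᵥ p.2 *ᵥ p.1}) ∩ {p | p.1 ⬝ᵥ p.2 *ᵥ p.1 ≤ 0} := by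
      ext p; simp
    rw [this]
    refine (isClosed_iInter fun i => isClosed_eq ?_ hq).inter (isClosed_le hq continuous_const)
    simp only [mulVec, dotProduct]
    fun_prop

namespace IsHyperbolicMatrix

variable {A : Matrix (Fin (m + 1)) (Fin (m + 1)) ℝ}

/-- The normalised row sums of `-A⁻¹` work, since `A` sends them to a constant vector. -/
lemma exists_incenter (hA : IsHyperbolicMatrix A) : ∃ y ∈ stdSimplex ℝ (Fin (m + 1)),
    ∀ i, (A *ᵥ y) i = -(∑ i, ∑ j, (-A⁻¹) i j)⁻¹ := by
  set σ := ∑ i, ∑ j, (-A⁻¹) i j with hσ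
  have hσ0 : 0 < σ := hA.lorentzian.sum_pos
  have hrow : ∀ i, ((-A⁻¹) *ᵥ 1) i = ∑ j, (-A⁻¹) i j := fun i => by
    simp [mulVec, dotProduct]
  refine ⟨σ⁻¹ • ((-A⁻¹) *ᵥ 1), ⟨fun i => ?_, ?_⟩, fun i => ?_⟩
  · rw [Pi.smul_apply, hrow]
    exact mul_nonneg (inv_pos.2 hσ0).le (Finset.sum_nonneg fun j _ => (hA.lorentzian.pos i j).le)
  · simp only [Pi.smul_apply, smul_eq_mul, hrow, ← Finset.mul_sum]
    exact inv_mul_cancel₀ hσ0.ne'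
  · rw [mulVec_smul, neg_mulVec, mulVec_neg, mulVec_mulVec,
      mul_nonsing_inv _ hA.det_ne_zero.isUnit, one_mulVec]
    simp

lemma quad_incenter {y : Fin (m + 1) → ℝ} (hy : y ∈ stdSimplex ℝ (Fin (m + 1))) {c : ℝ}
    (h : ∀ i, (A *ᵥ y) i = c) : y ⬝ᵥ A *ᵥ y = c := by
  simp only [dotProduct, h, ← Finset.sum_mul, hy.2, one_mul]

lemma isWeaklyHyperbolic (hA : IsHyperbolicMatrix A) : IsWeaklyHyperbolic A where
  symm := hA.symm
  diag := hA.diag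
  facet := hA.facet
  incenter := by
    obtain ⟨y, hy, h⟩ := hA.exists_incenter
    have hq := quad_incenter hy h
    refine ⟨y, hy, fun i => by rw [h, hq], ?_⟩
    rw [hq]
    exact (neg_neg_of_pos (inv_pos.2 hA.lorentzian.sum_pos)).le

lemma not_posSemidef (hA : IsHyperbolicMatrix A) : ¬ A.PosSemidef := by
  intro hpsd
  obtain ⟨y, hy, h⟩ := hA.exists_incenter
  have hq := quad_incenter hy h
  have h2 : 0 ≤ y ⬝ᵥ A *ᵥ y := by simpa using hpsd.dotProduct_mulVec_nonneg y
  have := inv_pos.2 hA.lorentzian.sum_pos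
  rw [hq] at h2
  linarith

/-- The inradius is controlled by the distance to positive semidefinite matrices. -/
lemma inv_sum_le (hA : IsHyperbolicMatrix A) {B : Matrix (Fin (m + 1)) (Fin (m + 1)) ℝ}
    (hB : B.PosSemidef) : (∑ i, ∑ j, (-A⁻¹) i j)⁻¹ ≤ ∑ i, ∑ j, |B i j - A i j| := by
  obtain ⟨y, hy, h⟩ := hA.exists_incenter
  have hq := quad_incenter hy h
  have h2 : 0 ≤ y ⬝ᵥ B *ᵥ y := by simpa using hB.dotProduct_mulVec_nonneg y
  have hy1 : ∀ i, y i ≤ 1 := fun i => by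
    rw [← hy.2]; exact Finset.single_le_sum (fun j _ => hy.1 j) (Finset.mem_univ i)
  have h3 : y ⬝ᵥ B *ᵥ y - y ⬝ᵥ A *ᵥ y ≤ ∑ i, ∑ j, |B i j - A i j| := by
    rw [quad_eq_sum, quad_eq_sum, ← Finset.sum_sub_distrib]
    refine Finset.sum_le_sum fun i _ => ?_
    rw [← Finset.sum_sub_distrib]
    refine Finset.sum_le_sum fun j _ => ?_
    rw [← sub_mul]
    have hyy : 0 ≤ y i * y j := mul_nonneg (hy.1 i) (hy.1 j)
    have hyy1 : y i * y j ≤ 1 := mul_le_one₀ (hy1 i) (hy.1 j) (hy1 j)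
    calc (B i j - A i j) * (y i * y j) ≤ |B i j - A i j| * (y i * y j) := by
          gcongr; exact le_abs_self _
      _ ≤ |B i j - A i j| * 1 := by gcongr
      _ = _ := mul_one _
  linarith

lemma inv_neg_inv (hA : IsHyperbolicMatrix A) : (-A⁻¹)⁻¹ = -A := by
  refine inv_eq_right_inv ?_
  rw [neg_mul_neg, nonsing_inv_mul _ hA.det_ne_zero.isUnit]

end IsHyperbolicMatrix

namespace IsWeaklyHyperbolic

variable {A : Matrix (Fin k) (Fin k) ℝ}

/-- Semidefiniteness forces the nonpositive value of the form at the incenter weights to be zero,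
and all coordinates of `A *ᵥ y` equal that value. -/
lemma exists_null (hA : IsWeaklyHyperbolic A) (hpsd : A.PosSemidef) :
    ∃ y ∈ stdSimplex ℝ (Fin k), A *ᵥ y = 0 := by
  obtain ⟨y, hy, h1, h2⟩ := hA.incenter
  have h3 : 0 ≤ y ⬝ᵥ A *ᵥ y := by simpa using hpsd.dotProduct_mulVec_nonneg y
  exact ⟨y, hy, funext fun i => by rw [h1, le_antisymm h2 h3]; rfl⟩

lemma exists_quad_neg (hA : IsWeaklyHyperbolic A) (hpsd : ¬ A.PosSemidef) :
    ∃ y, y ⬝ᵥ A *ᵥ y < 0 := by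
  by_contra! h
  refine hpsd (PosSemidef.of_dotProduct_mulVec_nonneg ?_ fun x => by simpa using h x)
  rw [IsHermitian, conjTranspose_eq_transpose_of_trivial]
  exact hA.symm

/-- Degenerate limits of hyperbolic angle Gram matrices are positive semidefinite. -/
lemma det_ne_zero (hA : IsWeaklyHyperbolic A) (hpsd : ¬ A.PosSemidef) : A.det ≠ 0 := by
  intro h0
  obtain ⟨w, hw, hw0⟩ := exists_mulVec_eq_zero_iff.2 h0
  obtain ⟨y, hy⟩ := hA.exists_quad_neg hpsd
  obtain ⟨i, hi⟩ := Function.ne_iff.1 hw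
  -- Moving a negative vector along the kernel does not change the form, but brings it into a
  -- coordinate hyperplane, where the form is nonnegative.
  have h := hA.facet (y - (y i / w i) • w) i (by
    have : w i ≠ 0 := hi
    simp [this])
  have hyw : w ⬝ᵥ A *ᵥ y = 0 := by rw [quad_comm hA.symm, hw0, dotProduct_zero]
  simp only [mulVec_sub, mulVec_smul, hw0, smul_zero, sub_zero, sub_dotProduct, smul_dotProduct,
    hyw] at h
  linarith

/-- In a nondegenerate limit of hyperbolic simplexes, distinct vertices stay distinct. -/
lemma off_diagonal_pos (hk : 3 ≤ k) (hA : IsWeaklyHyperbolic A) (hdet : A.det ≠ 0)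
    (hnonneg : ∀ i j, 0 ≤ (-A⁻¹) i j) {i j : Fin k} (hij : i ≠ j) : 0 < (-A⁻¹) i j := by
  set C := -A⁻¹ with hC
  have hunit : IsUnit A.det := hdet.isUnit
  have hCs : C.IsSymm := by
    rw [hC, IsSymm, transpose_neg, transpose_nonsing_inv, hA.symm.eq]
  -- The facet condition in dual form: the orthogonal complement of a vertex contains no timelike
  -- vector, even if the vertex is ideal.
  have hfacet : ∀ (t : Fin k → ℝ) (l : Fin k), (C *ᵥ t) l = 0 → t ⬝ᵥ C *ᵥ t ≤ 0 := by
    intro t l ht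
    have h1 := hA.facet (C *ᵥ t) l ht
    have h2 : A *ᵥ (C *ᵥ t) = -t := by
      rw [mulVec_mulVec, hC, mul_neg, mul_nonsing_inv _ hunit, neg_mulVec, one_mulVec]
    rw [h2, dotProduct_neg, dotProduct_comm] at h1
    linarith
  refine lt_of_le_of_ne (hnonneg i j) fun h0 => ?_
  obtain ⟨l, hli, hlj⟩ : ∃ l, l ≠ i ∧ l ≠ j := by
    have : ({i, j} : Finset (Fin k)).card < Fintype.card (Fin k) := by
      refine (Finset.card_le_two).trans_lt ?_
      simp; omega
    obtain ⟨l, -, hl⟩ := Finset.exists_mem_notMem_of_card_lt_card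
      (s := {i, j}) (t := Finset.univ) this
    simp only [Finset.mem_insert, Finset.mem_singleton, not_or] at hl
    exact ⟨l, hl⟩
  obtain ⟨α, β, hαβ, hl⟩ : ∃ α β : ℝ, (α ≠ 0 ∨ β ≠ 0) ∧ C l i * α + C l j * β = 0 := by
    by_cases hb : C l j = 0
    · by_cases ha : C l i = 0
      · exact ⟨1, 0, Or.inl one_ne_zero, by simp [ha]⟩
      · exact ⟨0, 1, Or.inr one_ne_zero, by simp [hb]⟩
    · exact ⟨C l j, -C l i, Or.inl hb, by ring⟩
  -- If `C i j = 0`, the form is nonnegative on the span of these two vertices, which contains a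
  -- nonzero `t` orthogonal to a third vertex `l`.
  set t : Fin k → ℝ := α • Pi.single i 1 + β • Pi.single j 1 with ht
  have hCt : (C *ᵥ t) l = 0 := by
    rw [ht, mulVec_add, mulVec_smul, mulVec_smul]
    simpa [mul_comm] using hl
  have hQt : 0 ≤ t ⬝ᵥ C *ᵥ t := by
    have hji : C j i = 0 := by rw [hCs.apply, ← h0]
    simp only [ht, mulVec_add, mulVec_smul, dotProduct_add, dotProduct_smul, add_dotProduct,
      smul_dotProduct, IsLorentzian.single_quad, ← h0, hji, smul_eq_mul, mul_zero, zero_add,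
      add_zero]
    nlinarith [mul_nonneg (hnonneg i i) (sq_nonneg α), mul_nonneg (hnonneg j j) (sq_nonneg β)]
  obtain ⟨p, hpl, hp⟩ : ∃ p, p ≠ l ∧ t p ≠ 0 := by
    rcases hαβ with h | h
    · exact ⟨i, hli.symm, by simpa [ht, hij] using h⟩
    · exact ⟨j, hlj.symm, by simpa [ht, hij.symm] using h⟩
  -- `r` represents the normal of facet `p`, also orthogonal to vertex `l`. Adding `t p • r` raises
  -- the form by `2 * t p ^ 2 - t p ^ 2 > 0`, contradicting the dual facet condition.
  set r : Fin k → ℝ := -(A *ᵥ Pi.single p 1) with hr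
  have hCr : C *ᵥ r = Pi.single p 1 := by
    rw [hr, hC, neg_mulVec, mulVec_neg, neg_neg, mulVec_mulVec, nonsing_inv_mul _ hunit, one_mulVec]
  have hrr : r ⬝ᵥ C *ᵥ r = -1 := by
    rw [hCr, hr]; simp [hA.diag]
  have htr : t ⬝ᵥ C *ᵥ r = t p := by rw [hCr]; simp
  have hrt : r ⬝ᵥ C *ᵥ t = t p := by rw [quad_comm hCs, htr]
  have hfin := hfacet (t + t p • r) l (by
    rw [mulVec_add, mulVec_smul, hCr]
    simp [hCt, hpl.symm])
  simp only [mulVec_add, mulVec_smul, dotProduct_add, dotProduct_smul, add_dotProduct,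
    smul_dotProduct, smul_eq_mul, hrr, htr, hrt] at hfin
  have : 0 < t p ^ 2 := by positivity
  nlinarith

end IsWeaklyHyperbolic

lemma volume_orthantBody_pos (C : Matrix (Fin k) (Fin k) ℝ) : 0 < volume (orthantBody C) := by
  set O : Set (Fin k → ℝ) := (⋂ i, {t | 0 < t i}) ∩ {t | t ⬝ᵥ C *ᵥ t < 1} with hO
  have hOo : IsOpen O := (isOpen_iInter_of_finite fun i =>
    isOpen_lt continuous_const (continuous_apply i)).inter
      (isOpen_lt (continuous_quad C) continuous_const)
  have hsub : O ⊆ orthantBody C := by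
    rintro t ⟨h1, h2⟩
    exact ⟨fun i => (Set.mem_iInter.1 h1 i : _ < _).le, h2⟩
  have hne : O.Nonempty := by
    have h1 : Tendsto (fun ε : ℝ => (ε • (1 : Fin k → ℝ)) ⬝ᵥ C *ᵥ (ε • (1 : Fin k → ℝ)))
        (𝓝[>] 0) (𝓝 0) := by
      simp only [quad_smul]
      have : Tendsto (fun ε : ℝ => ε ^ 2 * ((1 : Fin k → ℝ) ⬝ᵥ C *ᵥ 1)) (𝓝 0)
          (𝓝 (0 ^ 2 * ((1 : Fin k → ℝ) ⬝ᵥ C *ᵥ 1))) := by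
        exact (Continuous.tendsto (by fun_prop) 0)
      simpa using tendsto_nhdsWithin_of_tendsto_nhds this
    obtain ⟨ε, hε, hε0⟩ := ((h1.eventually_lt_const one_pos).and self_mem_nhdsWithin).exists
    refine ⟨ε • 1, Set.mem_iInter.2 fun i => ?_, hε⟩
    simpa using hε0
  exact (hOo.measure_pos volume hne).trans_le (measure_mono hsub)

/-! ### Continuous extension of the volume and its zero set -/

section Extension

instance : FirstCountableTopology (Matrix (Fin k) (Fin k) ℝ) :=
  inferInstanceAs (FirstCountableTopology (Fin k → Fin k → ℝ))

lemma tendsto_matrix_inv {A : Matrix (Fin k) (Fin k) ℝ} (hA : A.det ≠ 0) :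
    Tendsto (fun B : Matrix (Fin k) (Fin k) ℝ => B⁻¹) (𝓝 A) (𝓝 A⁻¹) := by
  simp only [inv_def, Ring.inverse_eq_inv']
  exact ((continuous_id.matrix_det.tendsto A).inv₀ hA).smul (continuous_id.matrix_adjugate.tendsto A)

open Classical in
/-- The volume as a function of the angle Gram matrix. -/
noncomputable def gramVolume (n : ℕ) (A : Matrix (Fin (n + 1)) (Fin (n + 1)) ℝ) : ℝ :=
  if A.PosSemidef then (n + 1) * (volume (polarBody (CFC.sqrt A))).toReal
  else (n + 1) * (normVolume (-A⁻¹)).toReal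

lemma gramVolume_of_posSemidef {A : Matrix (Fin (n + 1)) (Fin (n + 1)) ℝ} (hA : A.PosSemidef) :
    gramVolume n A = (n + 1) * (volume (polarBody (CFC.sqrt A))).toReal := if_pos hA

lemma gramVolume_of_not_posSemidef {A : Matrix (Fin (n + 1)) (Fin (n + 1)) ℝ}
    (hA : ¬ A.PosSemidef) : gramVolume n A = (n + 1) * (normVolume (-A⁻¹)).toReal := if_neg hA

lemma isHyperbolicMatrix_of_mem (hn : 2 ≤ n) {A : Matrix (Fin (n + 1)) (Fin (n + 1)) ℝ}
    (hA : A ∈ hyperbolicGram n) : IsHyperbolicMatrix A := by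
  obtain ⟨u, hu⟩ := hA
  exact (hu.exists_dual hn).1

lemma posSemidef_of_mem_closure_sphericalGram {A : Matrix (Fin (n + 1)) (Fin (n + 1)) ℝ}
    (hA : A ∈ closure (sphericalGram n)) : A.PosSemidef ∧ ∀ i, A i i = 1 := by
  have hcl : IsClosed ({A : Matrix (Fin (n + 1)) (Fin (n + 1)) ℝ | A.PosSemidef} ∩
      ⋂ i, {A | A i i = 1}) :=
    isClosed_posSemidef.inter (isClosed_iInter fun i => isClosed_eq (by fun_prop) continuous_const)
  have h : sphericalGram n ⊆ {A : Matrix (Fin (n + 1)) (Fin (n + 1)) ℝ | A.PosSemidef} ∩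
      ⋂ i, {A | A i i = 1} := by
    rintro B ⟨u, hu⟩
    exact ⟨hu.volume_eq.1, Set.mem_iInter.2 hu.volume_eq.2.1⟩
  have := closure_minimal h hcl hA
  refine ⟨this.1, ?_⟩
  simpa only [Set.mem_iInter, Set.mem_ofPred_eq] using this.2

lemma isWeaklyHyperbolic_of_mem_closure (hn : 2 ≤ n) {A : Matrix (Fin (n + 1)) (Fin (n + 1)) ℝ}
    (hA : A ∈ closure (hyperbolicGram n)) : IsWeaklyHyperbolic A :=
  closure_minimal (t := {A | IsWeaklyHyperbolic A})
    (fun _ hB => (isHyperbolicMatrix_of_mem hn hB).isWeaklyHyperbolic)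
    isClosed_isWeaklyHyperbolic hA

lemma tendsto_gramVolume_spherical {A : Matrix (Fin (n + 1)) (Fin (n + 1)) ℝ}
    (hA : A ∈ closure (sphericalGram n)) :
    Tendsto (gramVolume n) (𝓝[sphericalGram n] A) (𝓝 (gramVolume n A)) := by
  obtain ⟨hpsd, hdiag⟩ := posSemidef_of_mem_closure_sphericalGram hA
  have hsub : sphericalGram n ⊆ {A | A.PosSemidef} := fun B hB =>
    (posSemidef_of_mem_closure_sphericalGram (subset_closure hB)).1
  have hsqrt := (continuousOn_matrix_sqrt A hpsd).mono_left (nhdsWithin_mono A hsub)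
  have hvol := tendsto_volume_polarBody hsqrt (sqrt_row_ne_zero hpsd hdiag)
  have hreal := ((ENNReal.tendsto_toReal (volume_polarBody_lt_top _).ne).comp hvol).const_mul
    ((n : ℝ) + 1)
  rw [gramVolume_of_posSemidef hpsd]
  refine hreal.congr' ?_
  filter_upwards [self_mem_nhdsWithin] with B hB
  exact (gramVolume_of_posSemidef (hsub hB)).symm

lemma gramVolume_eq_zero_iff {A : Matrix (Fin (n + 1)) (Fin (n + 1)) ℝ} (hpsd : A.PosSemidef)
    (hdiag : ∀ i, A i i = 1) : gramVolume n A = 0 ↔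
      ∃ y ∈ stdSimplex ℝ (Fin (n + 1)), A *ᵥ y = 0 := by
  have hn : (n : ℝ) + 1 ≠ 0 := by positivity
  rw [gramVolume_of_posSemidef hpsd, ← volume_polarBody_eq_zero_iff hpsd hdiag, mul_eq_zero,
    or_iff_right hn, ENNReal.toReal_eq_zero_iff, or_iff_left (volume_polarBody_lt_top _).ne]

/-- The value at `A` is zero because the incenter weights become a null vector. Nearby hyperbolic
volumes are bounded by a constant times the square root of the entrywise distance to `A`. -/
lemma tendsto_gramVolume_euclidean (hn : 2 ≤ n) {A : Matrix (Fin (n + 1)) (Fin (n + 1)) ℝ}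
    (hA : A ∈ closure (hyperbolicGram n)) (hpsd : A.PosSemidef) :
    Tendsto (gramVolume n) (𝓝[hyperbolicGram n] A) (𝓝 (gramVolume n A)) := by
  have hweak := isWeaklyHyperbolic_of_mem_closure hn hA
  rw [(gramVolume_eq_zero_iff hpsd hweak.diag).2 (hweak.exists_null hpsd)]
  obtain ⟨m, rfl⟩ : ∃ m, n = m + 2 := ⟨n - 2, by omega⟩
  obtain ⟨K, hK, hbound⟩ := IsLorentzian.exists_normVolume_le_inradius m
  set δ : Matrix (Fin (m + 2 + 1)) (Fin (m + 2 + 1)) ℝ → ℝ :=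
    fun B => √(∑ i, ∑ j, |A i j - B i j|) with hδ
  have hδ0 : Tendsto (fun B => K * ENNReal.ofReal (δ B)) (𝓝[hyperbolicGram (m + 2)] A) (𝓝 0) := by
    have h1 : Tendsto δ (𝓝[hyperbolicGram (m + 2)] A) (𝓝 (δ A)) :=
      tendsto_nhdsWithin_of_tendsto_nhds (Continuous.tendsto (by fun_prop) A)
    have h2 : δ A = 0 := by simp [hδ]
    rw [h2] at h1
    have h3 := ENNReal.Tendsto.const_mul (a := K) (ENNReal.tendsto_ofReal h1) (Or.inr hK)
    simpa using h3
  have hnorm : Tendsto (fun B => normVolume (-B⁻¹)) (𝓝[hyperbolicGram (m + 2)] A) (𝓝 0) := by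
    refine tendsto_of_tendsto_of_tendsto_of_le_of_le' tendsto_const_nhds hδ0
      (Eventually.of_forall fun _ => bot_le) ?_
    filter_upwards [self_mem_nhdsWithin] with B hB
    have hB' := isHyperbolicMatrix_of_mem hn hB
    refine (hbound _ hB'.lorentzian fun i => ?_).trans ?_
    · rw [hB'.inv_neg_inv]; simp [hB'.diag]
    · gcongr
      rw [← Real.sqrt_inv]
      exact Real.sqrt_le_sqrt (hB'.inv_sum_le hpsd)
  have hreal := ((ENNReal.tendsto_toReal ENNReal.zero_ne_top).comp hnorm).const_mul
    (((m + 2 : ℕ) : ℝ) + 1)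
  rw [ENNReal.toReal_zero, mul_zero] at hreal
  refine hreal.congr' ?_
  filter_upwards [self_mem_nhdsWithin] with B hB
  exact (gramVolume_of_not_posSemidef (isHyperbolicMatrix_of_mem hn hB).not_posSemidef).symm

lemma inv_nonneg_of_mem_closure (hn : 2 ≤ n) {A : Matrix (Fin (n + 1)) (Fin (n + 1)) ℝ}
    (hA : A ∈ closure (hyperbolicGram n)) (hdet : A.det ≠ 0) (i j : Fin (n + 1)) :
    0 ≤ (-A⁻¹) i j := by
  have : (𝓝[hyperbolicGram n] A).NeBot := mem_closure_iff_nhdsWithin_neBot.1 hA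
  have h1 : Tendsto (fun B : Matrix (Fin (n + 1)) (Fin (n + 1)) ℝ => (-B⁻¹) i j)
      (𝓝[hyperbolicGram n] A) (𝓝 ((-A⁻¹) i j)) :=
    ((continuous_id.matrix_elem i j).tendsto _).comp
      ((tendsto_matrix_inv hdet).neg.mono_left nhdsWithin_le_nhds)
  refine ge_of_tendsto h1 ?_
  filter_upwards [self_mem_nhdsWithin] with B hB
  exact ((isHyperbolicMatrix_of_mem hn hB).lorentzian.pos i j).le

lemma normVolume_ne_top_of_mem_closure (hn : 2 ≤ n) {A : Matrix (Fin (n + 1)) (Fin (n + 1)) ℝ}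
    (hA : A ∈ closure (hyperbolicGram n)) (hpsd : ¬ A.PosSemidef) : normVolume (-A⁻¹) ≠ ⊤ := by
  have hweak := isWeaklyHyperbolic_of_mem_closure hn hA
  have hdet := hweak.det_ne_zero hpsd
  have hnonneg := inv_nonneg_of_mem_closure hn hA hdet
  exact ENNReal.mul_ne_top ENNReal.ofReal_ne_top (volume_orthantBody_lt_top (by omega)
    (fun i => hnonneg i i) fun i j hij =>
      hweak.off_diagonal_pos (by omega) hdet hnonneg hij).ne

/-- Inversion is continuous at `A`, and positivity of the limiting off-diagonal entries allows
dominated convergence even when vertices become ideal. -/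
lemma tendsto_gramVolume_hyperbolic (hn : 2 ≤ n) {A : Matrix (Fin (n + 1)) (Fin (n + 1)) ℝ}
    (hA : A ∈ closure (hyperbolicGram n)) (hpsd : ¬ A.PosSemidef) :
    Tendsto (gramVolume n) (𝓝[hyperbolicGram n] A) (𝓝 (gramVolume n A)) := by
  have hweak := isWeaklyHyperbolic_of_mem_closure hn hA
  have hdet := hweak.det_ne_zero hpsd
  have hnonneg := inv_nonneg_of_mem_closure hn hA hdet
  have hoff : ∀ i j, i ≠ j → 0 < (-A⁻¹) i j := fun i j hij =>
    hweak.off_diagonal_pos (by omega) hdet hnonneg hij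
  have hC : Tendsto (fun B : Matrix (Fin (n + 1)) (Fin (n + 1)) ℝ => -B⁻¹)
      (𝓝[hyperbolicGram n] A) (𝓝 (-A⁻¹)) :=
    (tendsto_matrix_inv hdet).neg.mono_left nhdsWithin_le_nhds
  have hvol := tendsto_volume_orthantBody (by omega) hC (by
    filter_upwards [self_mem_nhdsWithin] with B hB i
    exact ((isHyperbolicMatrix_of_mem hn hB).lorentzian.pos i i).le) (fun i => hnonneg i i) hoff
  have hfin : volume (orthantBody (-A⁻¹)) ≠ ⊤ :=
    (volume_orthantBody_lt_top (by omega) (fun i => hnonneg i i) hoff).ne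
  have hdetC : Tendsto (fun B : Matrix (Fin (n + 1)) (Fin (n + 1)) ℝ =>
      ENNReal.ofReal √|(-B⁻¹).det|) (𝓝[hyperbolicGram n] A)
      (𝓝 (ENNReal.ofReal √|(-A⁻¹).det|)) :=
    ENNReal.tendsto_ofReal (((continuous_id.matrix_det.tendsto _).comp hC).abs.sqrt)
  have hnorm : Tendsto (fun B => normVolume (-B⁻¹)) (𝓝[hyperbolicGram n] A)
      (𝓝 (normVolume (-A⁻¹))) :=
    ENNReal.Tendsto.mul hdetC (Or.inr hfin) hvol (Or.inr ENNReal.ofReal_ne_top)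
  have hreal := ((ENNReal.tendsto_toReal (normVolume_ne_top_of_mem_closure hn hA hpsd)).comp
    hnorm).const_mul ((n : ℝ) + 1)
  rw [gramVolume_of_not_posSemidef hpsd]
  refine hreal.congr' ?_
  filter_upwards [self_mem_nhdsWithin] with B hB
  exact (gramVolume_of_not_posSemidef (isHyperbolicMatrix_of_mem hn hB).not_posSemidef).symm

/-- The volume of simplexes converges at every limit of angle Gram matrices. -/
lemma tendsto_gramVolume (hn : 2 ≤ n) (A : Matrix (Fin (n + 1)) (Fin (n + 1)) ℝ) :
    Tendsto (gramVolume n) (𝓝[sphericalGram n ∪ hyperbolicGram n] A) (𝓝 (gramVolume n A)) := by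
  rw [nhdsWithin_union]
  refine Tendsto.sup ?_ ?_
  · by_cases hA : A ∈ closure (sphericalGram n)
    · exact tendsto_gramVolume_spherical hA
    · rw [mem_closure_iff_nhdsWithin_neBot, not_neBot] at hA
      rw [hA]; exact tendsto_bot
  · by_cases hA : A ∈ closure (hyperbolicGram n)
    · by_cases hpsd : A.PosSemidef
      · exact tendsto_gramVolume_euclidean hn hA hpsd
      · exact tendsto_gramVolume_hyperbolic hn hA hpsd
    · rw [mem_closure_iff_nhdsWithin_neBot, not_neBot] at hA
      rw [hA]; exact tendsto_bot

lemma HasSphericalGram.gramVolume_eq {u : Fin (n + 1) → EuclideanSpace ℝ (Fin (n + 1))}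
    {A : Matrix (Fin (n + 1)) (Fin (n + 1)) ℝ} (h : HasSphericalGram u A) :
    gramVolume n A = sphericalVolume u := by
  rw [gramVolume_of_posSemidef h.volume_eq.1, h.volume_eq.2.2]

lemma HasHyperbolicGram.gramVolume_eq (hn : 2 ≤ n) {u : Fin (n + 1) → Minkowski n}
    {A : Matrix (Fin (n + 1)) (Fin (n + 1)) ℝ} (h : HasHyperbolicGram u A) :
    gramVolume n A = hyperbolicVolume u := by
  rw [gramVolume_of_not_posSemidef (h.exists_dual hn).1.not_posSemidef, h.volume_eq hn]

lemma exists_isExtendedVolume (hn : 2 ≤ n) : ∃ V, IsExtendedVolume n V := by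
  set D := sphericalGram n ∪ hyperbolicGram n with hD
  have heq : ∀ A ∈ D, extendFrom D (gramVolume n) A = gramVolume n A := fun A hA =>
    extendFrom_eq (subset_closure hA) (tendsto_gramVolume hn A)
  refine ⟨extendFrom D (gramVolume n), ⟨?_, fun u A h => ?_, fun u A h => ?_⟩⟩
  · rw [← closure_union]
    exact continuousOn_extendFrom subset_rfl fun A _ => ⟨_, tendsto_gramVolume hn A⟩
  · rw [heq A (Or.inl ⟨u, h⟩), h.gramVolume_eq]
  · rw [heq A (Or.inr ⟨u, h⟩), h.gramVolume_eq hn]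

/-- The continuous extension of the volume is unique. -/
lemma IsExtendedVolume.eq_gramVolume (hn : 2 ≤ n) {V : Matrix (Fin (n + 1)) (Fin (n + 1)) ℝ → ℝ}
    (hV : IsExtendedVolume n V) {A : Matrix (Fin (n + 1)) (Fin (n + 1)) ℝ}
    (hA : A ∈ closure (sphericalGram n) ∪ closure (hyperbolicGram n)) : V A = gramVolume n A := by
  have hcont := hV.continuousOn A hA
  rw [← closure_union] at hA
  have : (𝓝[sphericalGram n ∪ hyperbolicGram n] A).NeBot := mem_closure_iff_nhdsWithin_neBot.1 hA
  have h1 : Tendsto V (𝓝[sphericalGram n ∪ hyperbolicGram n] A) (𝓝 (V A)) :=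
    hcont.mono_left (nhdsWithin_mono A (Set.union_subset_union subset_closure subset_closure))
  refine tendsto_nhds_unique h1 ((tendsto_gramVolume hn A).congr' ?_)
  filter_upwards [self_mem_nhdsWithin] with B hB
  rcases hB with ⟨u, hu⟩ | ⟨u, hu⟩
  · rw [hV.spherical u B hu, hu.gramVolume_eq]
  · rw [hV.hyperbolic u B hu, hu.gramVolume_eq hn]

/-- In the semidefinite case both sides amount to a nonnegative null vector. Otherwise `A` is a
limit of hyperbolic matrices with positive finite volume, and it is not a limit of Euclidean ones
since these are semidefinite. -/
lemma gramVolume_eq_zero_iff_mem_closure (hn : 2 ≤ n)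
    {A : Matrix (Fin (n + 1)) (Fin (n + 1)) ℝ}
    (hA : A ∈ closure (sphericalGram n) ∪ closure (hyperbolicGram n)) :
    gramVolume n A = 0 ↔ A ∈ closure (euclideanGram n) := by
  by_cases hpsd : A.PosSemidef
  · have hdiag : ∀ i, A i i = 1 := by
      rcases hA with h | h
      · exact (posSemidef_of_mem_closure_sphericalGram h).2
      · exact (isWeaklyHyperbolic_of_mem_closure hn h).diag
    rw [gramVolume_eq_zero_iff hpsd hdiag]
    exact ⟨fun ⟨y, hy, h⟩ => mem_closure_euclideanGram hpsd hdiag hy h,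
      fun h => (posSemidef_of_mem_closure_euclideanGram h).2⟩
  · have hA' : A ∈ closure (hyperbolicGram n) :=
      hA.resolve_left fun h => hpsd (posSemidef_of_mem_closure_sphericalGram h).1
    refine iff_of_false ?_ fun h => hpsd (posSemidef_of_mem_closure_euclideanGram h).1
    have hdet := (isWeaklyHyperbolic_of_mem_closure hn hA').det_ne_zero hpsd
    have hpos : normVolume (-A⁻¹) ≠ 0 := by
      refine mul_ne_zero ?_ (volume_orthantBody_pos _).ne'
      rw [Ne, ENNReal.ofReal_eq_zero, not_le]
      refine Real.sqrt_pos.2 (abs_pos.2 ?_)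
      rw [det_neg, det_nonsing_inv, Ring.inverse_eq_inv']
      exact mul_ne_zero (pow_ne_zero _ (by norm_num)) (inv_ne_zero hdet)
    rw [gramVolume_of_not_posSemidef hpsd]
    exact mul_ne_zero (by positivity)
      (ENNReal.toReal_ne_zero.2 ⟨hpos, normVolume_ne_top_of_mem_closure hn hA' hpsd⟩)

end Extension

end SimplexVolume

theorem theorem1 (n : ℕ) (hn : 2 ≤ n) :
    (∃ V : Matrix (Fin (n + 1)) (Fin (n + 1)) ℝ → ℝ, SimplexVolume.IsExtendedVolume n V) ∧
    ∀ V : Matrix (Fin (n + 1)) (Fin (n + 1)) ℝ → ℝ, SimplexVolume.IsExtendedVolume n V →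
      ∀ A ∈ closure (SimplexVolume.sphericalGram n) ∪ closure (SimplexVolume.hyperbolicGram n),
        V A = 0 ↔ A ∈ closure (SimplexVolume.euclideanGram n) := by
  refine ⟨SimplexVolume.exists_isExtendedVolume hn, fun V hV A hA => ?_⟩
  rw [hV.eq_gramVolume hn hA]
  exact SimplexVolume.gramVolume_eq_zero_iff_mem_closure hn hA
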